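/- **Definitions.** A function $F:[0,\infty)^4\to[0,\infty)$ is *permissible* if it is nondecreasing for the coordinatewise order and $x\,l_y+y\,l_x\le F(x,y,l_x,l_y)$ for all $x,y,l_x,l_y\ge 0$. For a nonzero unital C*-algebra $\mathfrak A$, let $\mathfrak{sa}(\mathfrak A)$ be its self-adjoint part and $\mathscr S(\mathfrak A)$ its state space. Given a seminorm $\mathsf L$ defined on a subspace $\mathrm{dom}(\mathsf L)$ of $\mathfrak{sa}(\mathfrak A)$, and extended by $\infty$ to $\mathfrak{sa}(\mathfrak A)$, let $\mathsf{mk}_{\mathsf L}(\varphi,\psi)=\sup\{|\varphi(a)-\psi(a)|:\mathsf L(a)\le 1\}$. We call $\mathsf L$ a *Lip-norm* if its domain is dense, $\{\mathsf L=0\}=\mathbb R1_{\mathfrak A}$, and $\mathsf{mk}_{\mathsf L}$ induces the weak* topology on $\mathscr S(\mathfrak A)$. The pair $(\mathfrak A,\mathsf L)$ is an *$F$-quasi-Leibniz quantum compact metric space* ($F$-QQCMS) if $\mathsf L$ is a Lip-norm, $\{a:\mathsf L(a)\le 1\}$ is norm closed, $\mathrm{dom}(\mathsf L)$ is closed under the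 Jordan product $\frac{ab+ba}{2}$ and the Lie product $\frac{ab-ba}{2i}$, and the values of $\mathsf L$ at both products are at most $F(\|a\|,\|b\|,\mathsf L(a),\mathsf L(b))$ for all $a,b\in\mathrm{dom}(\mathsf L)$. An *isometric isomorphism* $(\mathfrak A,\mathsf L_{\mathfrak A})\to(\mathfrak B,\mathsf L_{\mathfrak B})$ is a *-isomorphism $h:\mathfrak A\to\mathfrak B$ whose dual map $\varphi\mapsto\varphi\circ h$ is an isometry from $(\mathscr S(\mathfrak B),\mathsf{mk}_{\mathsf L_{\mathfrak B}})$ onto $(\mathscr S(\mathfrak A),\mathsf{mk}_{\mathsf L_{\mathfrak A}})$. An *$F$-tunnel* $\tau=(\mathfrak D,\mathsf L_{\mathfrak D},\pi_1,\pi_2)$ between $F$-QQCMSs $(\mathfrak A_1,\mathsf L_1)$ and $(\mathfrak A_2,\mathsf L_2)$ is an $F$-QQCMS $(\mathfrak D,\mathsf L_{\mathfrak D})$ with surjective *-morphisms $\pi_j:\mathfrak D\to\mathfrak A_j$ such that $\mathsf L_j(a)=\inf\{\mathsf L_{\mathfrak D}(d):d\in\mathfrak{sa}(\mathfrak D),\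 \pi_j(d)=a\}$ for all $a\in\mathfrak{sa}(\mathfrak A_j)$, $j=1,2$. Its *extent* $\chi(\tau)$ is the maximum over $j$ of the $\mathsf{mk}_{\mathsf L_{\mathfrak D}}$-Hausdorff distance between $\mathscr S(\mathfrak D)$ and $\{\varphi\circ\pi_j:\varphi\in\mathscr S(\mathfrak A_j)\}$. For a class $\mathcal C$ of $F$-QQCMSs, a class $\mathcal T$ of $F$-tunnels is *$(\mathcal C,F)$-appropriate* if: any two members of $\mathcal C$ are joined by a tunnel in $\mathcal T$; for each isometric isomorphism $h:(\mathfrak A,\mathsf L_{\mathfrak A})\to(\mathfrak B,\mathsf L_{\mathfrak B})$ between members of $\mathcal C$, both $(\mathfrak A,\mathsf L_{\mathfrak A},\mathrm{id},h)$ and $(\mathfrak B,\mathsf L_{\mathfrak B},h^{-1},\mathrm{id})$ are in $\mathcal T$; $\mathcal T$ is closed under inversion $(\mathfrak D,\mathsf L,\pi,\rho)\mapsto(\mathfrak D,\mathsf L,\rho,\pi)$; all tunnels in $\mathcal T$ join members of $\mathcal C$; and for every $\varepsilon>0$, whenever $(\mathfrak D_1,\mathsf L_1,\pi_1,\pi_2)\in\mathcal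 T$ goes from $(\mathfrak A,\mathsf L_{\mathfrak A})$ to $(\mathfrak B,\mathsf L_{\mathfrak B})$ and $(\mathfrak D_2,\mathsf L_2,\rho_1,\rho_2)\in\mathcal T$ goes from $(\mathfrak B,\mathsf L_{\mathfrak B})$ to $(\mathfrak E,\mathsf L_{\mathfrak E})$, the class $\mathcal T$ contains the tunnel on $\mathfrak D_1\oplus\mathfrak D_2$ with Lip-norm $\max\{\mathsf L_1(d_1),\mathsf L_2(d_2),\frac1\varepsilon\|\pi_2(d_1)-\rho_1(d_2)\|\}$ and maps $(d_1,d_2)\mapsto\pi_1(d_1)$, $(d_1,d_2)\mapsto\rho_2(d_2)$. The *$\mathcal T$-dual propinquity* $\Lambda^*_{\mathcal T}$ is the infimum of the extents of the tunnels in $\mathcal T$ between two given spaces; $\Lambda^*_F$ is the one for the class of all $F$-tunnels. Finally, $\mathrm{dist}_q$ is Rieffel's quantum Gromov–Hausdorff distance: the infimum of the $\mathsf{mk}_{\mathsf L}$-Hausdorff distances between (the images in $\mathscr S(\mathfrak A\oplus\mathfrak B)$ of) $\mathscr S(\mathfrak A)$ and $\mathscr S(\mathfrak B)$, over all Lip-norms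 $\mathsf L$ on $\mathfrak A\oplus\mathfrak B$ with domain $\mathrm{dom}(\mathsf L_{\mathfrak A})\oplus\mathrm{dom}(\mathsf L_{\mathfrak B})$ whose quotients to $\mathfrak A$ and $\mathfrak B$ are $\mathsf L_{\mathfrak A}$ and $\mathsf L_{\mathfrak B}$. **Theorem.** Let $F$ be permissible. (a) Let $\mathcal C$ be a nonempty class of $F$-QQCMSs and $\mathcal T$ a $(\mathcal C,F)$-appropriate class of $F$-tunnels. Then $\Lambda^*_{\mathcal T}$ is a metric on $\mathcal C$ up to isometric isomorphism: for all members $A,B,E$ of $\mathcal C$, $\Lambda^*_{\mathcal T}(A,B)<\infty$; $\Lambda^*_{\mathcal T}(A,B)=\Lambda^*_{\mathcal T}(B,A)$; $\Lambda^*_{\mathcal T}(A,E)\le\Lambda^*_{\mathcal T}(A,B)+\Lambda^*_{\mathcal T}(B,E)$; and $\Lambda^*_{\mathcal T}(A,B)=0$ if and only if there is an isometric isomorphism between $A$ and $B$. Moreover $\mathrm{dist}_q(A,B)\le\Lambda^*_{\mathcal T}(A,B)$. (b) For all $F$-QQCMSs $(\mathfrak A,\mathsf L_{\mathfrak A})$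 and $(\mathfrak B,\mathsf L_{\mathfrak B})$, $\Lambda^*_F((\mathfrak A,\mathsf L_{\mathfrak A}),(\mathfrak B,\mathsf L_{\mathfrak B}))\le\max\{\mathrm{diam}(\mathscr S(\mathfrak A),\mathsf{mk}_{\mathsf L_{\mathfrak A}}),\mathrm{diam}(\mathscr S(\mathfrak B),\mathsf{mk}_{\mathsf L_{\mathfrak B}})\}$. (c) For all nonempty compact metric spaces $X,Y$ with Lipschitz seminorms $\mathrm{Lip}_X,\mathrm{Lip}_Y$, $\Lambda^*_F((C(X),\mathrm{Lip}_X),(C(Y),\mathrm{Lip}_Y))\le\mathrm{GH}(X,Y)$, where $C(X)$ is the C*-algebra of continuous complex-valued functions on $X$ and $\mathrm{GH}$ is the Gromov–Hausdorff distance. (d) If $F$ is moreover continuous, then $\Lambda^*_F$ is a complete metric (up to isometric isomorphism) on the class of all $F$-QQCMSs: it has the metric properties listed in (a), and every Cauchy sequence of $F$-QQCMSs converges for $\Lambda^*_F$ to an $F$-QQCMS. -/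

import Mathlib

open scoped NNReal ENNReal Topology ComplexOrder

universe u

namespace DualPropinquity

noncomputable section

/-! ### Permissible functions -/

/-- A function `F : [0,∞)⁴ → [0,∞)` is permissible when it is nondecreasing for the coordinatewise
order and `x l_y + y l_x ≤ F (x, y, l_x, l_y)`. -/
def Permissible (F : ℝ≥0 × ℝ≥0 × ℝ≥0 × ℝ≥0 → ℝ≥0) : Prop :=
  Monotone F ∧ ∀ x y lx ly : ℝ≥0, x * ly + y * lx ≤ F (x, y, lx, ly)

/-! ### States, self-adjoint elements, Jordan and Lie products -/

/-- The state space of a unital C⋆-algebra: positive linear functionals with value `1` at the unit.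
As a subset of `WeakDual ℂ A` it carries the weak-⋆ topology. -/
def StateSpace (A : Type u) [CStarAlgebra A] : Set (WeakDual ℂ A) :=
  {φ | (∀ a : A, 0 ≤ φ (star a * a)) ∧ φ 1 = 1}

/-- A unital ⋆-homomorphism, as a continuous linear map. -/
def toCLM {A B : Type u} [CStarAlgebra A] [CStarAlgebra B] (π : A →⋆ₐ[ℂ] B) : A →L[ℂ] B :=
  haveI := NonUnitalStarAlgHom.instContinuousLinearMapClassComplex (F := A →⋆ₐ[ℂ] B) (A := A)
    (B := B)
  ⟨π.toAlgHom.toLinearMap, map_continuous π⟩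

/-- The dual map `φ ↦ φ ∘ π` from the states of `B` to the states of `A`. -/
def dualMap {A B : Type u} [CStarAlgebra A] [CStarAlgebra B] (π : A →⋆ₐ[ℂ] B)
    (φ : StateSpace B) : StateSpace A :=
  ⟨(show B →L[ℂ] ℂ from φ.1).comp (toCLM π), by
    refine ⟨fun a => ?_, ?_⟩
    · have h := φ.2.1 (π a)
      rw [← map_star, ← map_mul] at h
      exact h
    · have h := φ.2.2
      rw [← map_one π] at h
      exact h⟩

theorem dualMap_apply {A B : Type u} [CStarAlgebra A] [CStarAlgebra B] (π : A →⋆ₐ[ℂ] B)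
    (φ : StateSpace B) (a : A) : (dualMap π φ).1 a = φ.1 (π a) := rfl

/-- The map induced by a unital ⋆-homomorphism on self-adjoint elements. -/
def saMap {A B : Type u} [CStarAlgebra A] [CStarAlgebra B] (π : A →⋆ₐ[ℂ] B)
    (a : selfAdjoint A) : selfAdjoint B :=
  ⟨π a, IsSelfAdjoint.map a.2 π⟩

/-- The Jordan product `(ab + ba) / 2` of self-adjoint elements. -/
def jordan {A : Type u} [CStarAlgebra A] (a b : selfAdjoint A) : selfAdjoint A :=
  ⟨(1 / 2 : ℂ) • ((a : A) * b + b * a), by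
    rw [selfAdjoint.mem_iff]
    have ha : star (a : A) = a := a.2
    have hb : star (b : A) = b := b.2
    simp [star_smul, ha, hb, add_comm]⟩

/-- The Lie product `(ab - ba) / (2i)` of self-adjoint elements. -/
def lie {A : Type u} [CStarAlgebra A] (a b : selfAdjoint A) : selfAdjoint A :=
  ⟨(1 / (2 * Complex.I) : ℂ) • ((a : A) * b - b * a), by
    rw [selfAdjoint.mem_iff]
    have ha : star (a : A) = a := a.2
    have hb : star (b : A) = b := b.2
    rw [star_smul, star_sub, star_mul, star_mul, ha, hb]
    have hc : star (1 / (2 * Complex.I) : ℂ) = -(1 / (2 * Complex.I)) := by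
      simp
    rw [hc, neg_smul, ← smul_neg, neg_sub]⟩

/-! ### Seminorms defined on a subspace -/

/-- A seminorm defined on a linear subspace of a real vector space `V`, extended by `∞` outside of
that subspace (with `0 * ∞ = 0`). -/
structure ExtSeminorm (V : Type u) [AddCommGroup V] [Module ℝ V] where
  toFun : V → ℝ≥0∞
  map_smul' : ∀ (r : ℝ) (v : V), toFun (r • v) = ‖r‖ₑ * toFun v
  map_add_le' : ∀ v w : V, toFun (v + w) ≤ toFun v + toFun w

instance (V : Type u) [AddCommGroup V] [Module ℝ V] : CoeFun (ExtSeminorm V) fun _ => V → ℝ≥0∞ :=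
  ⟨ExtSeminorm.toFun⟩

/-- The domain of an extended seminorm: the subspace on which it is finite. -/
def ExtSeminorm.dom {V : Type u} [AddCommGroup V] [Module ℝ V] (L : ExtSeminorm V) : Set V :=
  {v | L v < ∞}

/-! ### The Monge-Kantorovich metric -/

/-- The Monge-Kantorovich distance between two states associated with `L`. -/
def mkDist {A : Type u} [CStarAlgebra A] (L : ExtSeminorm (selfAdjoint A))
    (φ ψ : StateSpace A) : ℝ≥0∞ :=
  ⨆ (a : selfAdjoint A) (_ : L a ≤ 1), ‖φ.1 (a : A) - ψ.1 (a : A)‖ₑ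

/-- `mkDist L`, as an extended pseudo-metric on the state space, with the topology it induces. -/
abbrev mkMetric {A : Type u} [CStarAlgebra A] (L : ExtSeminorm (selfAdjoint A)) :
    PseudoEMetricSpace (StateSpace A) where
  edist := mkDist L
  edist_self φ := by simp [mkDist]
  edist_comm φ ψ := by simp only [mkDist, ← edist_eq_enorm_sub, edist_comm]
  edist_triangle φ ψ θ := by
    refine iSup₂_le fun a ha => ?_
    rw [← edist_eq_enorm_sub]
    refine (edist_triangle _ (ψ.1 (a : A)) _).trans (add_le_add ?_ ?_)
    · rw [edist_eq_enorm_sub]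
      exact le_iSup₂ (f := fun (a : selfAdjoint A) (_ : L a ≤ 1) =>
        ‖φ.1 (a : A) - ψ.1 (a : A)‖ₑ) a ha
    · rw [edist_eq_enorm_sub]
      exact le_iSup₂ (f := fun (a : selfAdjoint A) (_ : L a ≤ 1) =>
        ‖ψ.1 (a : A) - θ.1 (a : A)‖ₑ) a ha

/-- The Hausdorff distance associated with the Monge-Kantorovich metric. -/
def mkHaus {A : Type u} [CStarAlgebra A] (L : ExtSeminorm (selfAdjoint A))
    (S T : Set (StateSpace A)) : ℝ≥0∞ :=
  @Metric.hausdorffEDist _ (mkMetric L) S T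

/-- The diameter of the state space for the Monge-Kantorovich metric. -/
def mkDiam {A : Type u} [CStarAlgebra A] (L : ExtSeminorm (selfAdjoint A)) : ℝ≥0∞ :=
  @Metric.ediam _ (mkMetric L) Set.univ

/-- `L` is a Lip-norm: it has dense domain, vanishes exactly on the real multiples of the unit, and
its Monge-Kantorovich metric induces the weak-⋆ topology on the state space. -/
structure IsLipNorm {A : Type u} [CStarAlgebra A] (L : ExtSeminorm (selfAdjoint A)) : Prop where
  dense_dom : Dense L.dom
  eq_zero_iff : ∀ a : selfAdjoint A, L a = 0 ↔ ∃ r : ℝ, a = r • (1 : selfAdjoint A)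
  topology_eq : (mkMetric L).toUniformSpace.toTopologicalSpace =
    (inferInstance : TopologicalSpace (StateSpace A))

/-! ### Quasi-Leibniz quantum compact metric spaces -/

/-- A pair `(A, L)` of a unital C⋆-algebra and a seminorm defined on a subspace of its self-adjoint
part. -/
structure Pair : Type (u + 1) where
  carrier : Type u
  [cstar : CStarAlgebra carrier]
  lip : ExtSeminorm (selfAdjoint carrier)

instance : CoeSort Pair.{u} (Type u) := ⟨Pair.carrier⟩

instance (𝔄 : Pair.{u}) : CStarAlgebra 𝔄 := 𝔄.cstar

/-- `(A, L)` is an `F`-quasi-Leibniz quantum compact metric space. The last two conditions contain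
the fact that the domain of `L` is closed under the Jordan and Lie products, as `F` has finite
values. -/
structure IsQQCMS (F : ℝ≥0 × ℝ≥0 × ℝ≥0 × ℝ≥0 → ℝ≥0) (𝔄 : Pair.{u}) : Prop where
  nontrivial : Nontrivial 𝔄
  isLipNorm : IsLipNorm 𝔄.lip
  isClosed : IsClosed {a : selfAdjoint 𝔄 | 𝔄.lip a ≤ 1}
  jordan_le : ∀ a ∈ 𝔄.lip.dom, ∀ b ∈ 𝔄.lip.dom, 𝔄.lip (jordan a b) ≤
    F (‖a‖₊, ‖b‖₊, (𝔄.lip a).toNNReal, (𝔄.lip b).toNNReal)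
  lie_le : ∀ a ∈ 𝔄.lip.dom, ∀ b ∈ 𝔄.lip.dom, 𝔄.lip (lie a b) ≤
    F (‖a‖₊, ‖b‖₊, (𝔄.lip a).toNNReal, (𝔄.lip b).toNNReal)

/-- A ⋆-isomorphism is an isometric isomorphism when its dual map is an isometry of the state space
of the codomain onto the state space of the domain, for the Monge-Kantorovich metrics. -/
def IsIsometricIso {𝔄 𝔅 : Pair.{u}} (h : 𝔄 ≃⋆ₐ[ℂ] 𝔅) : Prop :=
  (∀ φ ψ : StateSpace 𝔅, mkDist 𝔄.lip (dualMap h.toStarAlgHom φ) (dualMap h.toStarAlgHom ψ) =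
    mkDist 𝔅.lip φ ψ) ∧
  Function.Surjective (dualMap (h.toStarAlgHom : 𝔄 →⋆ₐ[ℂ] 𝔅))

/-! ### Tunnels -/

/-- The data `(D, L_D, π₁, π₂)` of a tunnel; the conditions are in `IsTunnel`. -/
structure PreTunnel (𝔄 𝔅 : Pair.{u}) : Type (u + 1) where
  mid : Pair.{u}
  left : mid →⋆ₐ[ℂ] 𝔄
  right : mid →⋆ₐ[ℂ] 𝔅

/-- `L` is the quotient of the seminorm `LD` under `π`. -/
def IsQuotient {D A : Type u} [CStarAlgebra D] [CStarAlgebra A]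
    (LD : ExtSeminorm (selfAdjoint D)) (π : D →⋆ₐ[ℂ] A) (L : ExtSeminorm (selfAdjoint A)) : Prop :=
  ∀ a : selfAdjoint A, L a = ⨅ (d : selfAdjoint D) (_ : saMap π d = a), LD d

/-- `τ` is an `F`-tunnel from `𝔄` to `𝔅`. -/
structure IsTunnel (F : ℝ≥0 × ℝ≥0 × ℝ≥0 × ℝ≥0 → ℝ≥0) {𝔄 𝔅 : Pair.{u}} (τ : PreTunnel 𝔄 𝔅) :
    Prop where
  source : IsQQCMS F 𝔄
  target : IsQQCMS F 𝔅
  mid : IsQQCMS F τ.mid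
  left_surjective : Function.Surjective τ.left
  right_surjective : Function.Surjective τ.right
  left_quotient : IsQuotient τ.mid.lip τ.left 𝔄.lip
  right_quotient : IsQuotient τ.mid.lip τ.right 𝔅.lip

/-- The extent of a tunnel. -/
def PreTunnel.extent {𝔄 𝔅 : Pair.{u}} (τ : PreTunnel 𝔄 𝔅) : ℝ≥0∞ :=
  max (mkHaus τ.mid.lip Set.univ (Set.range (dualMap τ.left)))
    (mkHaus τ.mid.lip Set.univ (Set.range (dualMap τ.right)))

/-- The inverse tunnel `(D, L_D, π₂, π₁)`. -/
def PreTunnel.inv {𝔄 𝔅 : Pair.{u}} (τ : PreTunnel 𝔄 𝔅) : PreTunnel 𝔅 𝔄 :=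
  ⟨τ.mid, τ.right, τ.left⟩

/-- The tunnel `(A, L_A, id, h)`. -/
def isoTunnelLeft {𝔄 𝔅 : Pair.{u}} (h : 𝔄 ≃⋆ₐ[ℂ] 𝔅) : PreTunnel 𝔄 𝔅 :=
  ⟨𝔄, StarAlgHom.id ℂ 𝔄, h.toStarAlgHom⟩

/-- The tunnel `(B, L_B, h⁻¹, id)`. -/
def isoTunnelRight {𝔄 𝔅 : Pair.{u}} (h : 𝔄 ≃⋆ₐ[ℂ] 𝔅) : PreTunnel 𝔄 𝔅 :=
  ⟨𝔅, h.symm.toStarAlgHom, StarAlgHom.id ℂ 𝔅⟩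

/-- The seminorm `max (L₁ d₁) (L₂ d₂) (‖π₂ d₁ - ρ₁ d₂‖ / ε)` on the self-adjoint part of
`D₁ ⊕ D₂`. -/
def compLip {𝔄 𝔅 ℭ : Pair.{u}} (τ₁ : PreTunnel 𝔄 𝔅) (τ₂ : PreTunnel 𝔅 ℭ) (ε : ℝ) :
    ExtSeminorm (selfAdjoint (τ₁.mid × τ₂.mid)) where
  toFun d := max (max (τ₁.mid.lip (saMap (StarAlgHom.fst ℂ _ _) d))
      (τ₂.mid.lip (saMap (StarAlgHom.snd ℂ _ _) d)))
    (ENNReal.ofReal (1 / ε) * ‖τ₁.right d.1.1 - τ₂.left d.1.2‖ₑ)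
  map_smul' r d := by
    have h1 : saMap (StarAlgHom.fst ℂ τ₁.mid τ₂.mid) (r • d) =
        r • saMap (StarAlgHom.fst ℂ τ₁.mid τ₂.mid) d := rfl
    have h2 : saMap (StarAlgHom.snd ℂ τ₁.mid τ₂.mid) (r • d) =
        r • saMap (StarAlgHom.snd ℂ τ₁.mid τ₂.mid) d := rfl
    have h3 : τ₁.right (r • d).1.1 - τ₂.left (r • d).1.2 =
        (r : ℂ) • (τ₁.right d.1.1 - τ₂.left d.1.2) := by
      have e1 : (r • d).1.1 = (r : ℂ) • d.1.1 := (Complex.coe_smul r d.1.1).symm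
      have e2 : (r • d).1.2 = (r : ℂ) • d.1.2 := (Complex.coe_smul r d.1.2).symm
      rw [e1, e2, map_smul, map_smul, smul_sub]
    have h4 : ‖(r : ℂ)‖ₑ = ‖r‖ₑ := by
      rw [← ofReal_norm, ← ofReal_norm, Complex.norm_real]
    rw [h1, h2, h3, ExtSeminorm.map_smul', ExtSeminorm.map_smul', enorm_smul, h4, mul_max, mul_max,
      mul_left_comm]
  map_add_le' d d' := by
    have h1 : saMap (StarAlgHom.fst ℂ τ₁.mid τ₂.mid) (d + d') =
        saMap (StarAlgHom.fst ℂ τ₁.mid τ₂.mid) d + saMap (StarAlgHom.fst ℂ τ₁.mid τ₂.mid) d' := rfl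
    have h2 : saMap (StarAlgHom.snd ℂ τ₁.mid τ₂.mid) (d + d') =
        saMap (StarAlgHom.snd ℂ τ₁.mid τ₂.mid) d + saMap (StarAlgHom.snd ℂ τ₁.mid τ₂.mid) d' := rfl
    have h3 : τ₁.right (d + d').1.1 - τ₂.left (d + d').1.2 =
        (τ₁.right d.1.1 - τ₂.left d.1.2) + (τ₁.right d'.1.1 - τ₂.left d'.1.2) := by
      have e1 : (d + d').1.1 = d.1.1 + d'.1.1 := rfl
      have e2 : (d + d').1.2 = d.1.2 + d'.1.2 := rfl
      rw [e1, e2, map_add, map_add]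
      abel
    rw [h1, h2, h3]
    refine max_le (max_le ?_ ?_) ?_
    · exact (ExtSeminorm.map_add_le' _ _ _).trans (add_le_add
        ((le_max_left _ _).trans (le_max_left _ _)) ((le_max_left _ _).trans (le_max_left _ _)))
    · exact (ExtSeminorm.map_add_le' _ _ _).trans (add_le_add
        ((le_max_right _ _).trans (le_max_left _ _)) ((le_max_right _ _).trans (le_max_left _ _)))
    · refine (mul_le_mul_right (enorm_add_le _ _) _).trans ?_
      rw [mul_add]
      exact add_le_add (le_max_right _ _) (le_max_right _ _)

/-- The `ε`-composition of two tunnels. -/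
def PreTunnel.comp {𝔄 𝔅 ℭ : Pair.{u}} (τ₁ : PreTunnel 𝔄 𝔅) (τ₂ : PreTunnel 𝔅 ℭ) (ε : ℝ) :
    PreTunnel 𝔄 ℭ where
  mid := ⟨τ₁.mid × τ₂.mid, compLip τ₁ τ₂ ε⟩
  left := τ₁.left.comp (StarAlgHom.fst ℂ τ₁.mid τ₂.mid)
  right := τ₂.right.comp (StarAlgHom.snd ℂ τ₁.mid τ₂.mid)

/-- A class of tunnels, given by the tunnels in the class from `𝔄` to `𝔅`, for all `𝔄` and `𝔅`. -/
abbrev TunnelClass : Type (u + 1) := ∀ 𝔄 𝔅 : Pair.{u}, Set (PreTunnel 𝔄 𝔅)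

/-- The class of all `F`-tunnels. -/
def allTunnels (F : ℝ≥0 × ℝ≥0 × ℝ≥0 × ℝ≥0 → ℝ≥0) : TunnelClass.{u} :=
  fun _ _ => {τ | IsTunnel F τ}

/-- `𝒯` is a `(𝒞, F)`-appropriate class of `F`-tunnels. -/
structure IsAppropriate (F : ℝ≥0 × ℝ≥0 × ℝ≥0 × ℝ≥0 → ℝ≥0) (𝒞 : Set Pair.{u})
    (𝒯 : TunnelClass.{u}) : Prop where
  isTunnel : ∀ (𝔄 𝔅 : Pair.{u}), ∀ τ ∈ 𝒯 𝔄 𝔅, IsTunnel F τ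
  connected : ∀ 𝔄 ∈ 𝒞, ∀ 𝔅 ∈ 𝒞, (𝒯 𝔄 𝔅).Nonempty
  iso_mem : ∀ 𝔄 ∈ 𝒞, ∀ 𝔅 ∈ 𝒞, ∀ h : 𝔄 ≃⋆ₐ[ℂ] 𝔅, IsIsometricIso h →
    isoTunnelLeft h ∈ 𝒯 𝔄 𝔅 ∧ isoTunnelRight h ∈ 𝒯 𝔄 𝔅
  inv_mem : ∀ (𝔄 𝔅 : Pair.{u}), ∀ τ ∈ 𝒯 𝔄 𝔅, τ.inv ∈ 𝒯 𝔅 𝔄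
  ends_mem : ∀ 𝔄 𝔅 : Pair.{u}, (𝒯 𝔄 𝔅).Nonempty → 𝔄 ∈ 𝒞 ∧ 𝔅 ∈ 𝒞
  comp_mem : ∀ (𝔄 𝔅 ℭ : Pair.{u}), ∀ τ₁ ∈ 𝒯 𝔄 𝔅, ∀ τ₂ ∈ 𝒯 𝔅 ℭ, ∀ ε : ℝ, 0 < ε →
    τ₁.comp τ₂ ε ∈ 𝒯 𝔄 ℭ

/-! ### The dual propinquity and the quantum Gromov-Hausdorff distance -/

/-- The `𝒯`-dual Gromov-Hausdorff propinquity. -/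
def propinquity (𝒯 : TunnelClass.{u}) (𝔄 𝔅 : Pair.{u}) : ℝ≥0∞ :=
  ⨅ τ ∈ 𝒯 𝔄 𝔅, τ.extent

/-- `Λ` is a metric on the class `𝒞`, up to isometric isomorphism. -/
structure IsMetricOn (𝒞 : Set Pair.{u}) (Λ : Pair.{u} → Pair.{u} → ℝ≥0∞) : Prop where
  finite : ∀ 𝔄 ∈ 𝒞, ∀ 𝔅 ∈ 𝒞, Λ 𝔄 𝔅 < ∞
  symm : ∀ 𝔄 ∈ 𝒞, ∀ 𝔅 ∈ 𝒞, Λ 𝔄 𝔅 = Λ 𝔅 𝔄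
  triangle : ∀ 𝔄 ∈ 𝒞, ∀ 𝔅 ∈ 𝒞, ∀ 𝔇 ∈ 𝒞, Λ 𝔄 𝔇 ≤ Λ 𝔄 𝔅 + Λ 𝔅 𝔇
  eq_zero_iff : ∀ 𝔄 ∈ 𝒞, ∀ 𝔅 ∈ 𝒞, Λ 𝔄 𝔅 = 0 ↔ ∃ h : 𝔄 ≃⋆ₐ[ℂ] 𝔅, IsIsometricIso h

/-- `Λ` is complete on `𝒞`: every Cauchy sequence in `𝒞` has a limit in `𝒞`. -/
def IsCompleteOn (𝒞 : Set Pair.{u}) (Λ : Pair.{u} → Pair.{u} → ℝ≥0∞) : Prop :=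
  ∀ 𝔄 : ℕ → Pair.{u}, (∀ n, 𝔄 n ∈ 𝒞) →
    (∀ ε : ℝ≥0∞, 0 < ε → ∃ N, ∀ m ≥ N, ∀ n ≥ N, Λ (𝔄 m) (𝔄 n) < ε) →
    ∃ 𝔅 ∈ 𝒞, Filter.Tendsto (fun n => Λ (𝔄 n) 𝔅) Filter.atTop (𝓝 0)

/-- The Lip-norms on `A ⊕ B`, finite exactly on `dom L_A ⊕ dom L_B`, which induce `L_A` and `L_B` as
quotients (Rieffel). -/
structure IsAdmissible (𝔄 𝔅 : Pair.{u}) (L : ExtSeminorm (selfAdjoint (𝔄 × 𝔅))) : Prop where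
  isLipNorm : IsLipNorm L
  mem_dom_iff : ∀ d : selfAdjoint (𝔄 × 𝔅), d ∈ L.dom ↔
    saMap (StarAlgHom.fst ℂ 𝔄 𝔅) d ∈ 𝔄.lip.dom ∧ saMap (StarAlgHom.snd ℂ 𝔄 𝔅) d ∈ 𝔅.lip.dom
  left_quotient : IsQuotient L (StarAlgHom.fst ℂ 𝔄 𝔅) 𝔄.lip
  right_quotient : IsQuotient L (StarAlgHom.snd ℂ 𝔄 𝔅) 𝔅.lip

/-- Rieffel's quantum Gromov-Hausdorff distance. -/
def distq (𝔄 𝔅 : Pair.{u}) : ℝ≥0∞ :=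
  ⨅ (L : ExtSeminorm (selfAdjoint (𝔄 × 𝔅))) (_ : IsAdmissible 𝔄 𝔅 L),
    mkHaus L (Set.range (dualMap (StarAlgHom.fst ℂ 𝔄 𝔅)))
      (Set.range (dualMap (StarAlgHom.snd ℂ 𝔄 𝔅)))

/-! ### Classical compact metric spaces -/

/-- The Lipschitz seminorm on the self-adjoint part of `C(X, ℂ)`. -/
def lipSeminorm (X : Type u) [MetricSpace X] [CompactSpace X] :
    ExtSeminorm (selfAdjoint C(X, ℂ)) where
  toFun f := ⨆ (x : X) (y : X) (_ : x ≠ y), edist (f.1 x) (f.1 y) / edist x y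
  map_smul' r f := by
    simp only [ENNReal.mul_iSup]
    refine iSup_congr fun x => iSup_congr fun y => iSup_congr fun _ => ?_
    have h : edist ((r • f).1 x) ((r • f).1 y) = ‖r‖ₑ * edist (f.1 x) (f.1 y) := by
      rw [edist_eq_enorm_sub, edist_eq_enorm_sub, ← enorm_smul, smul_sub]
      rfl
    rw [h, mul_div_assoc]
  map_add_le' f g := by
    refine iSup_le fun x => iSup_le fun y => iSup_le fun hxy => ?_
    have h : edist ((f + g).1 x) ((f + g).1 y) ≤
        edist (f.1 x) (f.1 y) + edist (g.1 x) (g.1 y) :=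
      edist_add_add_le _ _ _ _
    refine (ENNReal.div_le_div_right h _).trans ?_
    rw [ENNReal.add_div]
    exact add_le_add
      (le_iSup_of_le x (le_iSup_of_le y (le_iSup_of_le hxy le_rfl)))
      (le_iSup_of_le x (le_iSup_of_le y (le_iSup_of_le hxy le_rfl)))

/-- The pair `(C(X), Lip_X)` of a compact metric space. -/
def classical (X : Type u) [MetricSpace X] [CompactSpace X] : Pair.{u} :=
  ⟨C(X, ℂ), lipSeminorm X⟩

end

end DualPropinquity

open DualPropinquity

/-!
All Hausdorff distances between state spaces are turned into norm estimates. By the Mazur-Orlicz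
form of the Hahn-Banach theorem (`exists_linearMap_le_norm_of_cone`, `exists_state_of_le_norm`), the
states of `D` lie within `r` of the states which factor through `π : D → A` if and only if
`‖d‖ ≤ ‖π d‖ + r * l` whenever `L d ≤ l` (`NormBound`, `mkHaus_range_le_iff`,
`IsTunnel.extent_le_iff`). Lip-norms are recognized by Rieffel's criterion: a seminorm with dense
domain which vanishes at the unit is a Lip-norm as soon as its unit ball is bounded and totally
bounded modulo the scalars (`isLipNorm_of_totallyBounded`), and conversely the closed balls of a
closed Lip-norm which are bounded in norm are compact (`IsLipNorm.isCompact`).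

*Metric property.* The triangle inequality is the estimate `IsTunnel.extent_comp_le` for composed
tunnels. An isometric isomorphism preserves the Lip-norms, because a closed Lip-norm is determined
by its Monge-Kantorovich metric (`le_one_of_mkDist_le`, `IsIsometricIso.lip_eq`); it gives a tunnel
of extent `0`. If tunnels `τ n` from `A` to `B` have extents which tend to `0`, then the pairs of
limits, along a free ultrafilter, of the images of elements of the tunnels with bounded Lip-norms
form a real Jordan-Lie algebra (`Related`). The norm estimates show that both members of a pair have
the same norm, and compactness of the balls that every Lipschitz element of `A` occurs. So the
closure of the complexification of this relation is the graph of a ⋆-isomorphism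
(`exists_starAlgHom_of_graph`, `exists_isIsometricIso`), and it preserves the Lip-norms since these
are closed. A tunnel also induces Lip-norms on `A ⊕ B` which bound the quantum Gromov-Hausdorff
distance by its extent (`distq_le_extent`).

*Explicit tunnels.* The bound by the diameters comes from a Lip-norm on `A ⊕ B` built from the
distance of a pair to the common scalars (`gapTunnel`). For compact metric spaces `X` and `Y`, the
continuous functions on the optimal Gromov-Hausdorff coupling form a tunnel: its restriction maps
are quotients because real Lipschitz functions extend with the same constant
(`isQuotient_restrictHom`).

*Completeness.* After passing to a subsequence, consecutive terms are joined by tunnels `D k` of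
extent at most `2 ^ (-(k + 1))`. In the product of the `D k`, the sequences of bounded Lip-norm
whose coordinates agree in the common quotients of consecutive tunnels are called coherent
(`TunnelSeq.coh`). Their coordinates have slowly varying norms (`TunnelSeq.abs_norm_sub_le`), and
every element of finite Lip-norm of a term extends to one of them with almost the same Lip-norm
(`TunnelSeq.exists_coh_lift`). The limit is the completion of the ⋆-algebra which they generate for
the limit of the norms of the coordinates (`TunnelSeq.tailLim`), and the completion for the supremum
of the norms from `N` on (`TunnelSeq.tailSup`) is a tunnel from the `N`-th term to the limit, of
extent at most `2 * 2 ^ (-N)`. The Lip-norm of these completions is the largest lower semicontinuous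
seminorm below the supremum of the Lip-norms (`imageLip`). Their quasi-Leibniz property is
obtained up to small errors in the arguments of `F`, which disappear by continuity of `F`.
-/

namespace DualPropinquity

/-! ### States and the Hahn-Banach theorem -/

/-- The Mazur-Orlicz form of the Hahn-Banach theorem: a convex cone of upper bounds `(e, c)` can be
met by a linear functional below the norm as soon as no bound contradicts the norm. -/
theorem exists_linearMap_le_norm_of_cone {E : Type*} [SeminormedAddCommGroup E] [NormedSpace ℝ E]
    (P : Set (E × ℝ)) (zero_mem : (0, 0) ∈ P)
    (add_mem : ∀ p ∈ P, ∀ q ∈ P, p + q ∈ P) (smul_mem : ∀ r : ℝ, 0 < r → ∀ p ∈ P, r • p ∈ P)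
    (hP : ∀ p ∈ P, -‖p.1‖ ≤ p.2) :
    ∃ ψ : E →ₗ[ℝ] ℝ, (∀ b, ψ b ≤ ‖b‖) ∧ ∀ p ∈ P, ψ p.1 ≤ p.2 := by
  let q : E → ℝ := fun b => ⨅ p : P, (‖b - p.1.1‖ + p.1.2)
  have : Nonempty P := ⟨⟨_, zero_mem⟩⟩
  have hbdd : ∀ b, BddBelow (Set.range fun p : P => ‖b - p.1.1‖ + p.1.2) := by
    intro b
    refine ⟨-‖b‖, ?_⟩
    rintro _ ⟨p, rfl⟩
    have h1 := hP p.1 p.2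
    have h2 := norm_sub_norm_le p.1.1 b
    rw [norm_sub_rev] at h2
    dsimp only
    linarith
  have hq : ∀ b, ∀ p ∈ P, q b ≤ ‖b - p.1‖ + p.2 := fun b p hp => ciInf_le (hbdd b) ⟨p, hp⟩
  have hsmul : ∀ c : ℝ, 0 < c → ∀ x, q (c • x) ≤ c * q x := by
    intro c hc x
    rw [Real.mul_iInf_of_nonneg hc.le]
    refine le_ciInf fun p => ?_
    have h := hq (c • x) _ (smul_mem c hc p.1 p.2)
    rw [Prod.smul_fst, Prod.smul_snd, ← smul_sub, norm_smul, Real.norm_of_nonneg hc.le,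
      smul_eq_mul] at h
    linarith
  obtain ⟨ψ, -, hψ⟩ := exists_extension_of_le_sublinear (⊥ : E →ₗ.[ℝ] ℝ) q
    (fun c hc x => by
      refine le_antisymm (hsmul c hc x) ?_
      have h := hsmul c⁻¹ (inv_pos.2 hc) (c • x)
      rw [inv_smul_smul₀ hc.ne'] at h
      calc c * q x ≤ c * (c⁻¹ * q (c • x)) := mul_le_mul_of_nonneg_left h hc.le
        _ = q (c • x) := by rw [mul_inv_cancel_left₀ hc.ne'])
    (fun x y => by
      refine le_ciInf_add_ciInf fun p p' => ?_
      have h := hq (x + y) _ (add_mem p.1 p.2 p'.1 p'.2)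
      rw [Prod.fst_add, Prod.snd_add, add_sub_add_comm] at h
      have h' := norm_add_le (x - p.1.1) (y - p'.1.1)
      linarith)
    (fun x => by
      have hx : (x : E) = 0 := (Submodule.mem_bot ℝ).1 x.2
      have h0 : (⊥ : E →ₗ.[ℝ] ℝ) x = 0 := by
        have : x = 0 := Subtype.ext hx
        rw [this, LinearPMap.map_zero]
      rw [h0, hx]
      refine le_ciInf fun p => ?_
      have := hP p.1 p.2
      rw [zero_sub, norm_neg]
      linarith)
  refine ⟨ψ, fun b => ?_, fun p hp => ?_⟩
  · simpa using (hψ b).trans (hq b _ zero_mem)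
  · simpa using (hψ p.1).trans (hq p.1 p hp)

section States

variable {A B : Type u} [CStarAlgebra A] [CStarAlgebra B]

/-- The restriction of a state to the self-adjoint part, as a real linear functional. -/
noncomputable def ev (φ : StateSpace A) : selfAdjoint A →ₗ[ℝ] ℝ where
  toFun a := (φ.1 (a : A)).re
  map_add' a b := by
    rw [AddSubgroup.coe_add, map_add, Complex.add_re]
  map_smul' r a := by
    have : ((r • a : selfAdjoint A) : A) = (r : ℂ) • (a : A) := (Complex.coe_smul r (a : A)).symm
    rw [this, map_smul]
    simp

theorem ev_one (φ : StateSpace A) : ev φ 1 = 1 := by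
  change (φ.1 (1 : A)).re = 1
  rw [φ.2.2]; rfl

theorem ev_smul_one (φ : StateSpace A) (r : ℝ) : ev φ (r • 1) = r := by
  rw [map_smul, ev_one, smul_eq_mul, mul_one]

theorem coe_smul_one (r : ℝ) : ((r • (1 : selfAdjoint A) : selfAdjoint A) : A) = (r : ℂ) • 1 :=
  (Complex.coe_smul r (1 : A)).symm

theorem norm_smul_one_le (r : ℝ) : ‖r • (1 : selfAdjoint A)‖ ≤ |r| := by
  rcases subsingleton_or_nontrivial A with h | h
  · have : r • (1 : selfAdjoint A) = 0 := Subsingleton.elim _ _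
    rw [this, norm_zero]; exact abs_nonneg r
  · rw [norm_smul, Real.norm_eq_abs]
    have : ‖(1 : selfAdjoint A)‖ = 1 := CStarRing.norm_one (E := A)
    rw [this, mul_one]

theorem norm_smul_one [Nontrivial A] (r : ℝ) : ‖r • (1 : selfAdjoint A)‖ = |r| := by
  rw [norm_smul, Real.norm_eq_abs]
  have : ‖(1 : selfAdjoint A)‖ = 1 := CStarRing.norm_one (E := A)
  rw [this, mul_one]

/-- The element `‖a‖ - a` is positive. -/
theorem exists_norm_smul_one_sub (a : selfAdjoint A) :
    ∃ b : A, ((‖a‖ • (1 : selfAdjoint A) - a : selfAdjoint A) : A) = star b * b := by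
  let _ : PartialOrder A := CStarAlgebra.spectralOrder A
  let _ : StarOrderedRing A := CStarAlgebra.spectralOrderedRing A
  refine CStarAlgebra.nonneg_iff_eq_star_mul_self.1 ?_
  have h := IsSelfAdjoint.le_algebraMap_norm_self (a := (a : A)) a.2
  rw [Algebra.algebraMap_eq_smul_one] at h
  exact sub_nonneg.2 h

theorem state_eq_ev (φ : StateSpace A) (a : selfAdjoint A) : φ.1 (a : A) = (ev φ a : ℂ) := by
  obtain ⟨b, hb⟩ := exists_norm_smul_one_sub a
  have h := φ.2.1 b
  rw [← hb, AddSubgroup.coe_sub, map_sub, coe_smul_one, map_smul, φ.2.2, Complex.le_def] at h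
  apply Complex.ext
  · rfl
  · simpa using h.2

theorem ev_le_norm (φ : StateSpace A) (a : selfAdjoint A) : ev φ a ≤ ‖a‖ := by
  obtain ⟨b, hb⟩ := exists_norm_smul_one_sub a
  have h := φ.2.1 b
  rw [← hb, AddSubgroup.coe_sub, map_sub, coe_smul_one, map_smul, φ.2.2, state_eq_ev,
    Complex.le_def] at h
  simpa using h.1

theorem abs_ev_le_norm (φ : StateSpace A) (a : selfAdjoint A) : |ev φ a| ≤ ‖a‖ := by
  refine abs_le'.2 ⟨ev_le_norm φ a, ?_⟩
  rw [← map_neg, ← norm_neg]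
  exact ev_le_norm φ (-a)

theorem ev_dualMap (π : A →⋆ₐ[ℂ] B) (φ : StateSpace B) (a : selfAdjoint A) :
    ev (dualMap π φ) a = ev φ (saMap π a) := rfl

theorem enorm_state_sub (φ ψ : StateSpace A) (a : selfAdjoint A) :
    ‖φ.1 (a : A) - ψ.1 (a : A)‖ₑ = ‖ev φ a - ev ψ a‖ₑ := by
  rw [state_eq_ev, state_eq_ev, ← Complex.ofReal_sub, ← ofReal_norm, ← ofReal_norm,
    Complex.norm_real]

theorem norm_star_mul_self_sub_le (b : A) :
    ‖(‖star b * b‖ : ℂ) • (1 : A) - star b * b‖ ≤ ‖star b * b‖ := by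
  let _ : PartialOrder A := CStarAlgebra.spectralOrder A
  let _ : StarOrderedRing A := CStarAlgebra.spectralOrderedRing A
  rcases subsingleton_or_nontrivial A with h | h
  · rw [Subsingleton.elim ((‖star b * b‖ : ℂ) • (1 : A) - star b * b) 0, norm_zero]
    exact norm_nonneg _
  have h0 : 0 ≤ star b * b := star_mul_self_nonneg b
  have h1 := IsSelfAdjoint.le_algebraMap_norm_self (a := star b * b) (IsSelfAdjoint.star_mul_self b)
  rw [Algebra.algebraMap_eq_smul_one, ← Complex.coe_smul] at h1
  refine (CStarAlgebra.norm_le_norm_of_nonneg_of_le (sub_nonneg.2 h1) (sub_le_self _ h0)).trans ?_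
  rw [norm_smul, CStarRing.norm_one, Complex.norm_real, norm_norm, mul_one]

/-- A real functional on the self-adjoint part which is below the norm and maps the unit to `1`
comes from a state. -/
theorem exists_state_of_le_norm (ψ : selfAdjoint A →ₗ[ℝ] ℝ) (hψ : ∀ b, ψ b ≤ ‖b‖)
    (h1 : ψ 1 = 1) : ∃ φ : StateSpace A, ∀ a, ev φ a = ψ a := by
  have habs : ∀ b, |ψ b| ≤ ‖b‖ := fun b => abs_le'.2 ⟨hψ b, by
    rw [← map_neg, ← norm_neg]; exact hψ (-b)⟩
  let f : A →ₗ[ℝ] ℂ :=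
    Complex.ofRealCLM.toLinearMap ∘ₗ ψ ∘ₗ realPart +
      (Complex.I • Complex.ofRealCLM.toLinearMap) ∘ₗ ψ ∘ₗ imaginaryPart
  have hf : ∀ x, f x = (ψ (realPart x) : ℂ) + Complex.I * (ψ (imaginaryPart x) : ℂ) := fun x => rfl
  have hfI : ∀ x, f (Complex.I • x) = Complex.I * f x := by
    intro x
    rw [hf, hf, realPart_I_smul, imaginaryPart_I_smul, map_neg, mul_add, ← mul_assoc,
      Complex.I_mul_I]
    push_cast
    ring
  let g : A →ₗ[ℂ] ℂ :=
    { toFun := f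
      map_add' := map_add f
      map_smul' := fun c x => by
        have hc : c • x = c.re • x + c.im • (Complex.I • x) := by
          rw [← Complex.coe_smul, ← Complex.coe_smul, smul_smul, ← add_smul, Complex.re_add_im]
        rw [hc, map_add, map_smul, map_smul, hfI, RingHom.id_apply, smul_eq_mul]
        conv_rhs => rw [← Complex.re_add_im c]
        simp only [Complex.real_smul]
        ring }
  have hg : ∀ x, ‖g x‖ ≤ 2 * ‖x‖ := by
    intro x
    change ‖f x‖ ≤ _
    rw [hf]
    refine (norm_add_le _ _).trans ?_
    rw [norm_mul, Complex.norm_I, one_mul, Complex.norm_real, Complex.norm_real, Real.norm_eq_abs,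
      Real.norm_eq_abs]
    have e1 := (habs (realPart x)).trans (realPart.norm_le x)
    have e2 := (habs (imaginaryPart x)).trans (imaginaryPart.norm_le x)
    linarith
  let G : WeakDual ℂ A := StrongDual.toWeakDual (g.mkContinuous 2 hg)
  have hGf : ∀ x, G x = f x := fun x => rfl
  have hGsa : ∀ a : selfAdjoint A, G (a : A) = (ψ a : ℂ) := by
    intro a
    rw [hGf, hf, selfAdjoint.realPart_coe, selfAdjoint.imaginaryPart_coe]
    simp
  refine ⟨⟨G, fun b => ?_, ?_⟩, fun a => ?_⟩
  · have hb := hGsa ⟨star b * b, IsSelfAdjoint.star_mul_self b⟩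
    dsimp only at hb
    rw [hb]
    have key := hψ (‖star b * b‖ • 1 - ⟨star b * b, IsSelfAdjoint.star_mul_self b⟩)
    have hn : ‖(‖star b * b‖ • 1 - ⟨star b * b, IsSelfAdjoint.star_mul_self b⟩ : selfAdjoint A)‖
        ≤ ‖star b * b‖ := by
      have := norm_star_mul_self_sub_le b
      rw [Complex.coe_smul] at this
      exact this
    rw [map_sub, map_smul, h1, smul_eq_mul, mul_one] at key
    rw [Complex.zero_le_real]
    linarith
  · have := hGsa 1
    rw [h1] at this
    exact_mod_cast this
  · change (G (a : A)).re = ψ a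
    rw [hGsa, Complex.ofReal_re]

theorem abs_add_mul_norm_le_of_mem_spectrum [Nontrivial A] {a : selfAdjoint A} {x : ℝ}
    (hx : x ∈ spectrum ℝ (a : A)) (s t : ℝ) : |s + t * x| ≤ ‖s • (1 : selfAdjoint A) + t • a‖ := by
  have h : s + t * x ∈ spectrum ℝ (algebraMap ℝ A s + t • (a : A)) := by
    rw [← spectrum.singleton_add_eq]
    refine Set.add_mem_add rfl ?_
    rcases eq_or_ne t 0 with rfl | ht
    · simp [spectrum.zero_eq]
    · have := spectrum.smul_mem_smul_iff (r := Units.mk0 t ht) (a := (a : A)) (s := x)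
      exact this.2 hx
  have h2 := spectrum.norm_le_norm_of_mem h
  rwa [Real.norm_eq_abs, Algebra.algebraMap_eq_smul_one] at h2

/-- The norm of a self-adjoint element is attained at a state. -/
theorem exists_state_abs_eq_norm [Nontrivial A] (a : selfAdjoint A) :
    ∃ φ : StateSpace A, |ev φ a| = ‖a‖ := by
  suffices H : ∃ x : ℝ, |x| = ‖a‖ ∧ ∃ φ : StateSpace A, ev φ a = x by
    obtain ⟨x, hx, φ, hφ⟩ := H
    exact ⟨φ, by rw [hφ, hx]⟩
  obtain ⟨x, hx, hxa⟩ : ∃ x : ℝ, |x| = ‖a‖ ∧ x ∈ spectrum ℝ (a : A) := by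
    rcases CStarAlgebra.norm_or_neg_norm_mem_spectrum (a := (a : A)) a.2 with h | h
    · exact ⟨_, abs_norm _, h⟩
    · exact ⟨_, by rw [abs_neg]; exact abs_norm _, h⟩
  refine ⟨x, hx, ?_⟩
  obtain ⟨ψ, hψ, hP⟩ := exists_linearMap_le_norm_of_cone
    {p : selfAdjoint A × ℝ | ∃ s t : ℝ, p = (s • 1 + t • a, s + t * x)}
    ⟨0, 0, by simp⟩
    (by
      rintro _ ⟨s, t, rfl⟩ _ ⟨s', t', rfl⟩
      refine ⟨s + s', t + t', Prod.ext ?_ ?_⟩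
      · simp only [Prod.fst_add]; module
      · simp only [Prod.snd_add]; ring)
    (by
      rintro r - _ ⟨s, t, rfl⟩
      refine ⟨r * s, r * t, Prod.ext ?_ ?_⟩
      · simp only [Prod.smul_fst]; module
      · simp only [Prod.smul_snd, smul_eq_mul]; ring)
    (by
      rintro _ ⟨s, t, rfl⟩
      have := abs_add_mul_norm_le_of_mem_spectrum hxa s t
      exact (neg_le_neg this).trans (neg_abs_le _))
  have key : ∀ s t : ℝ, s * ψ 1 + t * ψ a ≤ s + t * x := by
    intro s t
    have := hP _ ⟨s, t, rfl⟩
    simpa using this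
  obtain ⟨φ, hφ⟩ := exists_state_of_le_norm ψ hψ (by
    have h1 := key 1 0
    have h2 := key (-1) 0
    linarith)
  refine ⟨φ, ?_⟩
  rw [hφ]
  have h1 := key 0 1
  have h2 := key 0 (-1)
  linarith

theorem nonempty_stateSpace [Nontrivial A] : Nonempty (StateSpace A) :=
  ⟨(exists_state_abs_eq_norm (0 : selfAdjoint A)).choose⟩

theorem norm_le_of_forall_state [Nontrivial A] {a : selfAdjoint A} {c : ℝ}
    (h : ∀ φ : StateSpace A, |ev φ a| ≤ c) : ‖a‖ ≤ c := by
  obtain ⟨φ, hφ⟩ := exists_state_abs_eq_norm a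
  exact hφ ▸ h φ

theorem norm_saMap_le (π : A →⋆ₐ[ℂ] B) (a : selfAdjoint A) : ‖saMap π a‖ ≤ ‖a‖ :=
  NonUnitalStarAlgHom.norm_apply_le π (a : A)

theorem isCompact_stateSpace : IsCompact (StateSpace A) := by
  refine WeakDual.isCompact_of_bounded_of_closed ?_ ?_
  · refine (Metric.isBounded_closedBall (x := (0 : StrongDual ℂ A)) (r := 2)).subset ?_
    intro φ hφ
    change WeakDual.toStrongDual φ ∈ _
    rw [mem_closedBall_zero_iff]
    refine ContinuousLinearMap.opNorm_le_bound _ (by norm_num) fun x => ?_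
    change ‖φ x‖ ≤ _
    have hx : x = (realPart x : A) + Complex.I • (imaginaryPart x : A) :=
      (realPart_add_I_smul_imaginaryPart x).symm
    have hr : φ (realPart x : A) = _ := state_eq_ev ⟨φ, hφ⟩ (realPart x)
    have hi : φ (imaginaryPart x : A) = _ := state_eq_ev ⟨φ, hφ⟩ (imaginaryPart x)
    rw [hx, map_add, map_smul, hr, hi, ← hx]
    refine (norm_add_le _ _).trans ?_
    rw [norm_smul, Complex.norm_I, one_mul, Complex.norm_real, Complex.norm_real, Real.norm_eq_abs,
      Real.norm_eq_abs]
    have e1 := (abs_ev_le_norm ⟨φ, hφ⟩ (realPart x)).trans (realPart.norm_le x)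
    have e2 := (abs_ev_le_norm ⟨φ, hφ⟩ (imaginaryPart x)).trans (imaginaryPart.norm_le x)
    linarith
  · have : StateSpace A = (⋂ a : A, {φ : WeakDual ℂ A | 0 ≤ φ (star a * a)}) ∩
        {φ : WeakDual ℂ A | φ 1 = 1} := by
      ext φ; simp [StateSpace]
    rw [this]
    refine (isClosed_iInter fun a => ?_).inter ?_
    · exact isClosed_Ici.preimage (WeakDual.eval_continuous _)
    · exact isClosed_singleton.preimage (WeakDual.eval_continuous _)

theorem continuous_ev (a : selfAdjoint A) : Continuous fun φ : StateSpace A => ev φ a :=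
  Complex.continuous_re.comp ((WeakDual.eval_continuous (a : A)).comp continuous_subtype_val)

end States

/-! ### Extended seminorms -/

theorem le_add_mul_of_forall_gt {x c r : ℝ} {l : ℝ≥0}
    (h : ∀ l' : ℝ≥0, l < l' → x ≤ c + r * l') : x ≤ c + r * l := by
  have h1 : Filter.Tendsto (fun l' : ℝ≥0 => c + r * (l' : ℝ)) (𝓝[>] l) (𝓝 (c + r * l)) := by
    refine Filter.Tendsto.mono_left (Continuous.tendsto ?_ l) nhdsWithin_le_nhds
    fun_prop
  have hne : (𝓝[>] l).NeBot := inferInstance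
  exact ge_of_tendsto h1 (Filter.eventually_of_mem self_mem_nhdsWithin fun l' hl' => h l' hl')

section ExtSeminorm

variable {V : Type u} [AddCommGroup V] [Module ℝ V] (L : ExtSeminorm V)

theorem ExtSeminorm.map_zero : L 0 = 0 := by
  have := L.map_smul' 0 0
  simpa using this

theorem ExtSeminorm.map_neg (v : V) : L (-v) = L v := by
  have := L.map_smul' (-1) v
  simpa using this

theorem ExtSeminorm.map_sub_le (v w : V) : L (v - w) ≤ L v + L w := by
  rw [sub_eq_add_neg, ← L.map_neg w]
  exact L.map_add_le' _ _

theorem ExtSeminorm.map_smul_le {r l : ℝ≥0} {v : V} (h : L v ≤ l) :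
    L ((r : ℝ) • v) ≤ (r * l : ℝ≥0) := by
  rw [L.map_smul', ENNReal.coe_mul]
  have : ‖(r : ℝ)‖ₑ = r := by rw [← ofReal_norm]; simp
  rw [this]
  gcongr

theorem ExtSeminorm.map_sub_eq {v w : V} (hw : L w = 0) : L (v - w) = L v := by
  refine le_antisymm ((L.map_sub_le v w).trans (by rw [hw, add_zero])) ?_
  have := L.map_add_le' (v - w) w
  rwa [sub_add_cancel, hw, add_zero] at this

theorem ExtSeminorm.le_of_unitBall {L L' : ExtSeminorm V} (h : ∀ v, L v ≤ 1 → L' v ≤ 1) (v : V) :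
    L' v ≤ L v := by
  rcases eq_or_ne (L v) ∞ with hv | hv
  · rw [hv]; exact le_top
  lift L v to ℝ≥0 using hv with l hl
  refine le_of_forall_gt_imp_ge_of_dense fun y hy => ?_
  rcases eq_or_ne y ∞ with rfl | hy'
  · exact le_top
  lift y to ℝ≥0 using hy'
  have hy0 : 0 < y := lt_of_le_of_lt zero_le (ENNReal.coe_lt_coe.1 hy)
  have h1 : L (((y⁻¹ : ℝ≥0) : ℝ) • v) ≤ 1 := by
    refine (L.map_smul_le (hl.symm.le.trans hy.le)).trans ?_
    rw [inv_mul_cancel₀ hy0.ne', ENNReal.coe_one]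
  have h2 := L'.map_smul_le (r := y) (l := 1) (h _ h1)
  rwa [smul_smul, ← NNReal.coe_mul, mul_inv_cancel₀ hy0.ne', NNReal.coe_one, one_smul,
    mul_one] at h2

/-- It is enough to check homogeneity of an extended seminorm as an inequality. -/
def ExtSeminorm.ofLe (f : V → ℝ≥0∞) (h0 : f 0 = 0)
    (hs : ∀ (r : ℝ) (v : V), r ≠ 0 → f (r • v) ≤ ‖r‖ₑ * f v)
    (ha : ∀ v w, f (v + w) ≤ f v + f w) : ExtSeminorm V where
  toFun := f
  map_smul' r v := by
    rcases eq_or_ne r 0 with rfl | hr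
    · simp [h0]
    · refine le_antisymm (hs r v hr) ?_
      have h := hs r⁻¹ (r • v) (inv_ne_zero hr)
      rw [inv_smul_smul₀ hr] at h
      calc ‖r‖ₑ * f v ≤ ‖r‖ₑ * (‖r⁻¹‖ₑ * f (r • v)) := by gcongr
        _ = f (r • v) := by
          rw [← mul_assoc, ← enorm_mul, mul_inv_cancel₀ hr, enorm_one, one_mul]
  map_add_le' := ha

end ExtSeminorm

/-! ### Restriction of ⋆-homomorphisms to self-adjoint elements -/

section SaMap

variable {A B : Type u} [CStarAlgebra A] [CStarAlgebra B] (π : A →⋆ₐ[ℂ] B)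

theorem saMap_add (a b : selfAdjoint A) : saMap π (a + b) = saMap π a + saMap π b :=
  Subtype.ext (map_add π _ _)

theorem saMap_sub (a b : selfAdjoint A) : saMap π (a - b) = saMap π a - saMap π b :=
  Subtype.ext (map_sub π _ _)

theorem saMap_zero : saMap π 0 = 0 := Subtype.ext (map_zero π)

theorem saMap_one : saMap π 1 = 1 := Subtype.ext (map_one π)

theorem saMap_smul (r : ℝ) (a : selfAdjoint A) : saMap π (r • a) = r • saMap π a := by
  refine Subtype.ext ?_
  change π (r • (a : A)) = r • π a
  rw [← Complex.coe_smul, map_smul, Complex.coe_smul]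

theorem saMap_smul_one (r : ℝ) : saMap π (r • 1) = r • 1 := by rw [saMap_smul, saMap_one]

theorem saMap_jordan (a b : selfAdjoint A) :
    saMap π (jordan a b) = jordan (saMap π a) (saMap π b) := by
  refine Subtype.ext ?_
  change π ((1 / 2 : ℂ) • ((a : A) * b + b * a)) = (1 / 2 : ℂ) • (π a * π b + π b * π a)
  rw [map_smul, map_add, map_mul, map_mul]

theorem saMap_lie (a b : selfAdjoint A) : saMap π (lie a b) = lie (saMap π a) (saMap π b) := by
  refine Subtype.ext ?_
  change π ((1 / (2 * Complex.I) : ℂ) • ((a : A) * b - b * a)) =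
    (1 / (2 * Complex.I) : ℂ) • (π a * π b - π b * π a)
  rw [map_smul, map_sub, map_mul, map_mul]

theorem continuous_saMap : Continuous (saMap π) :=
  Continuous.subtype_mk ((toCLM π).continuous.comp continuous_subtype_val) _

end SaMap

/-! ### The Monge-Kantorovich metric and norm estimates -/

section MkDist

variable {A B : Type u} [CStarAlgebra A] [CStarAlgebra B]

theorem mkDist_le_iff {L : ExtSeminorm (selfAdjoint A)} {φ ψ : StateSpace A} {r : ℝ≥0} :
    mkDist L φ ψ ≤ r ↔
      ∀ (a : selfAdjoint A) (l : ℝ≥0), L a ≤ l → |ev φ a - ev ψ a| ≤ r * l := by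
  have aux : ∀ x : ℝ, ‖x‖ₑ ≤ r ↔ |x| ≤ r := fun x => by
    rw [← Real.norm_eq_abs, ← coe_nnnorm, NNReal.coe_le_coe, enorm_le_coe]
  constructor
  · intro h a l hl
    have key : ∀ l' : ℝ≥0, l < l' → |ev φ a - ev ψ a| ≤ 0 + r * l' := by
      intro l' hl'
      have h0 : 0 < l' := lt_of_le_of_lt zero_le hl'
      have h1 : L (((l'⁻¹ : ℝ≥0) : ℝ) • a) ≤ 1 := by
        refine (L.map_smul_le (hl.trans (ENNReal.coe_le_coe.2 hl'.le))).trans ?_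
        rw [inv_mul_cancel₀ h0.ne', ENNReal.coe_one]
      have h2 := (le_iSup₂ (f := fun (a : selfAdjoint A) (_ : L a ≤ 1) =>
        ‖φ.1 (a : A) - ψ.1 (a : A)‖ₑ) _ h1).trans h
      rw [enorm_state_sub, aux, map_smul, map_smul, ← smul_sub, smul_eq_mul, abs_mul,
        NNReal.abs_eq, NNReal.coe_inv, inv_mul_le_iff₀ (NNReal.coe_pos.2 h0)] at h2
      linarith
    simpa using le_add_mul_of_forall_gt key
  · intro h
    refine iSup₂_le fun a ha => ?_
    rw [enorm_state_sub, aux]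
    simpa using h a 1 ha

/-- The norm form of a bound on the extent: an element of Lip-norm at most `l` loses at most `r * l`
of its norm under `π`. -/
def NormBound (L : ExtSeminorm (selfAdjoint A)) (π : A →⋆ₐ[ℂ] B) (r : ℝ≥0) : Prop :=
  ∀ (d : selfAdjoint A) (l : ℝ≥0), L d ≤ l → ‖d‖ ≤ ‖saMap π d‖ + r * l

/-- Under a norm bound, every state is near a state that factors through the quotient. The cone of
constraints asks for a functional on the quotient which is within `r` of `φ`. -/
theorem NormBound.exists_state {L : ExtSeminorm (selfAdjoint A)} {π : A →⋆ₐ[ℂ] B} {r : ℝ≥0}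
    (h : NormBound L π r) (h1 : L 1 = 0) (φ : StateSpace A) :
    ∃ ψ : StateSpace B, mkDist L φ (dualMap π ψ) ≤ r := by
  obtain ⟨ψ, hψ, hP⟩ := exists_linearMap_le_norm_of_cone
    {p : selfAdjoint B × ℝ | ∃ (d : selfAdjoint A) (l : ℝ≥0), L d ≤ l ∧
      p = (saMap π d, ev φ d + r * l)}
    ⟨0, 0, by rw [L.map_zero]; exact zero_le, by rw [saMap_zero, map_zero]; simp⟩
    (by
      rintro _ ⟨d, l, hl, rfl⟩ _ ⟨d', l', hl', rfl⟩
      refine ⟨d + d', l + l', ?_, Prod.ext ?_ ?_⟩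
      · rw [ENNReal.coe_add]
        exact (L.map_add_le' _ _).trans (add_le_add hl hl')
      · rw [saMap_add]; rfl
      · rw [map_add]
        push_cast
        change _ + _ = _
        ring)
    (by
      rintro s hs _ ⟨d, l, hl, rfl⟩
      lift s to ℝ≥0 using hs.le
      refine ⟨(s : ℝ) • d, s * l, L.map_smul_le hl, Prod.ext ?_ ?_⟩
      · rw [saMap_smul]; rfl
      · rw [map_smul]
        push_cast
        change (s : ℝ) * _ = _
        rw [smul_eq_mul]
        ring)
    (by
      rintro _ ⟨d, l, hl, rfl⟩
      have e1 := h d l hl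
      have e2 := (abs_le.1 (abs_ev_le_norm φ d)).1
      dsimp only
      linarith)
  have key : ∀ (d : selfAdjoint A) (l : ℝ≥0), L d ≤ l → ψ (saMap π d) ≤ ev φ d + r * l :=
    fun d l hl => hP _ ⟨d, l, hl, rfl⟩
  have hψ1 : ψ 1 = 1 := by
    refine le_antisymm ?_ ?_
    · refine (hψ 1).trans ?_
      simpa using norm_smul_one_le (A := B) 1
    · have := key (-1) 0 (by rw [L.map_neg, h1]; exact zero_le)
      have e : saMap π (-1) = -1 := by
        have := saMap_smul_one π (-1)
        simpa using this
      rw [e, map_neg, map_neg, ev_one] at this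
      simp only [NNReal.coe_zero, mul_zero, add_zero] at this
      linarith
  obtain ⟨θ, hθ⟩ := exists_state_of_le_norm ψ hψ hψ1
  refine ⟨θ, mkDist_le_iff.2 fun a l hl => ?_⟩
  rw [ev_dualMap, hθ]
  have e1 := key a l hl
  have e2 := key (-a) l (by rw [L.map_neg]; exact hl)
  have e : saMap π (-a) = -saMap π a := by
    have := saMap_smul π (-1) a
    simpa using this
  rw [e, map_neg, map_neg] at e2
  rw [abs_le]
  constructor <;> linarith

/-- The extent of one leg of a tunnel is a norm estimate. -/
theorem mkHaus_range_le_iff [Nontrivial A] {L : ExtSeminorm (selfAdjoint A)} {π : A →⋆ₐ[ℂ] B}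
    {r : ℝ≥0} (h1 : L 1 = 0) :
    mkHaus L Set.univ (Set.range (dualMap π)) ≤ r ↔ NormBound L π r := by
  constructor
  · intro h d l hl
    have key : ∀ r' : ℝ≥0, r < r' → ‖d‖ ≤ ‖saMap π d‖ + l * r' := by
      intro r' hr'
      refine norm_le_of_forall_state fun φ => ?_
      have hlt : mkHaus L Set.univ (Set.range (dualMap π)) < r' :=
        h.trans_lt (ENNReal.coe_lt_coe.2 hr')
      obtain ⟨_, ⟨ψ, rfl⟩, hψ⟩ := @Metric.exists_edist_lt_of_hausdorffEDist_lt _ (mkMetric L) φ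
        _ _ _ (Set.mem_univ φ) hlt
      have e := mkDist_le_iff.1 (le_of_lt hψ) d l hl
      rw [ev_dualMap] at e
      have e' := abs_ev_le_norm ψ (saMap π d)
      have := abs_add_le (ev φ d - ev ψ (saMap π d)) (ev ψ (saMap π d))
      rw [sub_add_cancel] at this
      linarith
    have := le_add_mul_of_forall_gt key
    linarith
  · intro h
    refine @Metric.hausdorffEDist_le_of_mem_edist _ (mkMetric L) _ _ _ (fun φ _ => ?_)
      (fun φ _ => ⟨φ, Set.mem_univ _, ?_⟩)
    · obtain ⟨ψ, hψ⟩ := h.exists_state h1 φ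
      exact ⟨_, ⟨ψ, rfl⟩, hψ⟩
    · exact ((@edist_self _ (mkMetric L) φ).trans_le zero_le)

end MkDist

/-! ### A closed Lip-norm is determined by its Monge-Kantorovich metric -/

section Determined

variable {A : Type u} [CStarAlgebra A]

theorem opNorm_pos_of_ne_zero {f : StrongDual ℝ (selfAdjoint A)} (hf : f ≠ 0) : 0 < ‖f‖ := by
  refine lt_of_le_of_ne (norm_nonneg f) fun h => hf (ContinuousLinearMap.ext fun x => ?_)
  have := f.le_opNorm x
  rw [← h, zero_mul] at this
  exact norm_le_zero_iff.1 this

/-- A functional on the self-adjoint part which vanishes at the unit is a multiple of a difference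
of two states. -/
theorem exists_states_sub_eq [Nontrivial A] (f : StrongDual ℝ (selfAdjoint A)) (h1 : f 1 = 0)
    (hf : f ≠ 0) : ∃ φ ψ : StateSpace A, ∀ b, f b = ‖f‖ * (ev φ b - ev ψ b) := by
  have hc : 0 < ‖f‖ := opNorm_pos_of_ne_zero hf
  have hcone : ∀ (b : selfAdjoint A) (s : ℝ), -‖b + s • (1 : selfAdjoint A)‖ ≤
      ‖b‖ + f b / ‖f‖ + s := by
    intro b s
    have hδ : ‖b - ‖b‖ • (1 : selfAdjoint A)‖ ≤ ‖b‖ + ‖b + s • (1 : selfAdjoint A)‖ + s := by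
      refine norm_le_of_forall_state fun φ => ?_
      have e1 := ev_le_norm φ b
      have e2 := (abs_le.1 (abs_ev_le_norm φ (b + s • 1))).1
      rw [map_add, ev_smul_one] at e2
      rw [map_sub, ev_smul_one, abs_of_nonpos (by linarith)]
      linarith
    have h2 : |f b| ≤ ‖f‖ * ‖b - ‖b‖ • (1 : selfAdjoint A)‖ := by
      have := f.le_opNorm (b - ‖b‖ • (1 : selfAdjoint A))
      rwa [map_sub, map_smul, h1, smul_zero, sub_zero] at this
    have h3 : -(f b / ‖f‖) ≤ ‖b - ‖b‖ • (1 : selfAdjoint A)‖ := by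
      rw [← neg_div, div_le_iff₀ hc]
      linarith [neg_abs_le (f b)]
    linarith
  obtain ⟨φ₀, hφ₀, hP⟩ := exists_linearMap_le_norm_of_cone
    {p : selfAdjoint A × ℝ | ∃ (b : selfAdjoint A) (s t : ℝ), ‖b‖ ≤ t ∧
      p = (b + s • 1, t + f b / ‖f‖ + s)}
    ⟨0, 0, 0, by simp, by simp⟩
    (by
      rintro _ ⟨b, s, t, ht, rfl⟩ _ ⟨b', s', t', ht', rfl⟩
      refine ⟨b + b', s + s', t + t', (norm_add_le _ _).trans (add_le_add ht ht'),
        Prod.ext ?_ ?_⟩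
      · simp only [Prod.fst_add]; module
      · simp only [Prod.snd_add, map_add]; ring)
    (by
      rintro r hr _ ⟨b, s, t, ht, rfl⟩
      refine ⟨r • b, r * s, r * t, ?_, Prod.ext ?_ ?_⟩
      · rw [norm_smul, Real.norm_of_nonneg hr.le]
        gcongr
      · simp only [Prod.smul_fst]; module
      · simp only [Prod.smul_snd, smul_eq_mul, map_smul]; ring)
    (by
      rintro _ ⟨b, s, t, ht, rfl⟩
      have := hcone b s
      dsimp only
      linarith)
  have key : ∀ (b : selfAdjoint A) (s : ℝ), φ₀ b + s * φ₀ 1 ≤ ‖b‖ + f b / ‖f‖ + s := by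
    intro b s
    have := hP _ ⟨b, s, _, le_rfl, rfl⟩
    rwa [map_add, map_smul, smul_eq_mul] at this
  have hφ1 : φ₀ 1 = 1 := by
    have e1 := key 0 1
    have e2 := key 0 (-1)
    simp only [map_zero, norm_zero, zero_div] at e1 e2
    linarith
  obtain ⟨φ, hφ⟩ := exists_state_of_le_norm φ₀ hφ₀ hφ1
  obtain ⟨ψ, hψ⟩ := exists_state_of_le_norm (φ₀ - ‖f‖⁻¹ • (f : selfAdjoint A →ₗ[ℝ] ℝ))
    (fun b => by
      have := key b 0
      simp only [LinearMap.sub_apply, LinearMap.smul_apply, smul_eq_mul,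
        ContinuousLinearMap.coe_coe]
      rw [← div_eq_inv_mul]
      linarith)
    (by
      simp only [LinearMap.sub_apply, LinearMap.smul_apply, smul_eq_mul,
        ContinuousLinearMap.coe_coe]
      rw [h1, hφ1]; ring)
  refine ⟨φ, ψ, fun b => ?_⟩
  rw [hφ, hψ]
  simp only [LinearMap.sub_apply, LinearMap.smul_apply, smul_eq_mul, ContinuousLinearMap.coe_coe]
  field_simp
  ring

theorem convex_unitBall (L : ExtSeminorm (selfAdjoint A)) : Convex ℝ {a | L a ≤ 1} := by
  intro a ha b hb s t hs ht hst
  lift s to ℝ≥0 using hs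
  lift t to ℝ≥0 using ht
  refine (L.map_add_le' _ _).trans ((add_le_add (L.map_smul_le (l := 1) ha)
    (L.map_smul_le (l := 1) hb)).trans ?_)
  rw [← ENNReal.coe_add, mul_one, mul_one]
  have : s + t = 1 := by exact_mod_cast hst
  rw [this, ENNReal.coe_one]

/-- By separation, an element outside of a closed Lipschitz ball is detected by two states. -/
theorem le_one_of_mkDist_le [Nontrivial A] {L L' : ExtSeminorm (selfAdjoint A)}
    (h1' : L' 1 = 0) (hc' : IsClosed {a : selfAdjoint A | L' a ≤ 1})
    (hmk : ∀ φ ψ, mkDist L φ ψ ≤ mkDist L' φ ψ) {a : selfAdjoint A} (ha : L a ≤ 1) :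
    L' a ≤ 1 := by
  by_contra hcon
  obtain ⟨f, u, hfu, hua⟩ := geometric_hahn_banach_closed_point (convex_unitBall L') hc' hcon
  have hu0 : 0 < u := by
    have := hfu 0 (by change L' 0 ≤ 1; rw [L'.map_zero]; exact zero_le)
    rwa [map_zero] at this
  have ht : ∀ t : ℝ, t * f 1 < u := by
    intro t
    have := hfu (t • 1) (by
      change L' (t • 1) ≤ 1
      rw [L'.map_smul', h1', mul_zero]; exact zero_le)
    rwa [map_smul, smul_eq_mul] at this
  have hf1 : f 1 = 0 := by
    by_contra hne
    have := ht (u / f 1)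
    rw [div_mul_cancel₀ _ hne] at this
    exact lt_irrefl _ this
  have hf : f ≠ 0 := by
    rintro rfl
    rw [zero_apply] at hua
    linarith
  obtain ⟨φ, ψ, hφψ⟩ := exists_states_sub_eq f hf1 hf
  have hc : 0 < ‖f‖ := opNorm_pos_of_ne_zero hf
  have hu : 0 ≤ u / ‖f‖ := by positivity
  have hb : mkDist L' φ ψ ≤ ((u / ‖f‖).toNNReal : ℝ≥0∞) := by
    refine iSup₂_le fun b hb => ?_
    rw [enorm_state_sub, enorm_le_coe, ← NNReal.coe_le_coe, coe_nnnorm, Real.norm_eq_abs]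
    rw [Real.coe_toNNReal _ hu, le_div_iff₀ hc, mul_comm, ← abs_of_pos hc, ← abs_mul, ← hφψ, abs_le]
    have e1 := hfu b hb
    have e2 := hfu (-b) (by change L' (-b) ≤ 1; rw [L'.map_neg]; exact hb)
    rw [map_neg] at e2
    constructor <;> linarith
  have hfin := mkDist_le_iff.1 ((hmk φ ψ).trans hb) a 1 ha
  rw [Real.coe_toNNReal _ hu] at hfin
  have e : f a ≤ u := by
    rw [hφψ a]
    have e1 := le_abs_self (ev φ a - ev ψ a)
    have e2 : ev φ a - ev ψ a ≤ u / ‖f‖ := e1.trans (by simpa using hfin)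
    calc ‖f‖ * (ev φ a - ev ψ a) ≤ ‖f‖ * (u / ‖f‖) := by gcongr
      _ = u := by field_simp
  linarith

end Determined

/-! ### Total boundedness and Lip-norms -/

/-- A set is totally bounded if it is so up to any error, through auxiliary maps. -/
theorem totallyBounded_image_of_approx {α X : Type*} [PseudoMetricSpace X] {W : Set α} {f : α → X}
    (h : ∀ η : ℝ, 0 < η → ∃ (Y : Type u) (_ : PseudoMetricSpace Y) (g : α → Y),
      TotallyBounded (g '' W) ∧ ∀ v ∈ W, ∀ w ∈ W, dist (f v) (f w) ≤ dist (g v) (g w) + η) :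
    TotallyBounded (f '' W) := by
  rw [Metric.totallyBounded_iff]
  intro ε hε
  obtain ⟨Y, _, g, hg, hfg⟩ := h (ε / 2) (by positivity)
  obtain ⟨t, htW, htfin, ht⟩ := Metric.finite_approx_of_totallyBounded hg (ε / 2) (by positivity)
  rcases isEmpty_or_nonempty α with hα | hα
  · refine ⟨∅, Set.finite_empty, ?_⟩
    rintro _ ⟨w, -, rfl⟩
    exact hα.elim w
  have htW' : ∀ y : Y, y ∈ t → ∃ w, w ∈ W ∧ g w = y := fun y hy => htW hy
  choose! k hkW hk using htW'
  refine ⟨(f ∘ k) '' t, htfin.image _, ?_⟩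
  rintro _ ⟨w, hw, rfl⟩
  obtain ⟨y, hy, hyw⟩ := Set.mem_iUnion₂.1 (ht ⟨w, hw, rfl⟩)
  refine Set.mem_iUnion₂.2 ⟨_, ⟨y, hy, rfl⟩, ?_⟩
  rw [Metric.mem_ball] at hyw ⊢
  have := hfg w hw (k y) (hkW y hy)
  rw [hk y hy] at this
  dsimp only [Function.comp]
  linarith

theorem totallyBounded_pi {ι : Type*} [Fintype ι] {X : ι → Type*} [∀ i, PseudoMetricSpace (X i)]
    {s : Set (∀ i, X i)} (h : ∀ i, TotallyBounded ((fun x => x i) '' s)) : TotallyBounded s := by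
  rw [Metric.totallyBounded_iff]
  intro ε hε
  choose t ht hts using fun i => Metric.totallyBounded_iff.1 (h i) (ε / 2) (by positivity)
  refine ⟨Set.pi Set.univ t, Set.Finite.pi fun i => ht i, fun x hx => ?_⟩
  choose y hy hxy using fun i => Set.mem_iUnion₂.1 (hts i ⟨x, hx, rfl⟩)
  refine Set.mem_iUnion₂.2 ⟨y, fun i _ => hy i, ?_⟩
  rw [Metric.mem_ball]
  refine ((dist_pi_le_iff (by positivity)).2 fun i => ?_).trans_lt (half_lt_self hε)
  exact (hxy i).le

section Criterion

variable {A : Type u} [CStarAlgebra A]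

theorem le_nhds_state {F : Filter (StateSpace A)} {φ : StateSpace A}
    (h : ∀ a : selfAdjoint A, Filter.Tendsto (fun ψ => ev ψ a) F (𝓝 (ev φ a))) : F ≤ 𝓝 φ := by
  have key : Filter.Tendsto (fun ψ : StateSpace A => ψ.1) F (𝓝 φ.1) := by
    refine WeakBilin.tendsto_iff_forall_eval_tendsto (topDualPairing ℂ A)
      ContinuousLinearMap.coe_injective |>.2 fun x => ?_
    change Filter.Tendsto (fun ψ : StateSpace A => ψ.1 x) F (𝓝 (φ.1 x))
    have hx : ∀ ψ : StateSpace A, ψ.1 x =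
        (ev ψ (realPart x) : ℂ) + Complex.I * (ev ψ (imaginaryPart x) : ℂ) := fun ψ => by
      conv_lhs => rw [← realPart_add_I_smul_imaginaryPart x]
      rw [map_add, map_smul, state_eq_ev, state_eq_ev, smul_eq_mul]
    simp only [hx]
    have hc := Complex.continuous_ofReal
    exact ((hc.tendsto _).comp (h _)).add (((hc.tendsto _).comp (h _)).const_mul _)
  rw [nhds_subtype_eq_comap]
  exact Filter.map_le_iff_le_comap.1 key

theorem tendsto_state {ι : Type*} {F : Filter ι} {φ : StateSpace A} {Φ : ι → StateSpace A}
    (h : ∀ a : selfAdjoint A, Filter.Tendsto (fun i => ev (Φ i) a) F (𝓝 (ev φ a))) :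
    Filter.Tendsto Φ F (𝓝 φ) :=
  le_nhds_state fun a => Filter.tendsto_map'_iff.2 (h a)

theorem lip_sub_smul_one {L : ExtSeminorm (selfAdjoint A)} (h1 : L 1 = 0) (a : selfAdjoint A)
    (t : ℝ) : L (a - t • 1) = L a :=
  L.map_sub_eq (by rw [L.map_smul', h1, mul_zero])

theorem isClosed_scalars : IsClosed (Set.range fun r : ℝ => r • (1 : selfAdjoint A)) := by
  have : (Set.range fun r : ℝ => r • (1 : selfAdjoint A)) =
      (Submodule.span ℝ {(1 : selfAdjoint A)} : Set (selfAdjoint A)) := by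
    ext x; simp [Submodule.mem_span_singleton]
  rw [this]
  exact Submodule.closed_of_finiteDimensional _

/-- Rieffel's criterion: a seminorm with dense domain whose unit ball is bounded and totally bounded
modulo scalars is a Lip-norm. -/
theorem isLipNorm_of_totallyBounded {L : ExtSeminorm (selfAdjoint A)}
    (hd : Dense L.dom) (h1 : L 1 = 0) (C : ℝ) (hC : ∀ a, L a ≤ 1 → ∃ t : ℝ, ‖a - t • 1‖ ≤ C)
    (htb : TotallyBounded {a : selfAdjoint A | L a ≤ 1 ∧ ‖a‖ ≤ C}) : IsLipNorm L := by
  have hC0 : 0 ≤ C := by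
    obtain ⟨t, ht⟩ := hC 0 (by rw [L.map_zero]; exact zero_le)
    exact (norm_nonneg _).trans ht
  refine ⟨hd, fun a => ⟨fun ha => ?_, ?_⟩, ?_⟩
  · obtain ⟨r, hr⟩ : a ∈ Set.range fun r : ℝ => r • (1 : selfAdjoint A) := by
      rw [← isClosed_scalars.closure_eq, Metric.mem_closure_iff]
      intro ε hε
      obtain ⟨n, hn⟩ := exists_nat_gt (C / ε)
      have hn0 : (0 : ℝ) < n := lt_of_le_of_lt (by positivity) hn
      obtain ⟨t, ht⟩ := hC ((n : ℝ) • a) (by rw [L.map_smul', ha, mul_zero]; exact zero_le)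
      refine ⟨_, ⟨t / n, rfl⟩, ?_⟩
      have e : (n : ℝ) • a - t • (1 : selfAdjoint A) = (n : ℝ) • (a - (t / n) • 1) := by
        rw [smul_sub, smul_smul, mul_div_cancel₀ _ hn0.ne']
      rw [e, norm_smul, Real.norm_of_nonneg hn0.le] at ht
      rw [dist_eq_norm]
      rw [div_lt_iff₀ hε] at hn
      nlinarith
    exact ⟨r, hr.symm⟩
  · rintro ⟨r, rfl⟩
    rw [L.map_smul', h1, mul_zero]
  · refine le_antisymm (le_of_nhds_le_nhds fun φ => ?_) (le_of_nhds_le_nhds fun φ => ?_)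
    · refine le_nhds_state fun a => Metric.tendsto_nhds.2 fun η hη => ?_
      obtain ⟨b, hb, hab⟩ := Metric.mem_closure_iff.1 (hd a) (η / 3) (by positivity)
      lift L b to ℝ≥0 using ne_of_lt hb with l hl
      have hr : 0 < η / 3 / (l + 1) := by positivity
      refine Filter.mem_of_superset (@Metric.eball_mem_nhds _ (mkMetric L) φ
        (ENNReal.ofReal (η / 3 / (l + 1))) (ENNReal.ofReal_pos.2 hr)) fun ψ hψ => ?_
      have hψ' : mkDist L ψ φ ≤ (Real.toNNReal (η / 3 / (l + 1)) : ℝ≥0∞) := le_of_lt hψ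
      have e := mkDist_le_iff.1 hψ' b l hl.symm.le
      rw [Real.coe_toNNReal _ hr.le] at e
      have e1 : |ev ψ b - ev φ b| ≤ η / 3 := e.trans (by
        rw [div_mul_eq_mul_div, div_le_iff₀ (by positivity)]
        have := l.2
        nlinarith)
      have e2 := abs_ev_le_norm ψ (a - b)
      have e3 := abs_ev_le_norm φ (a - b)
      rw [dist_eq_norm] at hab
      rw [map_sub] at e2 e3
      change dist (ev ψ a) (ev φ a) < η
      rw [Real.dist_eq, abs_lt]
      rw [abs_le] at e1 e2 e3
      constructor <;> linarith
    · refine (@Metric.nhds_basis_eball _ (mkMetric L) φ).ge_iff.2 fun ε hε => ?_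
      obtain ⟨η, hη, hηε⟩ := ENNReal.lt_iff_exists_nnreal_btwn.1 hε
      have hη0 : (0 : ℝ) < η := by exact_mod_cast hη
      obtain ⟨s, hs, hcov⟩ := Metric.totallyBounded_iff.1 htb (η / 3) (by positivity)
      have hev : ∀ᶠ ψ in 𝓝 φ, ∀ y ∈ s, |ev ψ y - ev φ y| < η / 3 := by
        rw [Filter.eventually_all_finite hs]
        intro y _
        exact Metric.tendsto_nhds.1 ((continuous_ev y).tendsto φ) _ (by positivity)
      filter_upwards [hev] with ψ hψ
      change mkDist L ψ φ < ε
      refine lt_of_le_of_lt (iSup₂_le fun a ha => ?_) hηε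
      obtain ⟨t, ht⟩ := hC a ha
      obtain ⟨y, hy, hay⟩ := Set.mem_iUnion₂.1 (hcov (show a - t • 1 ∈ _ from
        ⟨(lip_sub_smul_one h1 a t).le.trans ha, ht⟩))
      rw [Metric.mem_ball, dist_eq_norm] at hay
      rw [enorm_state_sub, enorm_le_coe, ← NNReal.coe_le_coe, coe_nnnorm, Real.norm_eq_abs]
      have e1 := hψ y hy
      have e2 := abs_ev_le_norm ψ (a - t • 1 - y)
      have e3 := abs_ev_le_norm φ (a - t • 1 - y)
      rw [map_sub, map_sub, ev_smul_one] at e2 e3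
      rw [abs_lt] at e1
      rw [abs_le] at e2 e3 ⊢
      constructor <;> linarith

variable {L : ExtSeminorm (selfAdjoint A)}

theorem IsLipNorm.map_one (hL : IsLipNorm L) : L 1 = 0 :=
  (hL.eq_zero_iff 1).2 ⟨1, (one_smul _ _).symm⟩

theorem IsLipNorm.eball_mem_nhds (hL : IsLipNorm L) (φ : StateSpace A) {ε : ℝ≥0∞} (hε : 0 < ε) :
    {ψ | mkDist L ψ φ < ε} ∈ 𝓝 φ := by
  have h := @Metric.eball_mem_nhds _ (mkMetric L) φ ε hε
  rw [hL.topology_eq] at h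
  exact h

theorem exists_convex_comb (φ ψ : StateSpace A) {t : ℝ} (h0 : 0 ≤ t) (h1 : t ≤ 1) :
    ∃ χ : StateSpace A, ∀ a, ev χ a = ev φ a + t * (ev ψ a - ev φ a) := by
  obtain ⟨χ, hχ⟩ := exists_state_of_le_norm ((1 - t) • ev φ + t • ev ψ)
    (fun b => by
      simp only [LinearMap.add_apply, LinearMap.smul_apply, smul_eq_mul]
      have e1 := ev_le_norm φ b
      have e2 := ev_le_norm ψ b
      nlinarith)
    (by
      simp only [LinearMap.add_apply, LinearMap.smul_apply, smul_eq_mul, ev_one]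
      ring)
  refine ⟨χ, fun a => ?_⟩
  rw [hχ]
  simp only [LinearMap.add_apply, LinearMap.smul_apply, smul_eq_mul]
  ring

/-- Two states are at finite distance: short segments have length at most one. -/
theorem IsLipNorm.mkDist_lt_top (hL : IsLipNorm L) (φ ψ : StateSpace A) : mkDist L φ ψ < ∞ := by
  have hmem : ∀ n : ℕ, (0 : ℝ) ≤ 1 / ((n : ℝ) + 1) ∧ 1 / ((n : ℝ) + 1) ≤ 1 := fun n =>
    ⟨by positivity, by rw [div_le_one (by positivity)]; linarith [n.cast_nonneg (α := ℝ)]⟩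
  choose χ hχ using fun n : ℕ => exists_convex_comb φ ψ (hmem n).1 (hmem n).2
  have hlim : Filter.Tendsto χ Filter.atTop (𝓝 φ) := tendsto_state fun a => by
    simp only [hχ]
    have := (tendsto_one_div_add_atTop_nhds_zero_nat (𝕜 := ℝ)).mul_const (ev ψ a - ev φ a)
    simpa using this.const_add (ev φ a)
  obtain ⟨n, hn⟩ := (hlim.eventually (hL.eball_mem_nhds φ zero_lt_one)).exists
  have hn' : mkDist L (χ n) φ ≤ (1 : ℝ≥0) := by exact_mod_cast hn.le
  refine lt_of_le_of_lt (mkDist_le_iff (r := n + 1).2 fun a l hl => ?_) ENNReal.coe_lt_top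
  have e := mkDist_le_iff.1 hn' a l hl
  have hn0 : (0 : ℝ) < n + 1 := by positivity
  rw [hχ, add_sub_cancel_left, abs_mul, abs_of_nonneg (hmem n).1, one_div_mul_eq_div,
    div_le_iff₀ hn0, abs_sub_comm] at e
  push_cast at e ⊢
  linarith

/-- The state space is weak* compact, hence totally bounded for the Monge-Kantorovich metric. -/
theorem IsLipNorm.exists_finite_net (hL : IsLipNorm L) {ε : ℝ≥0∞} (hε : 0 < ε) :
    ∃ s : Finset (StateSpace A), ∀ φ, ∃ ψ ∈ s, mkDist L φ ψ < ε := by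
  have : CompactSpace (StateSpace A) := isCompact_iff_compactSpace.1 isCompact_stateSpace
  obtain ⟨s, -, hs⟩ := (isCompact_univ (X := StateSpace A)).elim_nhds_subcover
    (fun ψ => {φ | mkDist L φ ψ < ε}) fun ψ _ => hL.eball_mem_nhds ψ hε
  refine ⟨s, fun φ => ?_⟩
  simpa using hs (Set.mem_univ φ)

theorem IsLipNorm.exists_mkDist_le (hL : IsLipNorm L) : ∃ C : ℝ≥0, ∀ φ ψ, mkDist L φ ψ ≤ C := by
  obtain ⟨s, hs⟩ := hL.exists_finite_net zero_lt_one
  rcases isEmpty_or_nonempty (StateSpace A) with h | ⟨⟨μ⟩⟩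
  · exact ⟨0, fun φ => (h.false φ).elim⟩
  have hM : (s.sup fun ψ => mkDist L ψ μ) < ∞ :=
    (Finset.sup_lt_iff (by simp)).2 fun ψ _ => hL.mkDist_lt_top ψ μ
  have hle : ∀ φ, mkDist L φ μ ≤ 1 + s.sup fun ψ => mkDist L ψ μ := fun φ => by
    obtain ⟨ψ, hψ, h⟩ := hs φ
    exact (@edist_triangle _ (mkMetric L) φ ψ μ).trans (add_le_add h.le
      (Finset.le_sup (f := fun ψ => mkDist L ψ μ) hψ))
  set M := 1 + s.sup fun ψ => mkDist L ψ μ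
  have hMt : M + M ≠ ∞ := by simp [M, hM.ne]
  refine ⟨(M + M).toNNReal, fun φ ψ => ?_⟩
  rw [ENNReal.coe_toNNReal hMt]
  refine (@edist_triangle _ (mkMetric L) φ μ ψ).trans (add_le_add (hle φ) ?_)
  rw [@edist_comm _ (mkMetric L)]
  exact hle ψ

theorem mkDiam_lt_top (hL : IsLipNorm L) : mkDiam L < ∞ := by
  obtain ⟨C, hC⟩ := hL.exists_mkDist_le
  exact (@Metric.ediam_le _ Set.univ (mkMetric L) _ fun φ _ ψ _ => hC φ ψ).trans_lt
    ENNReal.coe_lt_top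

theorem norm_sub_ev_le [Nontrivial A] {C : ℝ≥0} (hC : ∀ φ ψ, mkDist L φ ψ ≤ C)
    (μ : StateSpace A) {a : selfAdjoint A} {l : ℝ≥0} (ha : L a ≤ l) :
    ‖a - ev μ a • 1‖ ≤ C * l := by
  refine norm_le_of_forall_state fun φ => ?_
  rw [map_sub, ev_smul_one]
  exact mkDist_le_iff.1 (hC φ μ) a l ha

/-- The unit ball of a Lip-norm is bounded modulo the scalars, which is one half of the converse to
Rieffel's criterion. The constant is a bound for the diameter of the state space. -/
theorem IsLipNorm.exists_norm_sub_le [Nontrivial A] (hL : IsLipNorm L) :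
    ∃ C : ℝ≥0, ∀ (a : selfAdjoint A) (l : ℝ≥0), L a ≤ l → ∃ t : ℝ, ‖a - t • 1‖ ≤ C * l := by
  obtain ⟨C, hC⟩ := hL.exists_mkDist_le
  obtain ⟨μ⟩ := nonempty_stateSpace (A := A)
  exact ⟨C, fun a l ha => ⟨_, norm_sub_ev_le hC μ ha⟩⟩

/-- The other half of the converse to Rieffel's criterion: elements of a Lip-ball are equi-Lipschitz
on the state space, so that they are determined up to a small error by their values on a finite net.
-/
theorem IsLipNorm.totallyBounded [Nontrivial A] (hL : IsLipNorm L) (l : ℝ≥0) (R : ℝ) :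
    TotallyBounded {a : selfAdjoint A | L a ≤ l ∧ ‖a‖ ≤ R} := by
  rw [← Set.image_id {a : selfAdjoint A | L a ≤ l ∧ ‖a‖ ≤ R}]
  refine totallyBounded_image_of_approx.{0} fun η hη => ?_
  have hε : 0 < η / 2 / (l + 1) := by positivity
  obtain ⟨s, hs⟩ := hL.exists_finite_net (ε := ENNReal.ofReal (η / 2 / (l + 1)))
    (ENNReal.ofReal_pos.2 hε)
  refine ⟨Fin s.card → ℝ, inferInstance, fun a i => ev (s.equivFin.symm i).1 a, ?_, ?_⟩
  · refine totallyBounded_pi fun i => ?_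
    refine TotallyBounded.subset ?_ (isCompact_Icc (a := -R) (b := R)).totallyBounded
    rintro _ ⟨_, ⟨a, ha, rfl⟩, rfl⟩
    exact abs_le.1 ((abs_ev_le_norm _ a).trans ha.2)
  · intro a ha b hb
    rw [dist_eq_norm]
    refine norm_le_of_forall_state fun φ => ?_
    obtain ⟨ψ, hψ, hlt⟩ := hs φ
    have hle : mkDist L φ ψ ≤ (Real.toNNReal (η / 2 / (l + 1)) : ℝ≥0∞) := hlt.le
    have e1 := mkDist_le_iff.1 hle a l ha.1
    have e2 := mkDist_le_iff.1 hle b l hb.1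
    rw [Real.coe_toNNReal _ hε.le] at e1 e2
    have hsmall : η / 2 / (l + 1) * l ≤ η / 2 := by
      rw [div_mul_eq_mul_div, div_le_iff₀ (by positivity)]
      have := l.2
      nlinarith
    have e3 := dist_le_pi_dist (fun i => ev (s.equivFin.symm i).1 a)
      (fun i => ev (s.equivFin.symm i).1 b) (s.equivFin ⟨ψ, hψ⟩)
    rw [Equiv.symm_apply_apply, Real.dist_eq] at e3
    simp only [id, map_sub]
    generalize dist (fun i => ev (s.equivFin.symm i).1 a) (fun i => ev (s.equivFin.symm i).1 b) = D
      at e3 ⊢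
    rw [abs_le] at e1 e2 e3 ⊢
    constructor <;> linarith

theorem isComplete_selfAdjoint : CompleteSpace (selfAdjoint A) := by
  have : IsClosed (selfAdjoint A : Set A) := isClosed_eq continuous_star continuous_id
  exact this.completeSpace_coe

theorem isClosed_ball_of_isClosed (hc : IsClosed {a : selfAdjoint A | L a ≤ 1}) (l : ℝ≥0) :
    IsClosed {a : selfAdjoint A | L a ≤ l} := by
  have : {a : selfAdjoint A | L a ≤ l} =
      ⋂ (l' : ℝ≥0) (_ : l < l'), {a | L (((l'⁻¹ : ℝ≥0) : ℝ) • a) ≤ 1} := by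
    ext a
    simp only [Set.mem_ofPred_eq, Set.mem_iInter]
    have hpos : ∀ l' : ℝ≥0, l < l' → 0 < l' := fun l' h => lt_of_le_of_lt zero_le h
    constructor
    · intro ha l' hl'
      refine (L.map_smul_le (ha.trans (ENNReal.coe_le_coe.2 hl'.le))).trans ?_
      rw [inv_mul_cancel₀ (hpos l' hl').ne', ENNReal.coe_one]
    · intro h
      refine ENNReal.le_of_forall_pos_le_add fun ε hε _ => ?_
      have hl' : l < l + ε := lt_add_of_pos_right l hε
      have e := L.map_smul_le (r := l + ε) (l := 1) (h _ hl')
      rwa [smul_smul, ← NNReal.coe_mul, mul_inv_cancel₀ (hpos _ hl').ne', NNReal.coe_one,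
        one_smul, mul_one, ENNReal.coe_add] at e
  rw [this]
  exact isClosed_iInter fun l' => isClosed_iInter fun _ => hc.preimage (continuous_const_smul _)

theorem IsLipNorm.isCompact [Nontrivial A] (hL : IsLipNorm L)
    (hc : IsClosed {a : selfAdjoint A | L a ≤ 1}) (l : ℝ≥0) (R : ℝ) :
    IsCompact {a : selfAdjoint A | L a ≤ l ∧ ‖a‖ ≤ R} := by
  have := isComplete_selfAdjoint (A := A)
  refine (hL.totallyBounded l R).isCompact_of_isClosed ?_
  exact (isClosed_ball_of_isClosed hc l).inter (isClosed_le continuous_norm continuous_const)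

end Criterion

/-! ### Jordan and Lie products -/

section JL

variable {A B : Type u} [CStarAlgebra A] [CStarAlgebra B]

/-- The Jordan product for `true` and the Lie product for `false`, to treat both at once. -/
noncomputable def jl (i : Bool) (a b : selfAdjoint A) : selfAdjoint A :=
  if i then jordan a b else lie a b

theorem saMap_jl (π : A →⋆ₐ[ℂ] B) (i : Bool) (a b : selfAdjoint A) :
    saMap π (jl i a b) = jl i (saMap π a) (saMap π b) := by
  cases i
  · exact saMap_lie π a b
  · exact saMap_jordan π a b

theorem norm_jl_sub_le (i : Bool) (x x' y y' : selfAdjoint A) :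
    ‖jl i x x' - jl i y y'‖ ≤ ‖x - y‖ * ‖x'‖ + ‖y‖ * ‖x' - y'‖ := by
  have h1 : ‖((x : A) - y) * x'‖ ≤ ‖x - y‖ * ‖x'‖ := norm_mul_le _ _
  have h2 : ‖(y : A) * (x' - y')‖ ≤ ‖y‖ * ‖x' - y'‖ := norm_mul_le _ _
  have h3 : ‖(x' : A) * (x - y)‖ ≤ ‖x'‖ * ‖x - y‖ := norm_mul_le _ _
  have h4 : ‖((x' : A) - y') * y‖ ≤ ‖x' - y'‖ * ‖y‖ := norm_mul_le _ _
  cases i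
  · have e : ((jl false x x' - jl false y y' : selfAdjoint A) : A) =
        (1 / (2 * Complex.I) : ℂ) • ((((x : A) - y) * x' + (y : A) * (x' - y')) -
          ((x' : A) * (x - y) + ((x' : A) - y') * y)) := by
      change (1 / (2 * Complex.I) : ℂ) • ((x : A) * x' - x' * x) -
        (1 / (2 * Complex.I) : ℂ) • ((y : A) * y' - y' * y) = _
      rw [← smul_sub]
      congr 1
      noncomm_ring
    change ‖((jl false x x' - jl false y y' : selfAdjoint A) : A)‖ ≤ _
    rw [e, norm_smul]
    have hc : ‖(1 / (2 * Complex.I) : ℂ)‖ = 1 / 2 := by simp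
    rw [hc]
    have := norm_sub_le (((x : A) - y) * x' + (y : A) * (x' - y'))
      ((x' : A) * (x - y) + ((x' : A) - y') * y)
    have := norm_add_le (((x : A) - y) * x') ((y : A) * (x' - y'))
    have := norm_add_le ((x' : A) * (x - y)) (((x' : A) - y') * y)
    linarith
  · have e : ((jl true x x' - jl true y y' : selfAdjoint A) : A) =
        (1 / 2 : ℂ) • ((((x : A) - y) * x' + (y : A) * (x' - y')) +
          ((x' : A) * (x - y) + ((x' : A) - y') * y)) := by
      change (1 / 2 : ℂ) • ((x : A) * x' + x' * x) -
        (1 / 2 : ℂ) • ((y : A) * y' + y' * y) = _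
      rw [← smul_sub]
      congr 1
      noncomm_ring
    change ‖((jl true x x' - jl true y y' : selfAdjoint A) : A)‖ ≤ _
    rw [e, norm_smul]
    have hc : ‖(1 / 2 : ℂ)‖ = 1 / 2 := by simp
    rw [hc]
    have := norm_add_le (((x : A) - y) * x' + (y : A) * (x' - y'))
      ((x' : A) * (x - y) + ((x' : A) - y') * y)
    have := norm_add_le (((x : A) - y) * x') ((y : A) * (x' - y'))
    have := norm_add_le ((x' : A) * (x - y)) (((x' : A) - y') * y)
    linarith

theorem jl_smul_one (i : Bool) (s t : ℝ) :
    ∃ r : ℝ, jl i (s • (1 : selfAdjoint A)) (t • 1) = r • 1 := by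
  cases i
  · refine ⟨0, Subtype.ext ?_⟩
    change (1 / (2 * Complex.I) : ℂ) •
      ((s • (1 : A)) * (t • (1 : A)) - (t • (1 : A)) * (s • (1 : A))) =
      (0 : ℝ) • (1 : A)
    simp [smul_smul, mul_comm]
  · refine ⟨s * t, Subtype.ext ?_⟩
    change (1 / 2 : ℂ) • ((s • (1 : A)) * (t • (1 : A)) + (t • (1 : A)) * (s • (1 : A)))
      = (s * t) • (1 : A)
    have : (s • (1 : A)) * (t • (1 : A)) + (t • (1 : A)) * (s • (1 : A)) =
        (2 : ℂ) • (s * t) • (1 : A) := by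
      rw [two_smul]
      simp [smul_smul, mul_comm]
    rw [this, smul_smul]
    norm_num

theorem IsQQCMS.jl_le {F : ℝ≥0 × ℝ≥0 × ℝ≥0 × ℝ≥0 → ℝ≥0} {𝔄 : Pair.{u}} (h : IsQQCMS F 𝔄)
    (i : Bool) {a b : selfAdjoint 𝔄} (ha : a ∈ 𝔄.lip.dom) (hb : b ∈ 𝔄.lip.dom) :
    𝔄.lip (jl i a b) ≤ F (‖a‖₊, ‖b‖₊, (𝔄.lip a).toNNReal, (𝔄.lip b).toNNReal) := by
  cases i
  · exact h.lie_le a ha b hb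
  · exact h.jordan_le a ha b hb

theorem IsQQCMS.jl_le_of_le {F : ℝ≥0 × ℝ≥0 × ℝ≥0 × ℝ≥0 → ℝ≥0} {𝔄 : Pair.{u}} (h : IsQQCMS F 𝔄)
    (hF : Monotone F) (i : Bool) {a b : selfAdjoint 𝔄} {x y l m : ℝ≥0} (hx : ‖a‖₊ ≤ x)
    (hy : ‖b‖₊ ≤ y) (hl : 𝔄.lip a ≤ l) (hm : 𝔄.lip b ≤ m) :
    𝔄.lip (jl i a b) ≤ F (x, y, l, m) := by
  refine (h.jl_le i (lt_of_le_of_lt hl ENNReal.coe_lt_top)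
    (lt_of_le_of_lt hm ENNReal.coe_lt_top)).trans (ENNReal.coe_le_coe.2 (hF ?_))
  exact ⟨hx, hy, by simpa using ENNReal.toNNReal_mono ENNReal.coe_ne_top hl,
    by simpa using ENNReal.toNNReal_mono ENNReal.coe_ne_top hm⟩

theorem IsQQCMS.of_jl {F : ℝ≥0 × ℝ≥0 × ℝ≥0 × ℝ≥0 → ℝ≥0} {𝔄 : Pair.{u}}
    (hn : Nontrivial 𝔄) (hL : IsLipNorm 𝔄.lip) (hc : IsClosed {a : selfAdjoint 𝔄 | 𝔄.lip a ≤ 1})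
    (h : ∀ (i : Bool) (a b : selfAdjoint 𝔄) (l m : ℝ≥0), 𝔄.lip a = l → 𝔄.lip b = m →
      𝔄.lip (jl i a b) ≤ F (‖a‖₊, ‖b‖₊, l, m)) : IsQQCMS F 𝔄 where
  nontrivial := hn
  isLipNorm := hL
  isClosed := hc
  jordan_le a ha b hb := h true a b _ _ (ENNReal.coe_toNNReal (ne_of_lt ha)).symm
    (ENNReal.coe_toNNReal (ne_of_lt hb)).symm
  lie_le a ha b hb := h false a b _ _ (ENNReal.coe_toNNReal (ne_of_lt ha)).symm
    (ENNReal.coe_toNNReal (ne_of_lt hb)).symm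

end JL

/-! ### Quotients -/

section Quotient

variable {D A : Type u} [CStarAlgebra D] [CStarAlgebra A] {LD : ExtSeminorm (selfAdjoint D)}
  {π : D →⋆ₐ[ℂ] A} {L : ExtSeminorm (selfAdjoint A)}

theorem IsQuotient.le (h : IsQuotient LD π L) (d : selfAdjoint D) : L (saMap π d) ≤ LD d :=
  (h _).trans_le
    (iInf₂_le (f := fun (d' : selfAdjoint D) (_ : saMap π d' = saMap π d) => LD d') d rfl)

theorem IsQuotient.exists_lift (h : IsQuotient LD π L) {a : selfAdjoint A} {l : ℝ≥0∞}
    (ha : L a < l) : ∃ d, saMap π d = a ∧ LD d < l := by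
  rw [h a, iInf_lt_iff] at ha
  obtain ⟨d, hd⟩ := ha
  rw [iInf_lt_iff] at hd
  obtain ⟨hd, hl⟩ := hd
  exact ⟨d, hd, hl⟩

theorem isQuotient_of_lift (hle : ∀ d, L (saMap π d) ≤ LD d)
    (hlift : ∀ (a : selfAdjoint A) (l : ℝ≥0), L a < l → ∃ d, saMap π d = a ∧ LD d ≤ l) :
    IsQuotient LD π L := by
  intro a
  refine le_antisymm (le_iInf₂ fun d hd => hd ▸ hle d) ?_
  refine ENNReal.le_of_forall_nnreal_lt fun r hr => ?_
  by_contra hcon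
  obtain ⟨d, hd, hl⟩ := hlift a r (not_le.1 hcon)
  obtain ⟨l, hl1, hl2⟩ := ENNReal.lt_iff_exists_nnreal_btwn.1 (not_le.1 hcon)
  obtain ⟨d, hd, hdl⟩ := hlift a l hl1
  exact absurd ((iInf₂_le d hd).trans hdl) (not_le.2 (hl2.trans hr))

end Quotient

/-! ### Lip-norms on direct sums -/

section Prod

theorem totallyBounded_image_prod {X Y Z : Type*} [PseudoMetricSpace X] [PseudoMetricSpace Y]
    {f : Z → X} {g : Z → Y} {W : Set Z} (hf : TotallyBounded (f '' W))
    (hg : TotallyBounded (g '' W)) : TotallyBounded ((fun z => (f z, g z)) '' W) := by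
  rw [Metric.totallyBounded_iff] at *
  intro ε hε
  obtain ⟨s, hs, hs'⟩ := hf ε hε
  obtain ⟨t, ht, ht'⟩ := hg ε hε
  refine ⟨s ×ˢ t, hs.prod ht, ?_⟩
  rintro _ ⟨z, hz, rfl⟩
  obtain ⟨x, hx, hxz⟩ := Set.mem_iUnion₂.1 (hs' ⟨z, hz, rfl⟩)
  obtain ⟨y, hy, hyz⟩ := Set.mem_iUnion₂.1 (ht' ⟨z, hz, rfl⟩)
  exact Set.mem_iUnion₂.2 ⟨(x, y), ⟨hx, hy⟩, by
    rw [Metric.mem_ball, Prod.dist_eq]; exact max_lt hxz hyz⟩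

variable {A B : Type u} [CStarAlgebra A] [CStarAlgebra B]

/-- The first component of a self-adjoint element of a direct sum. -/
noncomputable abbrev saFst (d : selfAdjoint (A × B)) : selfAdjoint A :=
  saMap (StarAlgHom.fst ℂ A B) d

/-- The second component of a self-adjoint element of a direct sum. -/
noncomputable abbrev saSnd (d : selfAdjoint (A × B)) : selfAdjoint B :=
  saMap (StarAlgHom.snd ℂ A B) d

/-- The self-adjoint element of a direct sum with given components. -/
def saProd (a : selfAdjoint A) (b : selfAdjoint B) : selfAdjoint (A × B) :=
  ⟨(a.1, b.1), by
    rw [selfAdjoint.mem_iff]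
    exact Prod.ext a.2 b.2⟩

theorem saFst_saProd (a : selfAdjoint A) (b : selfAdjoint B) : saFst (saProd a b) = a := rfl

theorem saSnd_saProd (a : selfAdjoint A) (b : selfAdjoint B) : saSnd (saProd a b) = b := rfl

theorem saFst_one : saFst (1 : selfAdjoint (A × B)) = 1 := rfl

theorem saSnd_one : saSnd (1 : selfAdjoint (A × B)) = 1 := rfl

theorem saFst_jl (i : Bool) (d d' : selfAdjoint (A × B)) :
    saFst (jl i d d') = jl i (saFst d) (saFst d') := saMap_jl _ i d d'

theorem saSnd_jl (i : Bool) (d d' : selfAdjoint (A × B)) :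
    saSnd (jl i d d') = jl i (saSnd d) (saSnd d') := saMap_jl _ i d d'

theorem saFst_sub_smul_one (d : selfAdjoint (A × B)) (t : ℝ) :
    saFst (d - t • 1) = saFst d - t • 1 := rfl

theorem saSnd_sub_smul_one (d : selfAdjoint (A × B)) (t : ℝ) :
    saSnd (d - t • 1) = saSnd d - t • 1 := rfl

theorem norm_eq_max (d : selfAdjoint (A × B)) : ‖d‖ = max ‖saFst d‖ ‖saSnd d‖ :=
  Prod.norm_def (d : A × B)

theorem norm_saFst_le (d : selfAdjoint (A × B)) : ‖saFst d‖ ≤ ‖d‖ := norm_saMap_le _ d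

theorem norm_saSnd_le (d : selfAdjoint (A × B)) : ‖saSnd d‖ ≤ ‖d‖ := norm_saMap_le _ d

/-- A seminorm on a direct sum which dominates the Lip-norms of the summands is a Lip-norm when it
has the right domain and its unit ball is bounded modulo the scalars: total boundedness is inherited
from the summands. -/
theorem isLipNorm_prod [Nontrivial A] [Nontrivial B] {LA : ExtSeminorm (selfAdjoint A)}
    {LB : ExtSeminorm (selfAdjoint B)} {L : ExtSeminorm (selfAdjoint (A × B))}
    (hA : IsLipNorm LA) (hB : IsLipNorm LB)
    (hLA : ∀ d, LA (saFst d) ≤ L d) (hLB : ∀ d, LB (saSnd d) ≤ L d) (h1 : L 1 = 0)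
    (hdom : ∀ d, LA (saFst d) < ∞ → LB (saSnd d) < ∞ → L d < ∞)
    (C : ℝ) (hC : ∀ d, L d ≤ 1 → ∃ t : ℝ, ‖d - t • 1‖ ≤ C) : IsLipNorm L := by
  refine isLipNorm_of_totallyBounded (fun d => ?_) h1 C hC ?_
  · rw [Metric.mem_closure_iff]
    intro ε hε
    obtain ⟨a, ha, hda⟩ := Metric.mem_closure_iff.1 (hA.dense_dom (saFst d)) ε hε
    obtain ⟨b, hb, hdb⟩ := Metric.mem_closure_iff.1 (hB.dense_dom (saSnd d)) ε hε
    exact ⟨saProd a b, hdom _ ha hb, max_lt hda hdb⟩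
  · rw [← Set.image_id {d : selfAdjoint (A × B) | L d ≤ 1 ∧ ‖d‖ ≤ C}]
    refine totallyBounded_image_of_approx.{u} fun η hη => ⟨selfAdjoint A × selfAdjoint B,
      inferInstance, fun d => (saFst d, saSnd d), totallyBounded_image_prod ?_ ?_, ?_⟩
    · refine (hA.totallyBounded 1 C).subset ?_
      rintro _ ⟨d, hd, rfl⟩
      exact ⟨(hLA d).trans hd.1, (norm_saFst_le d).trans hd.2⟩
    · refine (hB.totallyBounded 1 C).subset ?_
      rintro _ ⟨d, hd, rfl⟩
      exact ⟨(hLB d).trans hd.1, (norm_saSnd_le d).trans hd.2⟩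
    · intro d _ d' _
      exact le_add_of_nonneg_right hη.le

/-- The maximum of the Lip-norms of the summands and of a closed seminorm `N` which satisfies the
Leibniz inequality for the norm. The Leibniz bound for `N` is absorbed by `F`, as `F` is
permissible. -/
theorem isQQCMS_prod {F : ℝ≥0 × ℝ≥0 × ℝ≥0 × ℝ≥0 → ℝ≥0} (hF : Permissible F) {𝔄 𝔅 : Pair.{u}}
    (hA : IsQQCMS F 𝔄) (hB : IsQQCMS F 𝔅) {L : ExtSeminorm (selfAdjoint (𝔄 × 𝔅))}
    {N : selfAdjoint (𝔄 × 𝔅) → ℝ≥0∞}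
    (hL : ∀ d, L d = max (max (𝔄.lip (saFst d)) (𝔅.lip (saSnd d))) (N d))
    (hN : ∀ d, N d < ∞) (hNc : IsClosed {d | N d ≤ 1}) (hN1 : N 1 = 0)
    (hNjl : ∀ i d d', N (jl i d d') ≤ ‖d‖ₑ * N d' + ‖d'‖ₑ * N d)
    (C : ℝ) (hC : ∀ d, L d ≤ 1 → ∃ t : ℝ, ‖d - t • 1‖ ≤ C) : IsQQCMS F ⟨𝔄 × 𝔅, L⟩ := by
  have := hA.nontrivial
  have := hB.nontrivial
  have hLA : ∀ d, 𝔄.lip (saFst d) ≤ L d := fun d => by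
    rw [hL]; exact (le_max_left _ _).trans (le_max_left _ _)
  have hLB : ∀ d, 𝔅.lip (saSnd d) ≤ L d := fun d => by
    rw [hL]; exact (le_max_right _ _).trans (le_max_left _ _)
  have hLN : ∀ d, N d ≤ L d := fun d => by
    rw [hL]; exact le_max_right _ _
  refine IsQQCMS.of_jl (inferInstance : Nontrivial (𝔄 × 𝔅)) ?_ ?_ ?_
  · refine isLipNorm_prod hA.isLipNorm hB.isLipNorm hLA hLB ?_ (fun d h h' => ?_) C hC
    · rw [hL, hN1, saFst_one, saSnd_one, hA.isLipNorm.map_one, hB.isLipNorm.map_one]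
      simp
    · rw [hL]
      exact max_lt (max_lt h h') (hN d)
  · have : {d : selfAdjoint (𝔄 × 𝔅) | L d ≤ 1} = ({d | 𝔄.lip (saFst d) ≤ 1} ∩
        {d | 𝔅.lip (saSnd d) ≤ 1}) ∩ {d | N d ≤ 1} := by
      ext d
      simp [hL]
    change IsClosed {d : selfAdjoint (𝔄 × 𝔅) | L d ≤ 1}
    rw [this]
    exact ((hA.isClosed.preimage (continuous_saMap _)).inter
      (hB.isClosed.preimage (continuous_saMap _))).inter hNc
  · intro i d d' l l' hl hl'
    change L d = l at hl
    change L d' = l' at hl'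
    change L (jl i d d') ≤ _
    rw [hL (jl i d d')]
    refine max_le (max_le ?_ ?_) ?_
    · rw [saFst_jl]
      exact hA.jl_le_of_le hF.1 i (norm_saFst_le d) (norm_saFst_le d') ((hLA d).trans hl.le)
        ((hLA d').trans hl'.le)
    · rw [saSnd_jl]
      exact hB.jl_le_of_le hF.1 i (norm_saSnd_le d) (norm_saSnd_le d') ((hLB d).trans hl.le)
        ((hLB d').trans hl'.le)
    · refine (hNjl i d d').trans ?_
      refine le_trans ?_ (ENNReal.coe_le_coe.2 (hF.2 ‖d‖₊ ‖d'‖₊ l l'))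
      push_cast
      refine add_le_add (mul_le_mul' le_rfl ((hLN d').trans hl'.le))
        (mul_le_mul' le_rfl ((hLN d).trans hl.le))

end Prod

/-! ### Composition of tunnels -/

section Comp

variable {F : ℝ≥0 × ℝ≥0 × ℝ≥0 × ℝ≥0 → ℝ≥0} {𝔄 𝔅 ℭ : Pair.{u}}

/-- The extent of a tunnel as a pair of norm estimates. -/
theorem IsTunnel.extent_le_iff {τ : PreTunnel 𝔄 𝔅} (hτ : IsTunnel F τ) {r : ℝ≥0} :
    τ.extent ≤ r ↔ NormBound τ.mid.lip τ.left r ∧ NormBound τ.mid.lip τ.right r := by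
  have := hτ.mid.nontrivial
  have h1 := hτ.mid.isLipNorm.map_one
  rw [PreTunnel.extent, max_le_iff, mkHaus_range_le_iff h1, mkHaus_range_le_iff h1]

/-- Some norm bound always holds, as elements of a Lip-ball are within a fixed distance of the
scalars. -/
theorem IsLipNorm.exists_normBound {D A : Type u} [CStarAlgebra D] [CStarAlgebra A] [Nontrivial D]
    [Nontrivial A] {L : ExtSeminorm (selfAdjoint D)} (hL : IsLipNorm L) :
    ∃ r : ℝ≥0, ∀ π : D →⋆ₐ[ℂ] A, NormBound L π r := by
  obtain ⟨C, hC⟩ := hL.exists_norm_sub_le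
  refine ⟨2 * C, fun π d l hl => ?_⟩
  obtain ⟨t, ht⟩ := hC d l hl
  have e1 := norm_saMap_le π (d - t • 1)
  rw [saMap_sub, saMap_smul_one] at e1
  have e2 := norm_sub_norm_le (t • (1 : selfAdjoint A)) (saMap π d)
  rw [norm_smul_one, norm_sub_rev] at e2
  have e3 := norm_sub_norm_le d (t • (1 : selfAdjoint D))
  rw [norm_smul_one] at e3
  push_cast
  linarith

theorem IsTunnel.extent_lt_top {τ : PreTunnel 𝔄 𝔅} (hτ : IsTunnel F τ) : τ.extent < ∞ := by
  have := hτ.mid.nontrivial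
  have := hτ.source.nontrivial
  have := hτ.target.nontrivial
  obtain ⟨r, hr⟩ := hτ.mid.isLipNorm.exists_normBound (A := 𝔄)
  obtain ⟨s, hs⟩ := hτ.mid.isLipNorm.exists_normBound (A := 𝔅)
  have h1 := hτ.mid.isLipNorm.map_one
  exact max_lt (((mkHaus_range_le_iff h1).2 (hr _)).trans_lt ENNReal.coe_lt_top)
    (((mkHaus_range_le_iff h1).2 (hs _)).trans_lt ENNReal.coe_lt_top)

theorem IsTunnel.inv {τ : PreTunnel 𝔄 𝔅} (hτ : IsTunnel F τ) : IsTunnel F τ.inv :=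
  ⟨hτ.target, hτ.source, hτ.mid, hτ.right_surjective, hτ.left_surjective, hτ.right_quotient,
    hτ.left_quotient⟩

theorem PreTunnel.extent_inv (τ : PreTunnel 𝔄 𝔅) : τ.inv.extent = τ.extent := max_comm _ _

variable {τ₁ : PreTunnel 𝔄 𝔅} {τ₂ : PreTunnel 𝔅 ℭ}

theorem compLip_eq (ε : ℝ) (d : selfAdjoint (τ₁.mid × τ₂.mid)) :
    compLip τ₁ τ₂ ε d = max (max (τ₁.mid.lip (saFst d)) (τ₂.mid.lip (saSnd d)))
      (ENNReal.ofReal (1 / ε) * ‖saMap τ₁.right (saFst d) - saMap τ₂.left (saSnd d)‖ₑ) := rfl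

theorem compLip_le_iff {ε : ℝ≥0} (hε : 0 < ε) {d : selfAdjoint (τ₁.mid × τ₂.mid)} {l : ℝ≥0} :
    compLip τ₁ τ₂ ε d ≤ l ↔ τ₁.mid.lip (saFst d) ≤ l ∧ τ₂.mid.lip (saSnd d) ≤ l ∧
      ‖saMap τ₁.right (saFst d) - saMap τ₂.left (saSnd d)‖ ≤ ε * l := by
  rw [compLip_eq, max_le_iff, max_le_iff, and_assoc]
  refine and_congr_right fun _ => and_congr_right fun _ => ?_
  have h : ENNReal.ofReal (1 / ε) = ((ε⁻¹ : ℝ≥0) : ℝ≥0∞) := by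
    rw [one_div, ← NNReal.coe_inv, ENNReal.ofReal_coe_nnreal]
  rw [h, ← coe_nnnorm, ← NNReal.coe_mul, NNReal.coe_le_coe, enorm_eq_nnnorm, ← ENNReal.coe_mul,
    ENNReal.coe_le_coe, inv_mul_le_iff₀ hε]

/-- A tunnel composed with another one is a tunnel. An element of the first space is lifted to the
first tunnel, its image in the middle space is lifted to the second tunnel, and the pair of lifts
has no defect in the middle space. -/
theorem IsTunnel.comp (hF : Permissible F) (h₁ : IsTunnel F τ₁) (h₂ : IsTunnel F τ₂) {ε : ℝ}
    (hε : 0 < ε) : IsTunnel F (τ₁.comp τ₂ ε) := by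
  lift ε to ℝ≥0 using hε.le
  have hε' : 0 < ε := hε
  have := h₁.mid.nontrivial
  have := h₂.mid.nontrivial
  have := h₁.target.nontrivial
  have hmid : IsQQCMS F ⟨τ₁.mid × τ₂.mid, compLip τ₁ τ₂ ε⟩ := by
    obtain ⟨C₁, hC₁⟩ := h₁.mid.isLipNorm.exists_norm_sub_le
    obtain ⟨C₂, hC₂⟩ := h₂.mid.isLipNorm.exists_norm_sub_le
    refine isQQCMS_prod hF h₁.mid h₂.mid (N := fun d => ENNReal.ofReal (1 / ε) *
      ‖saMap τ₁.right (saFst d) - saMap τ₂.left (saSnd d)‖ₑ) (fun d => rfl) (fun d => ?_) ?_ ?_ ?_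
      (C₁ + 2 * C₂ + ε) (fun d hd => ?_)
    · exact ENNReal.mul_lt_top ENNReal.ofReal_lt_top enorm_lt_top
    · have : Continuous fun d : selfAdjoint (τ₁.mid × τ₂.mid) => ENNReal.ofReal (1 / ε) *
          ‖saMap τ₁.right (saFst d) - saMap τ₂.left (saSnd d)‖ₑ := by
        refine (ENNReal.continuous_const_mul ENNReal.ofReal_ne_top).comp (continuous_enorm.comp ?_)
        exact ((continuous_saMap _).comp (continuous_saMap _)).sub
          ((continuous_saMap _).comp (continuous_saMap _))
      exact isClosed_le this continuous_const
    · rw [saFst_one, saSnd_one, saMap_one, saMap_one, sub_self, enorm_eq_nnnorm,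
        nnnorm_zero, ENNReal.coe_zero, mul_zero]
    · intro i d d'
      rw [saFst_jl, saSnd_jl, saMap_jl, saMap_jl, mul_left_comm, mul_left_comm ‖d'‖ₑ, ← mul_add]
      gcongr
      set x := saMap τ₁.right (saFst d)
      set y := saMap τ₂.left (saSnd d)
      set x' := saMap τ₁.right (saFst d')
      set y' := saMap τ₂.left (saSnd d')
      have key := norm_jl_sub_le i x x' y y'
      have hx : ‖x'‖ ≤ ‖d'‖ := (norm_saMap_le _ _).trans (norm_saFst_le d')
      have hy : ‖y‖ ≤ ‖d‖ := (norm_saMap_le _ _).trans (norm_saSnd_le d)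
      have key2 : ‖jl i x x' - jl i y y'‖ ≤ ‖d‖ * ‖x' - y'‖ + ‖d'‖ * ‖x - y‖ := by
        have e1 := mul_le_mul_of_nonneg_left hx (norm_nonneg (x - y))
        have e2 := mul_le_mul_of_nonneg_right hy (norm_nonneg (x' - y'))
        linarith
      simp only [enorm_eq_nnnorm, ← ENNReal.coe_mul, ← ENNReal.coe_add, ENNReal.coe_le_coe]
      exact key2
    · obtain ⟨hd1, hd2, hd3⟩ := (compLip_le_iff hε' (l := 1)).1 hd
      obtain ⟨s, hs⟩ := hC₁ _ 1 hd1
      obtain ⟨t, ht⟩ := hC₂ _ 1 hd2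
      refine ⟨s, ?_⟩
      have e1 := norm_saMap_le τ₁.right (saFst d - s • 1)
      have e2 := norm_saMap_le τ₂.left (saSnd d - t • 1)
      rw [saMap_sub, saMap_smul_one] at e1 e2
      have e3 : |s - t| ≤ C₁ + C₂ + ε := by
        rw [← norm_smul_one (A := 𝔅)]
        have : (s - t) • (1 : selfAdjoint 𝔅) = (saMap τ₂.left (saSnd d) - t • 1) -
            (saMap τ₁.right (saFst d) - s • 1) +
            (saMap τ₁.right (saFst d) - saMap τ₂.left (saSnd d)) := by module
        rw [this]
        have i1 := norm_add_le ((saMap τ₂.left (saSnd d) - t • 1) -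
            (saMap τ₁.right (saFst d) - s • 1))
            (saMap τ₁.right (saFst d) - saMap τ₂.left (saSnd d))
        have i2 := norm_sub_le (saMap τ₂.left (saSnd d) - t • 1)
            (saMap τ₁.right (saFst d) - s • 1)
        simp only [NNReal.coe_one, mul_one] at *
        linarith
      rw [norm_eq_max]
      refine max_le ?_ ?_
      · rw [saFst_sub_smul_one]
        simp only [NNReal.coe_one, mul_one] at *
        have := C₂.2
        have := ε.2
        simp only [NNReal.val_eq_coe] at *
        linarith
      · rw [saSnd_sub_smul_one]
        have : saSnd d - s • (1 : selfAdjoint τ₂.mid) = (saSnd d - t • 1) - (s - t) • 1 := by module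
        rw [this]
        have i1 := norm_sub_le (saSnd d - t • 1) ((s - t) • (1 : selfAdjoint τ₂.mid))
        have i2 := norm_smul_one_le (A := τ₂.mid) (s - t)
        simp only [NNReal.coe_one, mul_one] at *
        linarith
  refine ⟨h₁.source, h₂.target, hmid, ?_, ?_, ?_, ?_⟩
  · intro a
    obtain ⟨d, hd⟩ := h₁.left_surjective a
    exact ⟨(d, 0), hd⟩
  · intro a
    obtain ⟨d, hd⟩ := h₂.right_surjective a
    exact ⟨(0, d), hd⟩
  · refine isQuotient_of_lift (fun d => ?_) fun a l ha => ?_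
    · exact (h₁.left_quotient.le (saFst d)).trans ((le_max_left _ _).trans (le_max_left _ _))
    · obtain ⟨d₁, h1, hl1⟩ := h₁.left_quotient.exists_lift ha
      obtain ⟨d₂, h2, hl2⟩ := h₂.left_quotient.exists_lift
        ((h₁.right_quotient.le d₁).trans_lt hl1)
      refine ⟨saProd d₁ d₂, h1, (compLip_le_iff hε').2 ⟨hl1.le, hl2.le, ?_⟩⟩
      rw [saFst_saProd, saSnd_saProd, h2, sub_self, norm_zero]
      positivity
  · refine isQuotient_of_lift (fun d => ?_) fun a l ha => ?_
    · exact (h₂.right_quotient.le (saSnd d)).trans ((le_max_right _ _).trans (le_max_left _ _))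
    · obtain ⟨d₂, h2, hl2⟩ := h₂.right_quotient.exists_lift ha
      obtain ⟨d₁, h1, hl1⟩ := h₁.right_quotient.exists_lift
        ((h₂.left_quotient.le d₂).trans_lt hl2)
      refine ⟨saProd d₁ d₂, h2, (compLip_le_iff hε').2 ⟨hl1.le, hl2.le, ?_⟩⟩
      rw [saFst_saProd, saSnd_saProd, h1, sub_self, norm_zero]
      positivity

/-- The triangle inequality for extents. The norms of the components of an element of the direct sum
are compared through their images in the middle space, which differ by at most `ε * l`. -/
theorem IsTunnel.extent_comp_le (h₁ : IsTunnel F τ₁) (h₂ : IsTunnel F τ₂) {r₁ r₂ ε : ℝ≥0}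
    (hε : 0 < ε) (h : IsTunnel F (τ₁.comp τ₂ ε)) (hr₁ : τ₁.extent ≤ r₁) (hr₂ : τ₂.extent ≤ r₂) :
    (τ₁.comp τ₂ ε).extent ≤ (r₁ + r₂ + ε : ℝ≥0) := by
  obtain ⟨h1l, h1r⟩ := h₁.extent_le_iff.1 hr₁
  obtain ⟨h2l, h2r⟩ := h₂.extent_le_iff.1 hr₂
  refine h.extent_le_iff.2 ⟨fun d l hd => ?_, fun d l hd => ?_⟩
  all_goals
    obtain ⟨hd1, hd2, hd3⟩ := (compLip_le_iff hε).1 hd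
    have e1 := h1l _ _ hd1
    have e2 := h1r _ _ hd1
    have e3 := h2l _ _ hd2
    have e4 := h2r _ _ hd2
    have i1 := norm_saMap_le τ₁.right (saFst d)
    have i2 := norm_saMap_le τ₂.left (saSnd d)
    have i3 := norm_sub_norm_le (saMap τ₁.right (saFst d)) (saMap τ₂.left (saSnd d))
    have i4 := norm_sub_norm_le (saMap τ₂.left (saSnd d)) (saMap τ₁.right (saFst d))
    rw [norm_sub_rev] at i4
    have p1 : (0 : ℝ) ≤ r₁ * l := by positivity
    have p2 : (0 : ℝ) ≤ r₂ * l := by positivity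
    have p3 : (0 : ℝ) ≤ ε * l := by positivity
    have hmax : ‖d‖ = max ‖saFst d‖ ‖saSnd d‖ := norm_eq_max (A := τ₁.mid) (B := τ₂.mid) d
    rw [hmax]
    push_cast
  · change max _ _ ≤ ‖saMap τ₁.left (saFst d)‖ + _
    refine max_le ?_ ?_ <;> linarith
  · change max _ _ ≤ ‖saMap τ₂.right (saSnd d)‖ + _
    refine max_le ?_ ?_ <;> linarith

end Comp

/-! ### The diameter bound -/

section Build

variable {A B : Type u} [CStarAlgebra A] [CStarAlgebra B]

/-- The maximum of two extended seminorms. -/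
def ExtSeminorm.sup {V : Type u} [AddCommGroup V] [Module ℝ V] (L M : ExtSeminorm V) :
    ExtSeminorm V where
  toFun v := max (L v) (M v)
  map_smul' r v := by rw [L.map_smul', M.map_smul', mul_max]
  map_add_le' v w := max_le
    ((L.map_add_le' v w).trans (add_le_add (le_max_left _ _) (le_max_left _ _)))
    ((M.map_add_le' v w).trans (add_le_add (le_max_right _ _) (le_max_right _ _)))

/-- The multiple of an extended seminorm by a constant. -/
noncomputable def ExtSeminorm.scale {V : Type u} [AddCommGroup V] [Module ℝ V] (c : ℝ≥0)
    (L : ExtSeminorm V) : ExtSeminorm V where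
  toFun v := c * L v
  map_smul' r v := by rw [L.map_smul', mul_left_comm]
  map_add_le' v w := by
    rw [← mul_add]
    exact mul_le_mul' le_rfl (L.map_add_le' v w)

/-- The pull-back of an extended seminorm along a ⋆-homomorphism. -/
noncomputable def ExtSeminorm.pullback (L : ExtSeminorm (selfAdjoint B)) (π : A →⋆ₐ[ℂ] B) :
    ExtSeminorm (selfAdjoint A) where
  toFun a := L (saMap π a)
  map_smul' r a := by rw [saMap_smul, L.map_smul']
  map_add_le' a b := by rw [saMap_add]; exact L.map_add_le' _ _

theorem enorm_smul_real (r : ℝ) (a : selfAdjoint A) : ‖r • a‖ₑ = ‖r‖ₑ * ‖a‖ₑ := by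
  rw [enorm_eq_nnnorm, enorm_eq_nnnorm, enorm_eq_nnnorm, nnnorm_smul, ENNReal.coe_mul]

theorem ExtSeminorm.ext_of_forall {V : Type u} [AddCommGroup V] [Module ℝ V]
    {L M : ExtSeminorm V} (h : ∀ v, L v = M v) : L = M := by
  obtain ⟨f, _, _⟩ := L
  obtain ⟨g, _, _⟩ := M
  congr
  exact funext h

theorem mkDist_comm (L : ExtSeminorm (selfAdjoint A)) (φ ψ : StateSpace A) :
    mkDist L φ ψ = mkDist L ψ φ := @edist_comm _ (mkMetric L) φ ψ

/-- The distance `inf ‖a - t‖ + ‖b - t‖` from a pair to the common scalars. Unlike the difference of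
two states, it satisfies a Leibniz inequality. -/
noncomputable def gapSeminorm (A B : Type u) [CStarAlgebra A] [CStarAlgebra B] :
    ExtSeminorm (selfAdjoint (A × B)) :=
  ExtSeminorm.ofLe (fun d => ⨅ t : ℝ, ‖saFst d - t • 1‖ₑ + ‖saSnd d - t • 1‖ₑ)
    (by
      refine le_antisymm (iInf_le_of_le 0 (le_of_eq ?_)) zero_le
      have h1 : saFst (0 : selfAdjoint (A × B)) = 0 := rfl
      have h2 : saSnd (0 : selfAdjoint (A × B)) = 0 := rfl
      rw [h1, h2, zero_smul, zero_smul, sub_zero, sub_zero]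
      simp [enorm_eq_nnnorm])
    (by
      intro r d hr
      rw [ENNReal.mul_iInf_of_ne (by simpa using hr) (by simp)]
      refine le_iInf fun t => iInf_le_of_le (r * t) (le_of_eq ?_)
      have h1 : saFst (r • d) - (r * t) • (1 : selfAdjoint A) = r • (saFst d - t • 1) := by
        rw [smul_sub, smul_smul]; rfl
      have h2 : saSnd (r • d) - (r * t) • (1 : selfAdjoint B) = r • (saSnd d - t • 1) := by
        rw [smul_sub, smul_smul]; rfl
      rw [h1, h2, enorm_smul_real, enorm_smul_real, mul_add])
    (by
      intro d d'
      rw [ENNReal.iInf_add]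
      refine le_iInf fun s => ?_
      rw [ENNReal.add_iInf]
      refine le_iInf fun t => iInf_le_of_le (s + t) ?_
      have h1 : saFst (d + d') - (s + t) • (1 : selfAdjoint A) =
          (saFst d - s • 1) + (saFst d' - t • 1) := by
        change (saFst d + saFst d') - _ = _
        module
      have h2 : saSnd (d + d') - (s + t) • (1 : selfAdjoint B) =
          (saSnd d - s • 1) + (saSnd d' - t • 1) := by
        change (saSnd d + saSnd d') - _ = _
        module
      rw [h1, h2, add_add_add_comm]
      exact add_le_add (enorm_add_le _ _) (enorm_add_le _ _))

theorem gapSeminorm_apply (d : selfAdjoint (A × B)) : gapSeminorm A B d =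
    ⨅ t : ℝ, ‖saFst d - t • 1‖ₑ + ‖saSnd d - t • 1‖ₑ := rfl

theorem gapSeminorm_le (d : selfAdjoint (A × B)) (t : ℝ) :
    gapSeminorm A B d ≤ ((‖saFst d - t • 1‖₊ + ‖saSnd d - t • 1‖₊ : ℝ≥0) : ℝ≥0∞) := by
  rw [ENNReal.coe_add]
  exact iInf_le _ t

theorem exists_of_gapSeminorm_lt {d : selfAdjoint (A × B)} {r : ℝ≥0}
    (h : gapSeminorm A B d < r) : ∃ t : ℝ, ‖saFst d - t • 1‖ + ‖saSnd d - t • 1‖ < r := by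
  rw [gapSeminorm_apply, iInf_lt_iff] at h
  obtain ⟨t, ht⟩ := h
  rw [enorm_eq_nnnorm, enorm_eq_nnnorm, ← ENNReal.coe_add, ENNReal.coe_lt_coe] at ht
  exact ⟨t, ht⟩

theorem norm_sub_clamp_le [Nontrivial A] {a : selfAdjoint A} {M : ℝ} (ha : ‖a‖ ≤ M) (t : ℝ) :
    ‖a - (max (-M) (min M t)) • 1‖ ≤ ‖a - t • 1‖ := by
  refine norm_le_of_forall_state fun φ => ?_
  have h := abs_ev_le_norm φ (a - t • 1)
  have h' := (abs_le.1 ((abs_ev_le_norm φ a).trans ha))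
  rw [map_sub, ev_smul_one] at h ⊢
  refine le_trans ?_ h
  rcases le_total t (-M) with h1 | h1
  · rw [min_eq_right (by linarith), max_eq_left h1, abs_of_nonneg (by linarith)]
    exact le_trans (by linarith) (le_abs_self _)
  · rcases le_total t M with h2 | h2
    · rw [min_eq_right h2, max_eq_right h1]
    · rw [min_eq_left h2, max_eq_right (by linarith), abs_of_nonpos (by linarith)]
      exact le_trans (by linarith) (neg_abs_le _ |> fun h => neg_le.1 h)

/-- The Leibniz inequality for the distance to the scalars. The scalar near `d` can be taken of
modulus at most `‖d‖`, as clamping it only brings it nearer to both components. -/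
theorem gapSeminorm_jl_le [Nontrivial A] [Nontrivial B] (i : Bool) (d d' : selfAdjoint (A × B)) :
    gapSeminorm A B (jl i d d') ≤
      ‖d‖ₑ * gapSeminorm A B d' + ‖d'‖ₑ * gapSeminorm A B d := by
  have htop : ∀ x : selfAdjoint (A × B), ‖x‖ₑ ≠ ∞ := fun x => by
    rw [enorm_eq_nnnorm]; exact ENNReal.coe_ne_top
  rw [gapSeminorm_apply d, gapSeminorm_apply d',
    ENNReal.mul_iInf' (fun h => absurd h (htop _)) (fun _ => inferInstance),
    ENNReal.mul_iInf' (fun h => absurd h (htop _)) (fun _ => inferInstance), ENNReal.iInf_add]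
  refine le_iInf fun t' => ?_
  rw [ENNReal.add_iInf]
  refine le_iInf fun t => ?_
  set s := max (-‖d‖) (min ‖d‖ t) with hs
  have hs' : |s| ≤ ‖d‖ := by
    have := norm_nonneg d
    rw [abs_le]
    exact ⟨le_max_left _ _, max_le (by linarith) (min_le_left _ _)⟩
  obtain ⟨r, hr⟩ : ∃ r : ℝ, jl i (s • (1 : selfAdjoint (A × B))) (t' • 1) = r • 1 :=
    jl_smul_one i s t'
  have hrA : jl i (s • (1 : selfAdjoint A)) (t' • 1) = r • 1 := by
    have := congrArg saFst hr
    rwa [saFst_jl] at this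
  have hrB : jl i (s • (1 : selfAdjoint B)) (t' • 1) = r • 1 := by
    have := congrArg saSnd hr
    rwa [saSnd_jl] at this
  refine (gapSeminorm_le _ r).trans ?_
  simp only [enorm_eq_nnnorm, ← ENNReal.coe_mul, ← ENNReal.coe_add, ENNReal.coe_le_coe]
  rw [← NNReal.coe_le_coe]
  push_cast
  rw [saFst_jl, saSnd_jl, ← hrA, ← hrB]
  have e1 := norm_jl_sub_le i (saFst d) (saFst d') (s • 1) (t' • 1)
  have e2 := norm_jl_sub_le i (saSnd d) (saSnd d') (s • 1) (t' • 1)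
  have f1 := norm_sub_clamp_le (norm_saFst_le d) t
  have f2 := norm_sub_clamp_le (norm_saSnd_le d) t
  rw [← hs] at f1 f2
  rw [norm_smul_one] at e1 e2
  have g1 := mul_le_mul f1 (norm_saFst_le d') (norm_nonneg _) (norm_nonneg _)
  have g2 := mul_le_mul f2 (norm_saSnd_le d') (norm_nonneg _) (norm_nonneg _)
  have g3 := mul_le_mul_of_nonneg_right hs' (norm_nonneg (saFst d' - t' • 1))
  have g4 := mul_le_mul_of_nonneg_right hs' (norm_nonneg (saSnd d' - t' • 1))
  linarith

theorem continuous_gapSeminorm : Continuous (gapSeminorm A B) := by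
  have hle : ∀ d : selfAdjoint (A × B), gapSeminorm A B d ≤ 2 * ‖d‖ₑ := fun d => by
    refine (gapSeminorm_le d 0).trans ?_
    rw [enorm_eq_nnnorm]
    norm_cast
    rw [zero_smul, zero_smul, sub_zero, sub_zero, two_mul]
    exact add_le_add (norm_saFst_le d) (norm_saSnd_le d)
  refine continuous_of_le_add_edist 2 (by simp) fun d d' => ?_
  rw [edist_eq_enorm_sub]
  have := (gapSeminorm A B).map_add_le' (d - d') d'
  rw [sub_add_cancel] at this
  refine this.trans ?_
  rw [add_comm]
  exact add_le_add le_rfl (hle _)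

end Build

section Diameter

variable {F : ℝ≥0 × ℝ≥0 × ℝ≥0 × ℝ≥0 → ℝ≥0} {𝔄 𝔅 : Pair.{u}}

/-- The tunnel on `A ⊕ B` with Lip-norm `max (L_A a) (L_B b) (gap (a, b) / ε)`. -/
noncomputable def gapTunnel (𝔄 𝔅 : Pair.{u}) (ε : ℝ≥0) : PreTunnel 𝔄 𝔅 where
  mid := ⟨𝔄 × 𝔅, ((𝔄.lip.pullback (StarAlgHom.fst ℂ 𝔄 𝔅)).sup
    (𝔅.lip.pullback (StarAlgHom.snd ℂ 𝔄 𝔅))).sup ((gapSeminorm 𝔄 𝔅).scale ε⁻¹)⟩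
  left := StarAlgHom.fst ℂ 𝔄 𝔅
  right := StarAlgHom.snd ℂ 𝔄 𝔅

theorem gapTunnel_lip_eq (ε : ℝ≥0) (d : selfAdjoint (𝔄 × 𝔅)) : (gapTunnel 𝔄 𝔅 ε).mid.lip d =
    max (max (𝔄.lip (saFst d)) (𝔅.lip (saSnd d))) ((ε⁻¹ : ℝ≥0) * gapSeminorm 𝔄 𝔅 d) := rfl

theorem gapTunnel_lip_le_iff {ε : ℝ≥0} (hε : 0 < ε) {d : selfAdjoint (𝔄 × 𝔅)} {l : ℝ≥0} :
    (gapTunnel 𝔄 𝔅 ε).mid.lip d ≤ l ↔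
      𝔄.lip (saFst d) ≤ l ∧ 𝔅.lip (saSnd d) ≤ l ∧ gapSeminorm 𝔄 𝔅 d ≤ (ε * l : ℝ≥0) := by
  rw [gapTunnel_lip_eq, max_le_iff, max_le_iff, and_assoc]
  refine and_congr_right fun _ => and_congr_right fun _ => ?_
  rw [ENNReal.coe_inv hε.ne', mul_comm, ← div_eq_mul_inv, ENNReal.coe_mul, mul_comm,
    ENNReal.div_le_iff (by simpa using hε.ne') ENNReal.coe_ne_top, mul_comm]

theorem exists_of_gapTunnel_lip_le {ε : ℝ≥0} (hε : 0 < ε) {d : selfAdjoint (𝔄 × 𝔅)} {l l' : ℝ≥0}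
    (h : (gapTunnel 𝔄 𝔅 ε).mid.lip d ≤ l) (hl : l < l') :
    ∃ t : ℝ, ‖saFst d - t • 1‖ + ‖saSnd d - t • 1‖ ≤ ε * l' := by
  obtain ⟨t, ht⟩ := exists_of_gapSeminorm_lt (r := ε * l')
    ((((gapTunnel_lip_le_iff hε).1 h).2.2).trans_lt (by
      rw [ENNReal.coe_lt_coe]; exact mul_lt_mul_of_pos_left hl hε))
  exact ⟨t, by simpa using ht.le⟩

theorem exists_norm_sub_le_of_mkDiam [Nontrivial 𝔄] {ε : ℝ≥0} (hε : mkDiam 𝔄.lip ≤ ε)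
    {a : selfAdjoint 𝔄} {l : ℝ≥0} (ha : 𝔄.lip a ≤ l) : ∃ t : ℝ, ‖a - t • 1‖ ≤ ε * l := by
  obtain ⟨μ⟩ := nonempty_stateSpace (A := 𝔄)
  refine ⟨_, norm_sub_ev_le (L := 𝔄.lip) (fun φ ψ => ?_) μ ha⟩
  exact (@Metric.edist_le_ediam_of_mem _ Set.univ φ ψ (mkMetric 𝔄.lip) (Set.mem_univ _)
    (Set.mem_univ _)).trans hε

/-- An element `a` of the first space is lifted by `(a, t)`, where `t` is a scalar whose distance to
`a` is at most `ε` times its Lip-norm. It exists when `ε` is not below the diameter. -/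
theorem isTunnel_gapTunnel (hF : Permissible F) (hA : IsQQCMS F 𝔄) (hB : IsQQCMS F 𝔅) {ε : ℝ≥0}
    (hε : 0 < ε) (hdA : mkDiam 𝔄.lip ≤ ε) (hdB : mkDiam 𝔅.lip ≤ ε) :
    IsTunnel F (gapTunnel 𝔄 𝔅 ε) := by
  have := hA.nontrivial
  have := hB.nontrivial
  have hmid : IsQQCMS F (gapTunnel 𝔄 𝔅 ε).mid := by
    refine isQQCMS_prod hF hA hB (N := (gapSeminorm 𝔄 𝔅).scale ε⁻¹) (fun d => rfl) (fun d => ?_) ?_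
      ?_ ?_ (ε * 2) fun d hd => ?_
    · exact ENNReal.mul_lt_top ENNReal.coe_lt_top
        ((gapSeminorm_le d 0).trans_lt ENNReal.coe_lt_top)
    · exact isClosed_le ((ENNReal.continuous_const_mul ENNReal.coe_ne_top).comp
        continuous_gapSeminorm) continuous_const
    · change (ε⁻¹ : ℝ≥0) * gapSeminorm 𝔄 𝔅 1 = 0
      have : gapSeminorm 𝔄 𝔅 1 = 0 := by
        refine le_antisymm ((gapSeminorm_le _ 1).trans (le_of_eq ?_)) zero_le
        rw [saFst_one, saSnd_one, one_smul, one_smul, sub_self, sub_self]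
        simp
      rw [this, mul_zero]
    · intro i d d'
      change (ε⁻¹ : ℝ≥0) * gapSeminorm 𝔄 𝔅 _ ≤ _ * ((ε⁻¹ : ℝ≥0) * gapSeminorm 𝔄 𝔅 _) +
        _ * ((ε⁻¹ : ℝ≥0) * gapSeminorm 𝔄 𝔅 _)
      rw [mul_left_comm, mul_left_comm ‖d'‖ₑ, ← mul_add]
      exact mul_le_mul' le_rfl (gapSeminorm_jl_le i d d')
    · obtain ⟨t, ht⟩ := exists_of_gapTunnel_lip_le hε (l := 1) (l' := 2) hd one_lt_two
      refine ⟨t, ?_⟩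
      have e1 := norm_nonneg (saFst d - t • 1)
      have e2 := norm_nonneg (saSnd d - t • 1)
      rw [norm_eq_max, saFst_sub_smul_one, saSnd_sub_smul_one]
      push_cast at ht
      exact max_le (by linarith) (by linarith)
  refine ⟨hA, hB, hmid, fun a => ⟨(a, 0), rfl⟩, fun a => ⟨(0, a), rfl⟩, ?_, ?_⟩
  · refine isQuotient_of_lift (fun d => (le_max_left _ _).trans (le_max_left _ _))
      fun a l ha => ?_
    obtain ⟨t, ht⟩ := exists_norm_sub_le_of_mkDiam hdA ha.le
    refine ⟨saProd a (t • 1), rfl, (gapTunnel_lip_le_iff hε).2 ⟨ha.le, ?_, ?_⟩⟩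
    · rw [saSnd_saProd, ExtSeminorm.map_smul', hB.isLipNorm.map_one, mul_zero]
      exact zero_le
    · refine (gapSeminorm_le _ t).trans (ENNReal.coe_le_coe.2 ?_)
      rw [saFst_saProd, saSnd_saProd, sub_self, nnnorm_zero, add_zero]
      exact ht
  · refine isQuotient_of_lift (fun d => (le_max_right _ _).trans (le_max_left _ _))
      fun b l hb => ?_
    obtain ⟨t, ht⟩ := exists_norm_sub_le_of_mkDiam hdB hb.le
    refine ⟨saProd (t • 1) b, rfl, (gapTunnel_lip_le_iff hε).2 ⟨?_, hb.le, ?_⟩⟩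
    · rw [saFst_saProd, ExtSeminorm.map_smul', hA.isLipNorm.map_one, mul_zero]
      exact zero_le
    · refine (gapSeminorm_le _ t).trans (ENNReal.coe_le_coe.2 ?_)
      rw [saFst_saProd, saSnd_saProd, sub_self, nnnorm_zero, zero_add]
      exact ht

theorem extent_gapTunnel_le {ε : ℝ≥0} (hε : 0 < ε) (h : IsTunnel F (gapTunnel 𝔄 𝔅 ε)) :
    (gapTunnel 𝔄 𝔅 ε).extent ≤ ε := by
  have := h.source.nontrivial
  have := h.target.nontrivial
  refine h.extent_le_iff.2 ⟨fun d l hd => ?_, fun d l hd => ?_⟩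
  all_goals
    refine le_add_mul_of_forall_gt fun l' hl' => ?_
    obtain ⟨t, ht⟩ := exists_of_gapTunnel_lip_le hε hd hl'
    have hmax : ‖d‖ = max ‖saFst d‖ ‖saSnd d‖ := norm_eq_max (A := 𝔄) (B := 𝔅) d
    rw [hmax]
    have e1 := norm_nonneg (saFst d - t • 1)
    have e2 := norm_nonneg (saSnd d - t • 1)
    have e3 := norm_sub_norm_le (saFst d) (t • 1)
    have e4 := norm_sub_norm_le (saSnd d) (t • 1)
    have e5 := norm_sub_norm_le (t • 1) (saFst d)
    have e6 := norm_sub_norm_le (t • 1) (saSnd d)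
    rw [norm_sub_rev] at e5 e6
    rw [norm_smul_one] at e3 e4 e5 e6
  · change max _ _ ≤ ‖saFst d‖ + _
    exact max_le (by linarith) (by linarith)
  · change max _ _ ≤ ‖saSnd d‖ + _
    exact max_le (by linarith) (by linarith)

/-- The tunnels `gapTunnel` with parameters slightly above both diameters have the required extents.
-/
theorem propinquity_le_max_mkDiam (hF : Permissible F) (hA : IsQQCMS F 𝔄) (hB : IsQQCMS F 𝔅) :
    propinquity (allTunnels F) 𝔄 𝔅 ≤ max (mkDiam 𝔄.lip) (mkDiam 𝔅.lip) := by
  refine le_of_forall_gt_imp_ge_of_dense fun y hy => ?_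
  rcases eq_or_ne y ∞ with rfl | hy'
  · exact le_top
  lift y to ℝ≥0 using hy'
  have hy0 : 0 < y := ENNReal.coe_pos.1 (lt_of_le_of_lt zero_le hy)
  have h := isTunnel_gapTunnel hF hA hB hy0 ((le_max_left _ _).trans hy.le)
    ((le_max_right _ _).trans hy.le)
  exact (iInf₂_le (gapTunnel 𝔄 𝔅 y) h).trans (extent_gapTunnel_le hy0 h)

end Diameter

/-! ### Comparison with the quantum Gromov-Hausdorff distance -/

section Distq

variable {F : ℝ≥0 × ℝ≥0 × ℝ≥0 × ℝ≥0 → ℝ≥0} {𝔄 𝔅 : Pair.{u}}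

/-- The seminorm on `A ⊕ B` which measures how well a pair is approximated by the images of
Lipschitz elements of the tunnel. -/
noncomputable def approxSeminorm (τ : PreTunnel 𝔄 𝔅) (c : ℝ≥0) :
    ExtSeminorm (selfAdjoint (𝔄 × 𝔅)) :=
  ExtSeminorm.ofLe (fun d => ⨅ x : selfAdjoint τ.mid, τ.mid.lip x +
      c * (‖saFst d - saMap τ.left x‖ₑ + ‖saSnd d - saMap τ.right x‖ₑ))
    (by
      refine le_antisymm (iInf_le_of_le 0 (le_of_eq ?_)) zero_le
      have h1 : saFst (0 : selfAdjoint (𝔄 × 𝔅)) = 0 := rfl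
      have h2 : saSnd (0 : selfAdjoint (𝔄 × 𝔅)) = 0 := rfl
      rw [h1, h2, saMap_zero, saMap_zero, sub_zero, sub_zero, ExtSeminorm.map_zero]
      simp [enorm_eq_nnnorm])
    (by
      intro r d hr
      rw [ENNReal.mul_iInf_of_ne (by simpa using hr) (by simp)]
      refine le_iInf fun x => iInf_le_of_le (r • x) (le_of_eq ?_)
      have h1 : saFst (r • d) - saMap τ.left (r • x) = r • (saFst d - saMap τ.left x) := by
        rw [smul_sub, saMap_smul]; rfl
      have h2 : saSnd (r • d) - saMap τ.right (r • x) = r • (saSnd d - saMap τ.right x) := by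
        rw [smul_sub, saMap_smul]; rfl
      rw [h1, h2, enorm_smul_real, enorm_smul_real, ExtSeminorm.map_smul']
      ring)
    (by
      intro d d'
      rw [ENNReal.iInf_add]
      refine le_iInf fun x => ?_
      rw [ENNReal.add_iInf]
      refine le_iInf fun y => iInf_le_of_le (x + y) ?_
      have h1 : saFst (d + d') - saMap τ.left (x + y) =
          (saFst d - saMap τ.left x) + (saFst d' - saMap τ.left y) := by
        rw [saMap_add, sub_add_sub_comm]; rfl
      have h2 : saSnd (d + d') - saMap τ.right (x + y) =
          (saSnd d - saMap τ.right x) + (saSnd d' - saMap τ.right y) := by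
        rw [saMap_add, sub_add_sub_comm]; rfl
      rw [h1, h2, add_add_add_comm, ← mul_add, add_add_add_comm]
      exact add_le_add (ExtSeminorm.map_add_le' _ _ _) (mul_le_mul' le_rfl
        (add_le_add (enorm_add_le _ _) (enorm_add_le _ _))))

theorem approxSeminorm_le (τ : PreTunnel 𝔄 𝔅) (c : ℝ≥0) (d : selfAdjoint (𝔄 × 𝔅))
    (x : selfAdjoint τ.mid) : approxSeminorm τ c d ≤ τ.mid.lip x +
      c * (‖saFst d - saMap τ.left x‖ₑ + ‖saSnd d - saMap τ.right x‖ₑ) := iInf_le _ x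

theorem exists_of_approxSeminorm_lt {τ : PreTunnel 𝔄 𝔅} {c : ℝ≥0} {d : selfAdjoint (𝔄 × 𝔅)}
    {l : ℝ≥0} (h : approxSeminorm τ c d < l) : ∃ (x : selfAdjoint τ.mid) (m : ℝ≥0),
      τ.mid.lip x = m ∧
      m + c * (‖saFst d - saMap τ.left x‖ + ‖saSnd d - saMap τ.right x‖) < l := by
  obtain ⟨x, hx⟩ := iInf_lt_iff.1 h
  have hfin : τ.mid.lip x ≠ ∞ := by
    intro htop
    rw [htop, top_add] at hx
    exact not_top_lt hx
  refine ⟨x, _, (ENNReal.coe_toNNReal hfin).symm, ?_⟩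
  rw [← ENNReal.coe_toNNReal hfin, enorm_eq_nnnorm, enorm_eq_nnnorm, ← ENNReal.coe_add,
    ← ENNReal.coe_mul, ← ENNReal.coe_add, ENNReal.coe_lt_coe, ← NNReal.coe_lt_coe] at hx
  exact_mod_cast hx

/-- The Lip-norm on `A ⊕ B` obtained from a tunnel. -/
noncomputable def tunnelLip (τ : PreTunnel 𝔄 𝔅) (c : ℝ≥0) : ExtSeminorm (selfAdjoint (𝔄 × 𝔅)) :=
  ((𝔄.lip.pullback (StarAlgHom.fst ℂ 𝔄 𝔅)).sup (𝔅.lip.pullback (StarAlgHom.snd ℂ 𝔄 𝔅))).sup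
    (approxSeminorm τ c)

theorem tunnelLip_le_iff {τ : PreTunnel 𝔄 𝔅} {c : ℝ≥0} {d : selfAdjoint (𝔄 × 𝔅)} {l : ℝ≥0∞} :
    tunnelLip τ c d ≤ l ↔
      𝔄.lip (saFst d) ≤ l ∧ 𝔅.lip (saSnd d) ≤ l ∧ approxSeminorm τ c d ≤ l := by
  change max (max _ _) _ ≤ _ ↔ _
  rw [max_le_iff, max_le_iff, and_assoc]
  rfl

/-- The Lip-norm obtained from a tunnel has the right quotients: `a` is lifted by the pair of images
of a lift of `a` to the tunnel. -/
theorem isAdmissible_tunnelLip {τ : PreTunnel 𝔄 𝔅} (hτ : IsTunnel F τ) {η : ℝ≥0} (hη : 0 < η) :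
    IsAdmissible 𝔄 𝔅 (tunnelLip τ η⁻¹) := by
  have := hτ.source.nontrivial
  have := hτ.target.nontrivial
  have := hτ.mid.nontrivial
  have hfin : ∀ d, approxSeminorm τ η⁻¹ d < ∞ := fun d => by
    refine (approxSeminorm_le τ _ d 0).trans_lt ?_
    rw [ExtSeminorm.map_zero, zero_add]
    exact ENNReal.mul_lt_top ENNReal.coe_lt_top (ENNReal.add_lt_top.2 ⟨enorm_lt_top, enorm_lt_top⟩)
  have hA : ∀ d, 𝔄.lip (saFst d) ≤ tunnelLip τ η⁻¹ d := fun d =>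
    (le_max_left _ _).trans (le_max_left _ _)
  have hB : ∀ d, 𝔅.lip (saSnd d) ≤ tunnelLip τ η⁻¹ d := fun d =>
    (le_max_right _ _).trans (le_max_left _ _)
  have hdom : ∀ d, 𝔄.lip (saFst d) < ∞ → 𝔅.lip (saSnd d) < ∞ → tunnelLip τ η⁻¹ d < ∞ :=
    fun d h h' => max_lt (max_lt h h') (hfin d)
  have hexact : ∀ x, approxSeminorm τ η⁻¹ (saProd (saMap τ.left x) (saMap τ.right x)) ≤
      τ.mid.lip x := fun x => by
    refine (approxSeminorm_le τ _ _ x).trans (le_of_eq ?_)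
    rw [saFst_saProd, saSnd_saProd, sub_self, sub_self]
    simp [enorm_eq_nnnorm]
  obtain ⟨C, hC⟩ := hτ.mid.isLipNorm.exists_norm_sub_le
  refine ⟨isLipNorm_prod hτ.source.isLipNorm hτ.target.isLipNorm hA hB ?_ hdom (2 * η + C * 2)
    fun d hd => ?_, fun d => ⟨fun h => ⟨(hA d).trans_lt h, (hB d).trans_lt h⟩,
      fun h => hdom d h.1 h.2⟩, ?_, ?_⟩
  · refine le_antisymm (tunnelLip_le_iff.2 ⟨?_, ?_, ?_⟩) zero_le
    · rw [saFst_one, hτ.source.isLipNorm.map_one]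
    · rw [saSnd_one, hτ.target.isLipNorm.map_one]
    · have := hexact 1
      rw [saMap_one, saMap_one, hτ.mid.isLipNorm.map_one] at this
      exact this
  · obtain ⟨-, -, h3⟩ := tunnelLip_le_iff.1 hd
    obtain ⟨x, m, hm, hx⟩ := exists_of_approxSeminorm_lt (l := 2)
      (h3.trans_lt (by exact_mod_cast one_lt_two))
    have hη' : (0 : ℝ) < η := hη
    have e1 := norm_nonneg (saFst d - saMap τ.left x)
    have e2 := norm_nonneg (saSnd d - saMap τ.right x)
    have hm0 := m.2
    push_cast at hx
    have e3 : ‖saFst d - saMap τ.left x‖ + ‖saSnd d - saMap τ.right x‖ ≤ 2 * η := by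
      have : (η : ℝ)⁻¹ * (‖saFst d - saMap τ.left x‖ + ‖saSnd d - saMap τ.right x‖) ≤ 2 := by
        simp only [NNReal.val_eq_coe] at hm0
        linarith
      rwa [inv_mul_le_iff₀ hη', mul_comm] at this
    have hm2 : (m : ℝ) ≤ 2 := by
      have : 0 ≤ (η : ℝ)⁻¹ * (‖saFst d - saMap τ.left x‖ + ‖saSnd d - saMap τ.right x‖) := by
        positivity
      linarith
    obtain ⟨t, ht⟩ := hC x m hm.le
    have ht' : ‖x - t • 1‖ ≤ C * 2 := ht.trans (by gcongr)
    have i1 := (norm_saMap_le τ.left (x - t • 1)).trans ht'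
    have i2 := (norm_saMap_le τ.right (x - t • 1)).trans ht'
    rw [saMap_sub, saMap_smul_one] at i1 i2
    refine ⟨t, ?_⟩
    rw [norm_eq_max, saFst_sub_smul_one, saSnd_sub_smul_one]
    refine max_le ?_ ?_
    · have := norm_add_le (saFst d - saMap τ.left x) (saMap τ.left x - t • 1)
      rw [sub_add_sub_cancel] at this
      linarith
    · have := norm_add_le (saSnd d - saMap τ.right x) (saMap τ.right x - t • 1)
      rw [sub_add_sub_cancel] at this
      linarith
  · refine isQuotient_of_lift hA fun a l ha => ?_
    obtain ⟨x, hx, hl⟩ := hτ.left_quotient.exists_lift ha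
    refine ⟨saProd a (saMap τ.right x), rfl, tunnelLip_le_iff.2 ⟨ha.le, ?_, ?_⟩⟩
    · exact (hτ.right_quotient.le x).trans hl.le
    · rw [← hx]
      exact (hexact x).trans hl.le
  · refine isQuotient_of_lift hB fun b l hb => ?_
    obtain ⟨x, hx, hl⟩ := hτ.right_quotient.exists_lift hb
    refine ⟨saProd (saMap τ.left x) b, rfl, tunnelLip_le_iff.2 ⟨?_, hb.le, ?_⟩⟩
    · exact (hτ.left_quotient.le x).trans hl.le
    · rw [← hx]
      exact (hexact x).trans hl.le

/-- States which are near in the tunnel are near for the induced Lip-norm on the direct sum. -/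
theorem mkDist_tunnelLip_le {τ : PreTunnel 𝔄 𝔅} {η r : ℝ≥0} (hη : 0 < η) {φ : StateSpace 𝔄}
    {ψ : StateSpace 𝔅} (h : mkDist τ.mid.lip (dualMap τ.left φ) (dualMap τ.right ψ) ≤ r) :
    mkDist (tunnelLip τ η⁻¹) (dualMap (StarAlgHom.fst ℂ 𝔄 𝔅) φ)
      (dualMap (StarAlgHom.snd ℂ 𝔄 𝔅) ψ) ≤ (max η r : ℝ≥0) := by
  refine mkDist_le_iff.2 fun d l hd => ?_
  have key : ∀ l' : ℝ≥0, l < l' → |ev φ (saFst d) - ev ψ (saSnd d)| ≤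
      0 + (max η r : ℝ≥0) * l' := by
    intro l' hl'
    obtain ⟨-, -, h3⟩ := tunnelLip_le_iff.1 hd
    obtain ⟨x, m, hm, hx⟩ := exists_of_approxSeminorm_lt
      (h3.trans_lt (ENNReal.coe_lt_coe.2 hl'))
    have e1 := mkDist_le_iff.1 h x m hm.le
    rw [ev_dualMap, ev_dualMap] at e1
    have e2 := abs_ev_le_norm φ (saFst d - saMap τ.left x)
    have e3 := abs_ev_le_norm ψ (saSnd d - saMap τ.right x)
    rw [map_sub] at e2 e3
    have hη' : (0 : ℝ) < η := hη
    set P := ‖saFst d - saMap τ.left x‖ + ‖saSnd d - saMap τ.right x‖ with hP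
    have hP0 : 0 ≤ P := by positivity
    have e4 : (max η r : ℝ≥0) * (m + η⁻¹ * P) ≤ (max η r : ℝ≥0) * (l' : ℝ) := by
      have := hx.le
      push_cast at this
      gcongr
    have e5 : (r : ℝ) * m ≤ (max η r : ℝ≥0) * (m : ℝ) := by
      gcongr
      exact le_max_right _ _
    have e6 : P ≤ (max η r : ℝ≥0) * ((η : ℝ)⁻¹ * P) := by
      calc P = η * ((η : ℝ)⁻¹ * P) := by field_simp
        _ ≤ _ := by
          gcongr
          exact le_max_left _ _
    rw [mul_add, NNReal.coe_inv] at e4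
    rw [abs_le] at e1 e2 e3 ⊢
    constructor <;> linarith
  have := le_add_mul_of_forall_gt key
  rwa [zero_add] at this

theorem distq_le_extent {τ : PreTunnel 𝔄 𝔅} (hτ : IsTunnel F τ) : distq 𝔄 𝔅 ≤ τ.extent := by
  have hfin := hτ.extent_lt_top
  obtain ⟨r, hr⟩ : ∃ r : ℝ≥0, τ.extent = r := ⟨_, (ENNReal.coe_toNNReal hfin.ne).symm⟩
  have h1 := hτ.mid.isLipNorm.map_one
  obtain ⟨hl, hr'⟩ := hτ.extent_le_iff.1 hr.le
  rw [hr]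
  refine ENNReal.le_of_forall_pos_le_add fun η hη _ => ?_
  refine (iInf₂_le (tunnelLip τ η⁻¹) (isAdmissible_tunnelLip hτ hη)).trans ?_
  refine le_trans ?_ (max_le (le_add_self (a := (η : ℝ≥0∞)) (b := r)) le_self_add)
  refine @Metric.hausdorffEDist_le_of_mem_edist _ (mkMetric (tunnelLip τ η⁻¹)) _ _ _ ?_ ?_
  · rintro _ ⟨φ, rfl⟩
    obtain ⟨ψ, hψ⟩ := hr'.exists_state h1 (dualMap τ.left φ)
    exact ⟨_, ⟨ψ, rfl⟩, (mkDist_tunnelLip_le hη hψ).trans_eq (ENNReal.coe_max _ _)⟩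
  · rintro _ ⟨ψ, rfl⟩
    obtain ⟨φ, hφ⟩ := hl.exists_state h1 (dualMap τ.right ψ)
    refine ⟨_, ⟨φ, rfl⟩, ?_⟩
    rw [mkDist_comm] at hφ
    refine (mkDist_comm _ _ _).trans_le ?_
    exact (mkDist_tunnelLip_le hη hφ).trans_eq (ENNReal.coe_max _ _)

end Distq

/-! ### Isometric isomorphisms as tunnels -/

section Iso

variable {F : ℝ≥0 × ℝ≥0 × ℝ≥0 × ℝ≥0 → ℝ≥0} {𝔄 𝔅 : Pair.{u}}

theorem mkDist_pullback_equiv {A B : Type u} [CStarAlgebra A] [CStarAlgebra B] (h : A ≃⋆ₐ[ℂ] B)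
    (L : ExtSeminorm (selfAdjoint B)) (φ ψ : StateSpace B) :
    mkDist (L.pullback h.toStarAlgHom) (dualMap h.toStarAlgHom φ) (dualMap h.toStarAlgHom ψ) =
      mkDist L φ ψ := by
  refine le_antisymm (iSup₂_le fun a ha => ?_) (iSup₂_le fun b hb => ?_)
  · exact le_iSup₂ (f := fun (b : selfAdjoint B) (_ : L b ≤ 1) =>
      ‖φ.1 (b : B) - ψ.1 (b : B)‖ₑ) (saMap h.toStarAlgHom a) ha
  · have e : saMap h.toStarAlgHom (saMap h.symm.toStarAlgHom b) = b :=
      Subtype.ext (h.apply_symm_apply _)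
    have := le_iSup₂ (f := fun (a : selfAdjoint A) (_ : L.pullback h.toStarAlgHom a ≤ 1) =>
      ‖(dualMap h.toStarAlgHom φ).1 (a : A) - (dualMap h.toStarAlgHom ψ).1 (a : A)‖ₑ)
      (saMap h.symm.toStarAlgHom b) (by
        change L (saMap _ (saMap _ b)) ≤ 1
        rwa [e])
    rw [enorm_state_sub, ev_dualMap, ev_dualMap, e, ← enorm_state_sub] at this
    exact this

/-- An isometric isomorphism preserves Lip-norms, because both Lip-norms are closed and have the
same Monge-Kantorovich metric. -/
theorem IsIsometricIso.lip_eq {h : 𝔄 ≃⋆ₐ[ℂ] 𝔅} (hh : IsIsometricIso h) (hA : IsQQCMS F 𝔄)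
    (hB : IsQQCMS F 𝔅) (a : selfAdjoint 𝔄) : 𝔅.lip (saMap h.toStarAlgHom a) = 𝔄.lip a := by
  have := hA.nontrivial
  have hmk : ∀ φ ψ, mkDist (𝔅.lip.pullback h.toStarAlgHom) φ ψ = mkDist 𝔄.lip φ ψ := by
    intro φ ψ
    obtain ⟨φ, rfl⟩ := hh.2 φ
    obtain ⟨ψ, rfl⟩ := hh.2 ψ
    rw [mkDist_pullback_equiv, hh.1]
  have h1 : (𝔅.lip.pullback h.toStarAlgHom) 1 = 0 := by
    change 𝔅.lip (saMap _ 1) = 0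
    rw [saMap_one, hB.isLipNorm.map_one]
  have hc : IsClosed {a : selfAdjoint 𝔄 | 𝔅.lip.pullback h.toStarAlgHom a ≤ 1} :=
    hB.isClosed.preimage (continuous_saMap _)
  refine le_antisymm ?_ ?_
  · exact ExtSeminorm.le_of_unitBall (L := 𝔄.lip) (L' := 𝔅.lip.pullback h.toStarAlgHom)
      (fun v hv => le_one_of_mkDist_le h1 hc (fun φ ψ => (hmk φ ψ).ge) hv) a
  · exact ExtSeminorm.le_of_unitBall (L := 𝔅.lip.pullback h.toStarAlgHom) (L' := 𝔄.lip)
      (fun v hv => le_one_of_mkDist_le hA.isLipNorm.map_one hA.isClosed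
        (fun φ ψ => (hmk φ ψ).le) hv) a

theorem isIsometricIso_of_lip_eq {h : 𝔄 ≃⋆ₐ[ℂ] 𝔅}
    (hl : ∀ a, 𝔅.lip (saMap h.toStarAlgHom a) = 𝔄.lip a) : IsIsometricIso h := by
  have e : 𝔅.lip.pullback h.toStarAlgHom = 𝔄.lip :=
    ExtSeminorm.ext_of_forall hl
  refine ⟨fun φ ψ => by
    rw [← mkDist_pullback_equiv h 𝔅.lip φ ψ, e], fun φ => ?_⟩
  refine ⟨dualMap h.symm.toStarAlgHom φ, Subtype.ext (DFunLike.ext _ _ fun a => ?_)⟩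
  change φ.1 (h.symm (h a)) = φ.1 a
  rw [h.symm_apply_apply]

theorem isQuotient_of_equiv {h : 𝔄 ≃⋆ₐ[ℂ] 𝔅}
    (hl : ∀ a, 𝔅.lip (saMap h.toStarAlgHom a) = 𝔄.lip a) :
    IsQuotient 𝔄.lip h.toStarAlgHom 𝔅.lip := by
  refine isQuotient_of_lift (fun a => (hl a).le) fun b l hb => ?_
  have e : saMap h.toStarAlgHom (saMap h.symm.toStarAlgHom b) = b :=
    Subtype.ext (h.apply_symm_apply _)
  refine ⟨_, e, ?_⟩
  rw [← hl, e]
  exact hb.le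

theorem isQuotient_id : IsQuotient 𝔄.lip (StarAlgHom.id ℂ 𝔄) 𝔄.lip :=
  isQuotient_of_lift (fun _ => le_rfl) fun a _ ha => ⟨a, rfl, ha.le⟩

theorem IsIsometricIso.isTunnel_left {h : 𝔄 ≃⋆ₐ[ℂ] 𝔅} (hh : IsIsometricIso h)
    (hA : IsQQCMS F 𝔄) (hB : IsQQCMS F 𝔅) : IsTunnel F (isoTunnelLeft h) :=
  ⟨hA, hB, hA, Function.surjective_id, h.surjective, isQuotient_id,
    isQuotient_of_equiv (hh.lip_eq hA hB)⟩

theorem IsIsometricIso.isTunnel_right {h : 𝔄 ≃⋆ₐ[ℂ] 𝔅} (hh : IsIsometricIso h)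
    (hA : IsQQCMS F 𝔄) (hB : IsQQCMS F 𝔅) : IsTunnel F (isoTunnelRight h) := by
  refine ⟨hA, hB, hB, h.symm.surjective, Function.surjective_id, isQuotient_of_equiv fun b => ?_,
    isQuotient_id⟩
  rw [← hh.lip_eq hA hB]
  exact congrArg _ (Subtype.ext (h.apply_symm_apply _))

theorem IsIsometricIso.extent_eq_zero {h : 𝔄 ≃⋆ₐ[ℂ] 𝔅} (hh : IsIsometricIso h) :
    (isoTunnelLeft h).extent = 0 := by
  have h1 : Set.range (dualMap (isoTunnelLeft h).left) = Set.univ :=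
    Set.range_eq_univ.2 fun φ => ⟨φ, rfl⟩
  have h2 : Set.range (dualMap (isoTunnelLeft h).right) = Set.univ :=
    Set.range_eq_univ.2 hh.2
  rw [PreTunnel.extent, h1, h2, max_self]
  exact @Metric.hausdorffEDist_self _ (mkMetric _) _

theorem isAppropriate_allTunnels (hF : Permissible F) :
    IsAppropriate F {𝔄 : Pair.{u} | IsQQCMS F 𝔄} (allTunnels F) where
  isTunnel _ _ _ h := h
  connected 𝔄 hA 𝔅 hB := by
    have h := propinquity_le_max_mkDiam hF hA hB
    by_contra hne
    rw [Set.not_nonempty_iff_eq_empty] at hne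
    rw [propinquity, hne, iInf_emptyset, top_le_iff] at h
    exact (max_lt (mkDiam_lt_top hA.isLipNorm) (mkDiam_lt_top hB.isLipNorm)).ne h
  iso_mem _ hA _ hB _ hh := ⟨hh.isTunnel_left hA hB, hh.isTunnel_right hA hB⟩
  inv_mem _ _ _ h := h.inv
  ends_mem _ _ h := ⟨h.some_mem.source, h.some_mem.target⟩
  comp_mem _ _ _ _ h₁ _ h₂ _ hε := h₁.comp hF h₂ hε

end Iso

open Filter

/-! ### Star subalgebras generated by Jordan-Lie algebras -/

section JL

variable {R : Type*} [Ring R] [StarRing R] [Algebra ℂ R] [StarModule ℂ R]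

/-- The complexification `V + iV` of a unital real Jordan-Lie algebra `V` of self-adjoint elements
is a star subalgebra. -/
noncomputable def jlSubalgebra (V : Submodule ℝ (selfAdjoint R)) (one_mem : 1 ∈ V)
    (mul_mem : ∀ a ∈ V, ∀ b ∈ V, realPart ((a : R) * b) ∈ V ∧ imaginaryPart ((a : R) * b) ∈ V) :
    StarSubalgebra ℂ R where
  carrier := {x | realPart x ∈ V ∧ imaginaryPart x ∈ V}
  mul_mem' {x y} hx hy := by
    have e : x * y = (realPart x * realPart y - imaginaryPart x * imaginaryPart y : R) +
        Complex.I • (realPart x * imaginaryPart y + imaginaryPart x * realPart y : R) := by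
      conv_lhs => rw [← realPart_add_I_smul_imaginaryPart x, ← realPart_add_I_smul_imaginaryPart y]
      simp only [mul_add, add_mul, smul_mul_assoc, mul_smul_comm, smul_add, smul_smul,
        Complex.I_mul_I, neg_smul, one_smul]
      abel
    have h1 := mul_mem _ hx.1 _ hy.1
    have h2 := mul_mem _ hx.2 _ hy.2
    have h3 := mul_mem _ hx.1 _ hy.2
    have h4 := mul_mem _ hx.2 _ hy.1
    simp only [Set.mem_ofPred_eq]
    rw [e, map_add, map_add, realPart_I_smul, imaginaryPart_I_smul, map_sub, map_sub, map_add,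
      map_add]
    exact ⟨V.add_mem (V.sub_mem h1.1 h2.1) (V.neg_mem (V.add_mem h3.2 h4.2)),
      V.add_mem (V.sub_mem h1.2 h2.2) (V.add_mem h3.1 h4.1)⟩
  add_mem' {x y} hx hy := by
    simp only [Set.mem_ofPred_eq, map_add]
    exact ⟨V.add_mem hx.1 hy.1, V.add_mem hx.2 hy.2⟩
  algebraMap_mem' r := by
    have h1 : realPart (1 : R) = 1 := realPart_one
    have h2 : imaginaryPart (1 : R) = 0 := selfAdjoint.imaginaryPart_coe (x := (1 : selfAdjoint R))
    simp only [Set.mem_ofPred_eq]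
    rw [Algebra.algebraMap_eq_smul_one, realPart_smul, imaginaryPart_smul, h1, h2, smul_zero,
      smul_zero, sub_zero, zero_add]
    exact ⟨V.smul_mem _ one_mem, V.smul_mem _ one_mem⟩
  star_mem' {x} hx := by
    have h1 : realPart (star x) = realPart x := by
      refine Subtype.ext ?_
      rw [realPart_apply_coe, realPart_apply_coe, star_star, add_comm]
    have h2 : imaginaryPart (star x) = -imaginaryPart x := by
      refine Subtype.ext ?_
      rw [AddSubgroup.coe_neg, imaginaryPart_apply_coe, imaginaryPart_apply_coe, star_star,
        ← neg_sub, smul_neg, smul_neg]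
    simp only [Set.mem_ofPred_eq, h1, h2]
    exact ⟨hx.1, V.neg_mem hx.2⟩

theorem mem_jlSubalgebra {V : Submodule ℝ (selfAdjoint R)} {one_mem : 1 ∈ V}
    {mul_mem : ∀ a ∈ V, ∀ b ∈ V, realPart ((a : R) * b) ∈ V ∧ imaginaryPart ((a : R) * b) ∈ V}
    {x : R} : x ∈ jlSubalgebra V one_mem mul_mem ↔ realPart x ∈ V ∧ imaginaryPart x ∈ V := Iff.rfl

theorem coe_mem_jlSubalgebra {V : Submodule ℝ (selfAdjoint R)} {one_mem : 1 ∈ V}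
    {mul_mem : ∀ a ∈ V, ∀ b ∈ V, realPart ((a : R) * b) ∈ V ∧ imaginaryPart ((a : R) * b) ∈ V}
    {a : selfAdjoint R} : (a : R) ∈ jlSubalgebra V one_mem mul_mem ↔ a ∈ V := by
  rw [mem_jlSubalgebra, selfAdjoint.realPart_coe, selfAdjoint.imaginaryPart_coe]
  exact and_iff_left V.zero_mem

end JL

variable {A B : Type u} [CStarAlgebra A] [CStarAlgebra B]

theorem realPart_mul (a b : selfAdjoint A) : realPart ((a : A) * b) = jordan a b := by
  refine Subtype.ext ?_
  have ha : star (a : A) = a := a.2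
  have hb : star (b : A) = b := b.2
  rw [realPart_apply_coe, star_mul, ha, hb]
  change _ = (1 / 2 : ℂ) • _
  rw [← Complex.coe_smul]
  norm_num

theorem imaginaryPart_mul (a b : selfAdjoint A) : imaginaryPart ((a : A) * b) = lie a b := by
  refine Subtype.ext ?_
  have ha : star (a : A) = a := a.2
  have hb : star (b : A) = b := b.2
  rw [imaginaryPart_apply_coe, star_mul, ha, hb]
  change _ = (1 / (2 * Complex.I) : ℂ) • _
  rw [← Complex.coe_smul, smul_smul]
  congr 1
  rw [one_div, mul_inv, Complex.inv_I]
  push_cast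
  ring

/-- A star subalgebra containing a dense set of self-adjoint elements is dense. -/
theorem dense_of_dense_selfAdjoint {S : StarSubalgebra ℂ A} {D : Set (selfAdjoint A)}
    (hD : Dense D) (h : ∀ a ∈ D, (a : A) ∈ S) : Dense (S : Set A) := by
  have key : ∀ a : selfAdjoint A, (a : A) ∈ S.topologicalClosure := fun a => by
    have := image_closure_subset_closure_image (s := D) (continuous_subtype_val (p := fun x =>
      x ∈ selfAdjoint A))
    exact closure_mono (Set.image_subset_iff.2 h) (this ⟨a, hD a, rfl⟩)
  intro x
  change x ∈ S.topologicalClosure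
  rw [← realPart_add_I_smul_imaginaryPart x]
  exact add_mem (key _) (SMulMemClass.smul_mem _ (key _))

/-- A star subalgebra of `A × B` on which the second coordinate is dominated by the first one, and
whose first projection is dense, is contained in the graph of a ⋆-homomorphism. -/
theorem exists_starAlgHom_of_graph (Γ : StarSubalgebra ℂ (A × B))
    (hΓ : ∀ z ∈ Γ, ‖z.2‖ ≤ ‖z.1‖) (hd : Dense (Prod.fst '' (Γ : Set (A × B)))) :
    ∃ g : A →⋆ₐ[ℂ] B, ∀ z ∈ Γ, g z.1 = z.2 := by
  let Δ := Γ.topologicalClosure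
  have hΔc : IsClosed (Δ : Set (A × B)) := Γ.isClosed_topologicalClosure
  have hΔ : ∀ z ∈ Δ, ‖z.2‖ ≤ ‖z.1‖ := fun z hz =>
    closure_minimal (t := {z : A × B | ‖z.2‖ ≤ ‖z.1‖}) hΓ
      (isClosed_le (by fun_prop) (by fun_prop)) hz
  let p : Δ →⋆ₐ[ℂ] A := (StarAlgHom.fst ℂ A B).comp Δ.subtype
  have hp : Isometry p := AddMonoidHomClass.isometry_of_norm p fun z => by
    change ‖z.1.1‖ = ‖z.1‖
    rw [Prod.norm_def, max_eq_left (hΔ _ z.2)]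
  have : CompleteSpace Δ := hΔc.completeSpace_coe
  have hs : Function.Surjective p := by
    have h1 : IsClosed (Set.range p) := hp.isClosedEmbedding.isClosed_range
    have h2 : Dense (Set.range p) := hd.mono (by
      rintro _ ⟨z, hz, rfl⟩
      exact ⟨⟨z, Γ.le_topologicalClosure hz⟩, rfl⟩)
    rw [← Set.range_eq_univ, ← h1.closure_eq, h2.closure_eq]
  let e := StarAlgEquiv.ofBijective p ⟨hp.injective, hs⟩
  refine ⟨((StarAlgHom.snd ℂ A B).comp Δ.subtype).comp e.symm.toStarAlgHom, fun z hz => ?_⟩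
  have : e.symm z.1 = (⟨z, Γ.le_topologicalClosure hz⟩ : Δ) := e.symm_apply_apply (⟨z, _⟩ : Δ)
  change (e.symm z.1).1.2 = z.2
  rw [this]

/-! ### Coincidence -/

section Coincidence

variable {F : ℝ≥0 × ℝ≥0 × ℝ≥0 × ℝ≥0 → ℝ≥0} {𝔄 𝔅 : Pair.{u}}

theorem le_of_forall_coe_gt {x y : ℝ≥0∞} (h : ∀ l : ℝ≥0, x < l → y ≤ l) : y ≤ x := by
  refine le_of_forall_gt_imp_ge_of_dense fun z hz => ?_
  obtain ⟨l, hl, hlz⟩ := ENNReal.lt_iff_exists_nnreal_btwn.1 hz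
  exact (h l hl).trans hlz.le

theorem tendsto_jl {A : Type u} [CStarAlgebra A] {ι : Type*} {U : Filter ι} (i : Bool)
    {f g : ι → selfAdjoint A} {a b : selfAdjoint A} (hf : Tendsto f U (𝓝 a))
    (hg : Tendsto g U (𝓝 b)) : Tendsto (fun n => jl i (f n) (g n)) U (𝓝 (jl i a b)) := by
  rw [tendsto_iff_norm_sub_tendsto_zero]
  refine squeeze_zero (fun _ => norm_nonneg _) (fun n => norm_jl_sub_le i (f n) (g n) a b) ?_
  have h1 := (tendsto_iff_norm_sub_tendsto_zero.1 hf).mul hg.norm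
  have h2 := (tendsto_iff_norm_sub_tendsto_zero.1 hg).const_mul ‖a‖
  simpa using h1.add h2

/-- The elements `a` and `b` are `l`-related along a sequence of tunnels when they are limits, along
a fixed free ultrafilter, of the images of elements of the tunnels with Lip-norm at most `l`. -/
def Related (τ : ℕ → PreTunnel 𝔄 𝔅) (l : ℝ≥0) (a : selfAdjoint 𝔄) (b : selfAdjoint 𝔅) : Prop :=
  ∃ d : ∀ n, selfAdjoint (τ n).mid, (∀ n, (τ n).mid.lip (d n) ≤ l) ∧
    Tendsto (fun n => saMap (τ n).left (d n)) (hyperfilter ℕ) (𝓝 a) ∧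
    Tendsto (fun n => saMap (τ n).right (d n)) (hyperfilter ℕ) (𝓝 b)

variable {τ : ℕ → PreTunnel 𝔄 𝔅} {l m : ℝ≥0} {a a' : selfAdjoint 𝔄} {b b' : selfAdjoint 𝔅}

theorem Related.add (h : Related τ l a b) (h' : Related τ m a' b') :
    Related τ (l + m) (a + a') (b + b') := by
  obtain ⟨d, hd, hl, hr⟩ := h
  obtain ⟨d', hd', hl', hr'⟩ := h'
  refine ⟨fun n => d n + d' n, fun n => ?_, ?_, ?_⟩
  · rw [ENNReal.coe_add]
    exact ((τ n).mid.lip.map_add_le' _ _).trans (add_le_add (hd n) (hd' n))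
  · simp only [saMap_add]
    exact hl.add hl'
  · simp only [saMap_add]
    exact hr.add hr'

theorem Related.smul (h : Related τ l a b) (r : ℝ) : Related τ (‖r‖₊ * l) (r • a) (r • b) := by
  obtain ⟨d, hd, hl, hr⟩ := h
  refine ⟨fun n => r • d n, fun n => ?_, ?_, ?_⟩
  · rw [ENNReal.coe_mul, (τ n).mid.lip.map_smul']
    exact mul_le_mul_right (hd n) _
  · simp only [saMap_smul]
    exact hl.const_smul r
  · simp only [saMap_smul]
    exact hr.const_smul r

theorem Related.inv (h : Related τ l a b) : Related (fun n => (τ n).inv) l b a := by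
  obtain ⟨d, hd, hl, hr⟩ := h
  exact ⟨d, hd, hr, hl⟩

theorem related_one (hτ : ∀ n, IsTunnel F (τ n)) : Related τ 0 (1 : selfAdjoint 𝔄) 1 := by
  refine ⟨fun n => 1, fun n => (hτ n).mid.isLipNorm.map_one.le, ?_, ?_⟩
  · simp only [saMap_one]; exact tendsto_const_nhds
  · simp only [saMap_one]; exact tendsto_const_nhds

/-- The relation is compatible with the products: the norms of the lifts are eventually bounded by
the norm bounds of the tunnels, so the quasi-Leibniz property applies with a uniform constant. -/
theorem Related.exists_jl (hF : Monotone F) (hτ : ∀ n, IsTunnel F (τ n)) {r : ℝ≥0}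
    (hr : ∀ n, (τ n).extent ≤ r) (i : Bool)
    (h : Related τ l a b) (h' : Related τ m a' b') :
    ∃ l', Related τ l' (jl i a a') (jl i b b') := by
  obtain ⟨d, hd, hl, hR⟩ := h
  obtain ⟨d', hd', hl', hR'⟩ := h'
  have e1 : ∀ᶠ n in (hyperfilter ℕ : Filter ℕ), ‖saMap (τ n).left (d n)‖ < ‖a‖ + 1 :=
    hl.norm.eventually_lt_const (by linarith)
  have e2 : ∀ᶠ n in (hyperfilter ℕ : Filter ℕ), ‖saMap (τ n).left (d' n)‖ < ‖a'‖ + 1 :=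
    hl'.norm.eventually_lt_const (by linarith)
  set l' : ℝ≥0 := F (‖a‖₊ + 1 + r * l, ‖a'‖₊ + 1 + r * m, l, m) with hl'_def
  have key : ∀ᶠ n in (hyperfilter ℕ : Filter ℕ),
      (τ n).mid.lip (jl i (d n) (d' n)) ≤ l' := by
    filter_upwards [e1, e2] with n h1 h2
    have hb := ((hτ n).extent_le_iff.1 (hr n)).1
    have b1 := hb _ _ (hd n)
    have b2 := hb _ _ (hd' n)
    refine (hτ n).mid.jl_le_of_le hF i ?_ ?_ (hd n) (hd' n)
    · rw [← NNReal.coe_le_coe]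
      push_cast
      linarith
    · rw [← NNReal.coe_le_coe]
      push_cast
      linarith
  classical
  -- the lifts are set to zero at the indices where they are not controlled
  refine ⟨l', fun n => if (τ n).mid.lip (jl i (d n) (d' n)) ≤ l' then
    jl i (d n) (d' n) else 0, fun n => ?_, ?_, ?_⟩
  · dsimp only
    split_ifs with hn
    · exact hn
    · rw [ExtSeminorm.map_zero]; exact zero_le
  · refine (tendsto_jl i hl hl').congr' ?_
    filter_upwards [key] with n hn
    rw [if_pos hn, saMap_jl]
  · refine (tendsto_jl i hR hR').congr' ?_
    filter_upwards [key] with n hn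
    rw [if_pos hn, saMap_jl]

variable {r : ℕ → ℝ≥0}

/-- The norms of the lifts `d n` exceed those of their left images by at most `r n * l`, which tends
to `0`. -/
theorem Related.norm_le (hτ : ∀ n, IsTunnel F (τ n)) (hr : ∀ n, (τ n).extent ≤ r n)
    (hr0 : Tendsto r atTop (𝓝 0)) (h : Related τ l a b) : ‖b‖ ≤ ‖a‖ := by
  obtain ⟨d, hd, hl, hR⟩ := h
  have hr1 : Tendsto (fun n => (r n : ℝ)) (hyperfilter ℕ) (𝓝 ((0 : ℝ≥0) : ℝ)) :=
    NNReal.tendsto_coe.2 (hr0.mono_left Nat.hyperfilter_le_atTop)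
  have h2 := hl.norm.add (hr1.mul_const (l : ℝ))
  rw [NNReal.coe_zero, zero_mul, add_zero] at h2
  refine le_of_tendsto_of_tendsto' hR.norm h2 fun n => ?_
  exact (norm_saMap_le _ _).trans (((hτ n).extent_le_iff.1 (hr n)).1 _ _ (hd n))

theorem Related.lip_le (hτ : ∀ n, IsTunnel F (τ n)) (h : Related τ l a b) : 𝔅.lip b ≤ l := by
  obtain ⟨d, hd, hl, hR⟩ := h
  exact (isClosed_ball_of_isClosed (hτ 0).target.isClosed l).mem_of_tendsto hR
    (Eventually.of_forall fun n => ((hτ n).right_quotient.le (d n)).trans (hd n))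

/-- Compactness of Lip-balls: every element of finite Lip-norm is related to some element. -/
theorem exists_related (hτ : ∀ n, IsTunnel F (τ n)) {R : ℝ≥0} (hR : ∀ n, (τ n).extent ≤ R)
    (ha : 𝔄.lip a < l) : ∃ b, Related τ l a b := by
  choose d hd hdl using fun n => (hτ n).left_quotient.exists_lift ha
  have := (hτ 0).target.nontrivial
  have hcomp := (hτ 0).target.isLipNorm.isCompact (hτ 0).target.isClosed l (‖a‖ + R * l)
  have hmem : ∀ n, saMap (τ n).right (d n) ∈
      {b : selfAdjoint 𝔅 | 𝔅.lip b ≤ l ∧ ‖b‖ ≤ ‖a‖ + R * l} := fun n => by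
    refine ⟨((hτ n).right_quotient.le (d n)).trans (hdl n).le, ?_⟩
    have := ((hτ n).extent_le_iff.1 (hR n)).1 _ _ (hdl n).le
    rw [hd n] at this
    exact (norm_saMap_le _ _).trans this
  obtain ⟨b, -, hb⟩ := hcomp.ultrafilter_le_nhds
    ((hyperfilter ℕ).map fun n => saMap (τ n).right (d n))
    (le_principal_iff.2 (mem_map.2 (univ_mem' hmem)))
  exact ⟨b, d, fun n => (hdl n).le, by simp only [hd]; exact tendsto_const_nhds, hb⟩

/-- If the extents of the tunnels tend to `0`, then the relation is contained in the graph of a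
⋆-homomorphism. -/
theorem exists_starAlgHom_of_related (hF : Monotone F) (hτ : ∀ n, IsTunnel F (τ n))
    (hr : ∀ n, (τ n).extent ≤ r n) (hr0 : Tendsto r atTop (𝓝 0)) :
    ∃ g : 𝔄 →⋆ₐ[ℂ] 𝔅, ∀ l a b, Related τ l a b → saMap g a = b := by
  obtain ⟨R, hR⟩ : ∃ R : ℝ≥0, ∀ n, (τ n).extent ≤ R := by
    obtain ⟨R, hR⟩ := hr0.bddAbove_range
    exact ⟨R, fun n => (hr n).trans (ENNReal.coe_le_coe.2 (hR ⟨n, rfl⟩))⟩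
  let V : Submodule ℝ (selfAdjoint (𝔄 × 𝔅)) :=
    { carrier := {z | ∃ l, Related τ l (saFst z) (saSnd z)}
      add_mem' := by
        rintro z w ⟨l, hl⟩ ⟨m, hm⟩
        exact ⟨_, hl.add hm⟩
      zero_mem' := by
        have := (related_one hτ).smul 0
        rw [zero_smul, zero_smul] at this
        exact ⟨_, this⟩
      smul_mem' := by
        rintro c z ⟨l, hl⟩
        exact ⟨_, hl.smul c⟩ }
  have hV : ∀ z, z ∈ V ↔ ∃ l, Related τ l (saFst z) (saSnd z) := fun z => Iff.rfl
  have hjl : ∀ i, ∀ z ∈ V, ∀ w ∈ V, jl i z w ∈ V := by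
    rintro i z ⟨l, hl⟩ w ⟨m, hm⟩
    rw [hV, saFst_jl, saSnd_jl]
    exact hl.exists_jl hF hτ hR i hm
  let Γ : StarSubalgebra ℂ (𝔄 × 𝔅) := jlSubalgebra V ⟨_, related_one hτ⟩ fun z hz w hw => by
    rw [realPart_mul, imaginaryPart_mul]
    exact ⟨hjl true z hz w hw, hjl false z hz w hw⟩
  have hsa : ∀ w ∈ V, ‖saSnd w‖ ≤ ‖saFst w‖ := by
    rintro w ⟨l, hl⟩
    exact hl.norm_le hτ hr hr0
  -- by the C⋆-identity, the norm inequality only has to be checked on self-adjoint elements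
  have hnorm : ∀ z ∈ Γ, ‖z.2‖ ≤ ‖z.1‖ := fun z hz => by
    have h1 : star z * z ∈ Γ := mul_mem (star_mem hz) hz
    have h2 := hsa ⟨star z * z, IsSelfAdjoint.star_mul_self z⟩ (coe_mem_jlSubalgebra.1 h1)
    change ‖star z.2 * z.2‖ ≤ ‖star z.1 * z.1‖ at h2
    rw [CStarRing.norm_star_mul_self, CStarRing.norm_star_mul_self] at h2
    exact (mul_self_le_mul_self_iff (norm_nonneg _) (norm_nonneg _)).2 h2
  have hdense : Dense (Γ.map (StarAlgHom.fst ℂ 𝔄 𝔅) : Set 𝔄) :=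
    dense_of_dense_selfAdjoint (hτ 0).source.isLipNorm.dense_dom fun a ha => by
      obtain ⟨l, hal, -⟩ := ENNReal.lt_iff_exists_nnreal_btwn.1 (show 𝔄.lip a < ∞ from ha)
      obtain ⟨b, hb⟩ := exists_related hτ hR hal
      exact ⟨saProd a b, coe_mem_jlSubalgebra.2 ⟨l, hb⟩, rfl⟩
  obtain ⟨g, hg⟩ := exists_starAlgHom_of_graph Γ hnorm hdense
  refine ⟨g, fun l a b h => Subtype.ext ?_⟩
  exact hg (saProd a b) (coe_mem_jlSubalgebra.2 ⟨l, h⟩)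

/-- Spaces joined by tunnels of arbitrarily small extents are isometrically isomorphic. The
⋆-homomorphisms for the tunnels and for the inverted tunnels are mutually inverse. -/
theorem exists_isIsometricIso (hF : Monotone F) (hτ : ∀ n, IsTunnel F (τ n))
    (hr : ∀ n, (τ n).extent ≤ r n) (hr0 : Tendsto r atTop (𝓝 0)) :
    ∃ h : 𝔄 ≃⋆ₐ[ℂ] 𝔅, IsIsometricIso h := by
  have hτ' : ∀ n, IsTunnel F (τ n).inv := fun n => (hτ n).inv
  have hr' : ∀ n, (τ n).inv.extent ≤ r n := fun n => (PreTunnel.extent_inv _).trans_le (hr n)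
  obtain ⟨R, hR⟩ : ∃ R : ℝ≥0, ∀ n, (τ n).extent ≤ R := by
    obtain ⟨R, hR⟩ := hr0.bddAbove_range
    exact ⟨R, fun n => (hr n).trans (ENNReal.coe_le_coe.2 (hR ⟨n, rfl⟩))⟩
  have hR' : ∀ n, (τ n).inv.extent ≤ R := fun n => (PreTunnel.extent_inv _).trans_le (hR n)
  obtain ⟨g, hg⟩ := exists_starAlgHom_of_related hF hτ hr hr0
  obtain ⟨g', hg'⟩ := exists_starAlgHom_of_related hF hτ' hr' hr0
  have lift : ∀ a (l : ℝ≥0), 𝔄.lip a < l → Related τ l a (saMap g a) := fun a l ha => by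
    obtain ⟨b, hb⟩ := exists_related hτ hR ha
    rwa [hg l a b hb]
  have lift' : ∀ b (l : ℝ≥0), 𝔅.lip b < l → Related (fun n => (τ n).inv) l b (saMap g' b) :=
    fun b l hb => by
      obtain ⟨a, ha⟩ := exists_related hτ' hR' hb
      rwa [hg' l b a ha]
  have id_of_dom : ∀ {A : Type u} [CStarAlgebra A] (f : A →⋆ₐ[ℂ] A) (D : Set (selfAdjoint A)),
      Dense D → (∀ a ∈ D, saMap f a = a) → f = StarAlgHom.id ℂ A := by
    intro A _ f D hD hf
    have h1 : saMap f = id := (continuous_saMap f).ext_on hD continuous_id hf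
    ext x
    rw [← realPart_add_I_smul_imaginaryPart x, map_add, map_smul]
    have e : ∀ a : selfAdjoint A, f (a : A) = a := fun a => congrArg Subtype.val (congrFun h1 a)
    rw [e, e]
    rfl
  have c1 : g'.comp g = StarAlgHom.id ℂ 𝔄 := id_of_dom _ _ (hτ 0).source.isLipNorm.dense_dom
    fun a ha => by
      obtain ⟨l, hal, -⟩ := ENNReal.lt_iff_exists_nnreal_btwn.1 (show 𝔄.lip a < ∞ from ha)
      exact hg' _ _ _ (lift a l hal).inv
  have c2 : g.comp g' = StarAlgHom.id ℂ 𝔅 := id_of_dom _ _ (hτ 0).target.isLipNorm.dense_dom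
    fun b hb => by
      obtain ⟨l, hbl, -⟩ := ENNReal.lt_iff_exists_nnreal_btwn.1 (show 𝔅.lip b < ∞ from hb)
      exact hg _ _ _ (lift' b l hbl).inv
  have le : ∀ a, 𝔅.lip (saMap g a) ≤ 𝔄.lip a := fun a =>
    le_of_forall_coe_gt fun l hl => (lift a l hl).lip_le hτ
  have le' : ∀ b, 𝔄.lip (saMap g' b) ≤ 𝔅.lip b := fun b =>
    le_of_forall_coe_gt fun l hl => (lift' b l hl).lip_le hτ'
  refine ⟨StarAlgEquiv.ofStarAlgHom g g' c1 c2, isIsometricIso_of_lip_eq fun a => ?_⟩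
  refine le_antisymm (le a) ?_
  have := le' (saMap g a)
  have e : saMap g' (saMap g a) = a := Subtype.ext (DFunLike.congr_fun c1 (a : 𝔄))
  rwa [e] at this

end Coincidence

/-! ### The metric property -/

section Metric

variable {F : ℝ≥0 × ℝ≥0 × ℝ≥0 × ℝ≥0 → ℝ≥0} {𝒞 : Set Pair.{u}} {𝒯 : TunnelClass.{u}}

theorem propinquity_le_of_inv {𝒯 : TunnelClass.{u}}
    (h : ∀ (𝔄 𝔅 : Pair.{u}), ∀ τ ∈ 𝒯 𝔄 𝔅, τ.inv ∈ 𝒯 𝔅 𝔄) (𝔄 𝔅 : Pair.{u}) :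
    propinquity 𝒯 𝔅 𝔄 ≤ propinquity 𝒯 𝔄 𝔅 :=
  le_iInf₂ fun τ hτ => (iInf₂_le τ.inv (h _ _ τ hτ)).trans (PreTunnel.extent_inv τ).le

/-- The propinquity is `∞` where there is no tunnel, so that the triangle inequality does not need
the spaces to be in the class. -/
theorem IsAppropriate.propinquity_triangle (h : IsAppropriate F 𝒞 𝒯) (𝔄 𝔅 ℭ : Pair.{u}) :
    propinquity 𝒯 𝔄 ℭ ≤ propinquity 𝒯 𝔄 𝔅 + propinquity 𝒯 𝔅 ℭ := by
  have key : ∀ τ₁ ∈ 𝒯 𝔄 𝔅, ∀ τ₂ ∈ 𝒯 𝔅 ℭ, propinquity 𝒯 𝔄 ℭ ≤ τ₁.extent + τ₂.extent := by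
    intro τ₁ h₁ τ₂ h₂
    refine ENNReal.le_of_forall_pos_le_add fun ε hε _ => ?_
    have t₁ := h.isTunnel _ _ _ h₁
    have t₂ := h.isTunnel _ _ _ h₂
    have hc := h.comp_mem _ _ _ _ h₁ _ h₂ ε hε
    refine (iInf₂_le _ hc).trans ?_
    have := t₁.extent_comp_le t₂ hε (h.isTunnel _ _ _ hc)
      (ENNReal.coe_toNNReal t₁.extent_lt_top.ne).ge (ENNReal.coe_toNNReal t₂.extent_lt_top.ne).ge
    rwa [ENNReal.coe_add, ENNReal.coe_add, ENNReal.coe_toNNReal t₁.extent_lt_top.ne,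
      ENNReal.coe_toNNReal t₂.extent_lt_top.ne] at this
  unfold propinquity at key ⊢
  simp only [ENNReal.iInf_add, ENNReal.add_iInf]
  exact le_iInf fun τ₂ => le_iInf fun h₂ => le_iInf fun τ₁ => le_iInf fun h₁ => key τ₁ h₁ τ₂ h₂

theorem exists_tunnel_extent_lt {𝔄 𝔅 : Pair.{u}} {x : ℝ≥0∞} (h : propinquity 𝒯 𝔄 𝔅 < x) :
    ∃ τ ∈ 𝒯 𝔄 𝔅, τ.extent < x := by
  simpa only [propinquity, iInf_lt_iff, exists_prop] using h

theorem IsAppropriate.isMetricOn (hF : Permissible F) (h : IsAppropriate F 𝒞 𝒯) :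
    IsMetricOn 𝒞 (propinquity 𝒯) where
  finite 𝔄 hA 𝔅 hB := by
    obtain ⟨τ, hτ⟩ := h.connected 𝔄 hA 𝔅 hB
    exact (iInf₂_le τ hτ).trans_lt (h.isTunnel _ _ τ hτ).extent_lt_top
  symm 𝔄 _ 𝔅 _ := le_antisymm (propinquity_le_of_inv h.inv_mem _ _)
    (propinquity_le_of_inv h.inv_mem _ _)
  triangle 𝔄 _ 𝔅 _ ℭ _ := h.propinquity_triangle 𝔄 𝔅 ℭ
  eq_zero_iff 𝔄 hA 𝔅 hB := by
    constructor
    · intro h0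
      have hpos : ∀ n : ℕ, (0 : ℝ≥0) < 1 / ((n : ℝ≥0) + 1) := fun n => by positivity
      choose τ hτ hext using fun n : ℕ => exists_tunnel_extent_lt (𝒯 := 𝒯) (𝔄 := 𝔄) (𝔅 := 𝔅)
        (x := ((1 / ((n : ℝ≥0) + 1) : ℝ≥0) : ℝ≥0∞)) (by
          rw [h0]; exact ENNReal.coe_pos.2 (hpos n))
      exact exists_isIsometricIso hF.1 (fun n => h.isTunnel _ _ _ (hτ n))
        (fun n => (hext n).le) (tendsto_one_div_add_atTop_nhds_zero_nat (𝕜 := ℝ≥0))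
    · rintro ⟨e, he⟩
      refine le_antisymm ?_ zero_le
      exact (iInf₂_le _ (h.iso_mem 𝔄 hA 𝔅 hB e he).1).trans he.extent_eq_zero.le

theorem IsAppropriate.distq_le_propinquity (h : IsAppropriate F 𝒞 𝒯) (𝔄 𝔅 : Pair.{u}) :
    distq 𝔄 𝔅 ≤ propinquity 𝒯 𝔄 𝔅 :=
  le_iInf₂ fun τ hτ => distq_le_extent (h.isTunnel _ _ τ hτ)

end Metric

/-! ### Classical compact metric spaces -/

section Classical

variable {X Z : Type u} [MetricSpace X] [MetricSpace Z]

theorem lipSeminorm_le_iff [CompactSpace X] {f : selfAdjoint C(X, ℂ)} {K : ℝ≥0} :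
    lipSeminorm X f ≤ K ↔ ∀ x y, dist (f.1 x) (f.1 y) ≤ K * dist x y := by
  have aux : ∀ x y : X, x ≠ y → (edist (f.1 x) (f.1 y) / edist x y ≤ K ↔
      dist (f.1 x) (f.1 y) ≤ K * dist x y) := fun x y hxy => by
    rw [ENNReal.div_le_iff (by simpa using hxy) (edist_ne_top x y), edist_nndist, edist_nndist,
      ← ENNReal.coe_mul, ENNReal.coe_le_coe, ← NNReal.coe_le_coe]
    rfl
  constructor
  · intro h x y
    rcases eq_or_ne x y with rfl | hxy
    · simp
    · exact (aux x y hxy).1 (le_trans (le_iSup_of_le x (le_iSup_of_le y (le_iSup (fun _ : x ≠ y =>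
        edist (f.1 x) (f.1 y) / edist x y) hxy))) h)
  · intro h
    exact iSup_le fun x => iSup_le fun y => iSup_le fun hxy => (aux x y hxy).2 (h x y)

theorem coe_re_apply (f : selfAdjoint C(X, ℂ)) (x : X) : ((f.1 x).re : ℂ) = f.1 x := by
  have h : star (f.1 x) = f.1 x := congrArg (fun g : C(X, ℂ) => g x) f.2
  exact Complex.conj_eq_iff_re.1 h

theorem dist_apply (f : selfAdjoint C(X, ℂ)) (x y : X) :
    dist (f.1 x) (f.1 y) = |(f.1 x).re - (f.1 y).re| := by
  rw [← coe_re_apply f x, ← coe_re_apply f y, Complex.dist_eq, ← Complex.ofReal_sub,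
    Complex.norm_real]
  rfl

theorem norm_le_iff [CompactSpace X] [Nonempty X] {f : selfAdjoint C(X, ℂ)} {C : ℝ} :
    ‖f‖ ≤ C ↔ ∀ x, ‖f.1 x‖ ≤ C := ContinuousMap.norm_le_of_nonempty (f := f.1)

/-- A real continuous function, as a self-adjoint element of `C(X, ℂ)`. -/
def ofRealMap (g : C(X, ℝ)) : selfAdjoint C(X, ℂ) :=
  ⟨⟨fun x => (g x : ℂ), by fun_prop⟩, by
    rw [selfAdjoint.mem_iff]
    ext x
    exact Complex.conj_ofReal _⟩

theorem continuous_ofRealMap : Continuous (ofRealMap (X := X)) :=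
  Continuous.subtype_mk
    (ContinuousMap.continuous_postcomp (⟨_, Complex.continuous_ofReal⟩ : C(ℝ, ℂ))) _

theorem lipSeminorm_ofRealMap_le [CompactSpace X] {g : C(X, ℝ)} {K : ℝ≥0} (h : LipschitzWith K g) :
    lipSeminorm X (ofRealMap g) ≤ K := by
  refine lipSeminorm_le_iff.2 fun x y => ?_
  rw [dist_apply]
  exact h.dist_le_mul x y

theorem lipSeminorm_jl_le [CompactSpace X] (i : Bool) {f g : selfAdjoint C(X, ℂ)} {l m : ℝ≥0}
    (hf : lipSeminorm X f ≤ l) (hg : lipSeminorm X g ≤ m) :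
    lipSeminorm X (jl i f g) ≤ (‖f‖₊ * m + ‖g‖₊ * l : ℝ≥0) := by
  rw [lipSeminorm_le_iff] at hf hg ⊢
  intro x y
  cases i
  · have e : ∀ x, (jl false f g).1 x = 0 := fun x => by
      change (1 / (2 * Complex.I)) * (f.1 x * g.1 x - g.1 x * f.1 x) = 0
      ring
    rw [e, e, dist_self]
    positivity
  · have e : ∀ x, (jl true f g).1 x = f.1 x * g.1 x := fun x => by
      change (1 / 2) * (f.1 x * g.1 x + g.1 x * f.1 x) = _
      ring
    have h1 : ‖f.1 x‖ ≤ ‖f‖ := ContinuousMap.norm_coe_le_norm f.1 x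
    have h2 : ‖g.1 y‖ ≤ ‖g‖ := ContinuousMap.norm_coe_le_norm g.1 y
    rw [e, e, dist_eq_norm]
    have e2 : f.1 x * g.1 x - f.1 y * g.1 y =
        f.1 x * (g.1 x - g.1 y) + (f.1 x - f.1 y) * g.1 y := by ring
    rw [e2]
    refine (norm_add_le _ _).trans ?_
    rw [norm_mul, norm_mul, ← dist_eq_norm, ← dist_eq_norm]
    have i1 := mul_le_mul h1 (hg x y) dist_nonneg (norm_nonneg _)
    have i2 := mul_le_mul (hf x y) h2 (norm_nonneg _) (by positivity)
    push_cast
    linarith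

theorem continuous_apply_selfAdjoint (x : X) :
    Continuous fun f : selfAdjoint C(X, ℂ) => f.1 x :=
  (continuous_eval_const x).comp continuous_subtype_val

variable [CompactSpace X]

/-- Density of the Lipschitz functions, from the Stone-Weierstrass theorem. -/
theorem dense_dom_lipSeminorm : Dense (lipSeminorm X).dom := by
  let S : Subalgebra ℝ C(X, ℝ) :=
    { carrier := {g | ofRealMap g ∈ (lipSeminorm X).dom}
      mul_mem' := fun {f g} hf hg => by
        have e : ofRealMap (f * g) = jl true (ofRealMap f) (ofRealMap g) := by
          refine Subtype.ext (ContinuousMap.ext fun x => ?_)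
          change ((f x * g x : ℝ) : ℂ) = (1 / 2) * ((f x : ℂ) * g x + g x * f x)
          push_cast
          ring
        change lipSeminorm X _ < ∞
        rw [e]
        exact (lipSeminorm_jl_le true (ENNReal.coe_toNNReal (ne_of_lt hf)).ge
          (ENNReal.coe_toNNReal (ne_of_lt hg)).ge).trans_lt ENNReal.coe_lt_top
      add_mem' := fun {f g} hf hg => by
        have e : ofRealMap (f + g) = ofRealMap f + ofRealMap g :=
          Subtype.ext (ContinuousMap.ext fun x => Complex.ofReal_add _ _)
        change lipSeminorm X _ < ∞
        rw [e]
        exact ((lipSeminorm X).map_add_le' _ _).trans_lt (ENNReal.add_lt_top.2 ⟨hf, hg⟩)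
      algebraMap_mem' := fun r => by
        change lipSeminorm X _ < ∞
        exact (lipSeminorm_ofRealMap_le (K := 0) (LipschitzWith.const r)).trans_lt
          ENNReal.coe_lt_top }
  have hS : S.SeparatesPoints := by
    intro x y hxy
    refine ⟨fun z => dist z x, ⟨⟨fun z => dist z x, by fun_prop⟩, ?_, rfl⟩, ?_⟩
    · exact (lipSeminorm_ofRealMap_le (K := 1) (LipschitzWith.dist_left x)).trans_lt
        ENNReal.coe_lt_top
    · simpa using hxy.symm
  have hd : Dense (S : Set C(X, ℝ)) := by
    have := ContinuousMap.subalgebra_topologicalClosure_eq_top_of_separatesPoints S hS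
    intro g
    have h : g ∈ S.topologicalClosure := by rw [this]; trivial
    exact h
  have hsurj : Function.Surjective (ofRealMap (X := X)) := fun f =>
    ⟨⟨fun x => (f.1 x).re, by fun_prop⟩, Subtype.ext (ContinuousMap.ext fun x => coe_re_apply f x)⟩
  refine (hsurj.denseRange.dense_image continuous_ofRealMap hd).mono ?_
  rintro _ ⟨g, hg, rfl⟩
  exact hg

/-- A Lipschitz function is determined, up to a small error, by its values at finitely many
points. -/
theorem totallyBounded_lipBall [Nonempty X] (R : ℝ) :
    TotallyBounded {f : selfAdjoint C(X, ℂ) | lipSeminorm X f ≤ 1 ∧ ‖f‖ ≤ R} := by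
  rw [← Set.image_id {f : selfAdjoint C(X, ℂ) | lipSeminorm X f ≤ 1 ∧ ‖f‖ ≤ R}]
  refine totallyBounded_image_of_approx.{u} fun η hη => ?_
  obtain ⟨t, -, ht⟩ := (isCompact_univ (X := X)).elim_nhds_subcover (fun x => Metric.ball x (η / 2))
    fun x _ => Metric.ball_mem_nhds x (by positivity)
  refine ⟨t → ℂ, inferInstance, fun f x => f.1 x, totallyBounded_pi fun x => ?_, ?_⟩
  · refine (isCompact_closedBall (0 : ℂ) R).totallyBounded.subset ?_
    rintro _ ⟨_, ⟨f, hf, rfl⟩, rfl⟩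
    rw [mem_closedBall_zero_iff]
    exact norm_le_iff.1 hf.2 x
  · intro f hf g hg
    set g' := fun (f : selfAdjoint C(X, ℂ)) (x : t) => f.1 (x : X)
    change dist f g ≤ dist (g' f) (g' g) + η
    rw [dist_eq_norm]
    refine norm_le_iff.2 fun x => ?_
    change ‖f.1 x - g.1 x‖ ≤ _
    rw [← dist_eq_norm]
    obtain ⟨y, hy, hxy⟩ := Set.mem_iUnion₂.1 (ht (Set.mem_univ x))
    have h1 := lipSeminorm_le_iff.1 (show lipSeminorm X f ≤ (1 : ℝ≥0) from hf.1) x y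
    have h2 := lipSeminorm_le_iff.1 (show lipSeminorm X g ≤ (1 : ℝ≥0) from hg.1) y x
    have h3 : dist (f.1 y) (g.1 y) ≤ dist (g' f) (g' g) :=
      dist_le_pi_dist (g' f) (g' g) ⟨y, hy⟩
    have h4 := dist_triangle4 (f.1 x) (f.1 y) (g.1 y) (g.1 x)
    rw [Metric.mem_ball] at hxy
    rw [dist_comm y x] at h2
    rw [NNReal.coe_one, one_mul] at h1 h2
    linarith

theorem isLipNorm_lipSeminorm [Nonempty X] : IsLipNorm (lipSeminorm X) := by
  have h1 : lipSeminorm X 1 = 0 := le_antisymm (lipSeminorm_le_iff (K := 0).2 fun x y => by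
    change dist (1 : ℂ) 1 ≤ _
    simp) zero_le
  obtain ⟨x₀⟩ := ‹Nonempty X›
  have : Nonempty X := ⟨x₀⟩
  refine isLipNorm_of_totallyBounded dense_dom_lipSeminorm h1 (Metric.diam (Set.univ : Set X))
    (fun f hf => ⟨(f.1 x₀).re, ?_⟩) (totallyBounded_lipBall _)
  refine norm_le_iff.2 fun x => ?_
  have e : (f - (f.1 x₀).re • (1 : selfAdjoint C(X, ℂ)) : selfAdjoint C(X, ℂ)).1 x =
      f.1 x - f.1 x₀ := by
    change f.1 x - (f.1 x₀).re • (1 : ℂ) = _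
    rw [← coe_re_apply f x₀]
    simp
  rw [e, ← dist_eq_norm]
  refine (lipSeminorm_le_iff.1 (show lipSeminorm X f ≤ (1 : ℝ≥0) from hf) x x₀).trans ?_
  rw [NNReal.coe_one, one_mul]
  exact Metric.dist_le_diam_of_mem isCompact_univ.isBounded trivial trivial

theorem isClosed_lipBall : IsClosed {f : selfAdjoint C(X, ℂ) | lipSeminorm X f ≤ 1} := by
  have : {f : selfAdjoint C(X, ℂ) | lipSeminorm X f ≤ 1} =
      ⋂ (x : X) (y : X), {f | dist (f.1 x) (f.1 y) ≤ 1 * dist x y} := by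
    ext f
    simpa using lipSeminorm_le_iff (f := f) (K := 1)
  rw [this]
  exact isClosed_iInter fun x => isClosed_iInter fun y => isClosed_le
    ((continuous_apply_selfAdjoint x).dist (continuous_apply_selfAdjoint y)) continuous_const

theorem isQQCMS_classical [Nonempty X] {F : ℝ≥0 × ℝ≥0 × ℝ≥0 × ℝ≥0 → ℝ≥0} (hF : Permissible F) :
    IsQQCMS F (classical X) :=
  IsQQCMS.of_jl (inferInstanceAs (Nontrivial C(X, ℂ))) isLipNorm_lipSeminorm isClosed_lipBall
    fun i _ _ _ _ hl hm => (lipSeminorm_jl_le i (le_of_eq hl) (le_of_eq hm)).trans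
      (ENNReal.coe_le_coe.2 (hF.2 _ _ _ _))

/-- The restriction homomorphism `C(Z) → C(X)` along an isometry. -/
noncomputable def restrictHom {ι : X → Z} (hι : Isometry ι) : C(Z, ℂ) →⋆ₐ[ℂ] C(X, ℂ) :=
  ContinuousMap.compStarAlgHom' ℂ ℂ ⟨ι, hι.continuous⟩

theorem restrictHom_surjective {ι : X → Z} (hι : Isometry ι) :
    Function.Surjective (restrictHom hι) := fun f => by
  obtain ⟨g, hg⟩ := ContinuousMap.exists_extension hι.isClosedEmbedding f
  exact ⟨g, hg⟩

variable [CompactSpace Z]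

/-- Lipschitz functions extend with the same constant, so that the Lipschitz seminorm of a subspace
is a quotient. -/
theorem isQuotient_restrictHom {ι : X → Z} (hι : Isometry ι) :
    IsQuotient (lipSeminorm Z) (restrictHom hι) (lipSeminorm X) := by
  refine isQuotient_of_lift (fun d => ?_) fun f l hf => ?_
  · refine le_of_forall_coe_gt fun l hl => lipSeminorm_le_iff.2 fun x y => ?_
    have := lipSeminorm_le_iff.1 hl.le (ι x) (ι y)
    rwa [hι.dist_eq] at this
  · have hf' := lipSeminorm_le_iff.1 hf.le
    obtain ⟨h, hh⟩ : ∃ h : Z → ℝ, ∀ x, h (ι x) = (f.1 x).re :=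
      ⟨Function.extend ι (fun x => (f.1 x).re) 0, fun x => hι.injective.extend_apply _ _ x⟩
    obtain ⟨g, hg, hgf⟩ := LipschitzOnWith.extend_real (s := Set.range ι) (K := l) (f := h) (by
      refine LipschitzOnWith.of_dist_le_mul ?_
      rintro _ ⟨x, rfl⟩ _ ⟨y, rfl⟩
      rw [hh, hh, hι.dist_eq, Real.dist_eq, ← dist_apply]
      exact hf' x y)
    refine ⟨ofRealMap ⟨g, hg.continuous⟩, Subtype.ext (ContinuousMap.ext fun x => ?_),
      lipSeminorm_ofRealMap_le hg⟩
    change (g (ι x) : ℂ) = f.1 x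
    rw [← hgf ⟨x, rfl⟩, hh, coe_re_apply]

/-- A Lipschitz function on a space is controlled by its restriction to an `r`-dense subspace. -/
theorem normBound_restrictHom [Nonempty X] [Nonempty Z] {ι : X → Z} (hι : Isometry ι) {r : ℝ≥0}
    (hr : ∀ z, ∃ x, dist z (ι x) ≤ r) : NormBound (lipSeminorm Z) (restrictHom hι) r := by
  intro d l hd
  refine norm_le_iff.2 fun z => ?_
  obtain ⟨x, hx⟩ := hr z
  have h1 := lipSeminorm_le_iff.1 hd z (ι x)
  have h2 : ‖d.1 (ι x)‖ ≤ ‖saMap (restrictHom hι) d‖ :=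
    norm_le_iff.1 (le_refl ‖saMap (restrictHom hι) d‖) x
  have h3 := norm_le_norm_add_norm_sub' (d.1 z) (d.1 (ι x))
  rw [← dist_eq_norm] at h3
  have h4 := mul_le_mul_of_nonneg_left hx l.2
  simp only [NNReal.val_eq_coe] at h4
  linarith

/-- Continuous functions on the optimal Gromov-Hausdorff coupling. It is the union of both spaces,
each of which is dense up to their Hausdorff distance. -/
theorem propinquity_classical_le {F : ℝ≥0 × ℝ≥0 × ℝ≥0 × ℝ≥0 → ℝ≥0} (hF : Permissible F)
    (X Y : Type u) [MetricSpace X] [CompactSpace X] [Nonempty X]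
    [MetricSpace Y] [CompactSpace Y] [Nonempty Y] :
    propinquity (allTunnels F) (classical X) (classical Y) ≤
      ENNReal.ofReal (GromovHausdorff.ghDist X Y) := by
  let il := GromovHausdorff.optimalGHInjl X Y
  let ir := GromovHausdorff.optimalGHInjr X Y
  have hil : Isometry il := GromovHausdorff.isometry_optimalGHInjl X Y
  have hir : Isometry ir := GromovHausdorff.isometry_optimalGHInjr X Y
  have hne : Nonempty (GromovHausdorff.OptimalGHCoupling X Y) := ‹Nonempty X›.map il
  have hcover : ∀ z, (∃ x, il x = z) ∨ ∃ y, ir y = z := by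
    intro z
    induction z using Quotient.inductionOn' with
    | h w =>
      rcases w with x | y
      · exact Or.inl ⟨x, rfl⟩
      · exact Or.inr ⟨y, rfl⟩
  let τ : PreTunnel (classical X) (classical Y) :=
    ⟨classical (GromovHausdorff.OptimalGHCoupling X Y), restrictHom hil, restrictHom hir⟩
  have hτ : IsTunnel F τ := ⟨isQQCMS_classical hF, isQQCMS_classical hF, isQQCMS_classical hF,
    restrictHom_surjective hil, restrictHom_surjective hir, isQuotient_restrictHom hil,
    isQuotient_restrictHom hir⟩
  refine (iInf₂_le τ hτ).trans (le_of_forall_coe_gt fun r hr => hτ.extent_le_iff.2 ?_)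
  have hr' : GromovHausdorff.ghDist X Y < r := by
    rwa [← ENNReal.ofReal_coe_nnreal, ENNReal.ofReal_lt_ofReal_iff_of_nonneg] at hr
    rw [← GromovHausdorff.hausdorffDist_optimal]
    exact Metric.hausdorffDist_nonneg
  rw [← GromovHausdorff.hausdorffDist_optimal] at hr'
  have hfin : Metric.hausdorffEDist (Set.range il) (Set.range ir) ≠ ∞ :=
    Metric.hausdorffEDist_ne_top_of_nonempty_of_bounded (Set.range_nonempty _)
      (Set.range_nonempty _) (isCompact_range hil.continuous).isBounded
      (isCompact_range hir.continuous).isBounded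
  constructor
  · refine normBound_restrictHom hil fun z => ?_
    rcases hcover z with ⟨x, rfl⟩ | ⟨y, rfl⟩
    · exact ⟨x, by rw [dist_self]; exact r.2⟩
    · obtain ⟨_, ⟨x, rfl⟩, hx⟩ := Metric.exists_dist_lt_of_hausdorffDist_lt'
        (Set.mem_range_self y) hr' hfin
      exact ⟨x, by rw [dist_comm]; exact hx.le⟩
  · refine normBound_restrictHom hir fun z => ?_
    rcases hcover z with ⟨x, rfl⟩ | ⟨y, rfl⟩
    · obtain ⟨_, ⟨y, rfl⟩, hy⟩ := Metric.exists_dist_lt_of_hausdorffDist_lt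
        (Set.mem_range_self x) hr' hfin
      exact ⟨y, hy.le⟩
    · exact ⟨y, by rw [dist_self]; exact r.2⟩

end Classical

/-! ### Completions for C⋆-seminorms -/

section Completion

open UniformSpace

/-- The completion of a complex ⋆-algebra for a C⋆-seminorm. -/
theorem exists_completion_of_seminormedRing (R : Type u) [SeminormedRing R] [StarRing R]
    [NormedAlgebra ℂ R] [StarModule ℂ R] (hstar : ∀ x : R, ‖x‖ * ‖x‖ ≤ ‖star x * x‖) :
    ∃ (E : Type u) (_ : CStarAlgebra E) (j : R →⋆ₐ[ℂ] E), DenseRange j ∧ ∀ x, ‖j x‖ = ‖x‖ := by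
  have hle : ∀ x : R, ‖x‖ ≤ ‖star x‖ := fun x => by
    rcases (norm_nonneg x).eq_or_lt' with h | h
    · rw [h]; exact norm_nonneg _
    · exact le_of_mul_le_mul_right ((hstar x).trans (norm_mul_le _ _)) h
  have hnorm : ∀ x : R, ‖star x‖ = ‖x‖ := fun x => le_antisymm
    (by simpa using hle (star x)) (hle x)
  have hiso : Isometry (star : R → R) :=
    AddMonoidHomClass.isometry_of_norm (starAddEquiv (R := R)) hnorm
  have huc : UniformContinuous (star : R → R) := hiso.uniformContinuous
  let st : Completion R → Completion R := Completion.map star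
  have hst : Continuous st := Completion.continuous_map
  have hcoe : ∀ x : R, st x = (star x : R) := fun x => Completion.map_coe huc x
  let instStar : StarRing (Completion R) :=
    { star := st
      star_involutive := fun x => by
        induction x using Completion.induction_on with
        | hp => exact isClosed_eq (hst.comp hst) continuous_id
        | ih x => rw [hcoe, hcoe, star_star]
      star_mul := fun x y => by
        induction x, y using Completion.induction_on₂ with
        | hp =>
          exact isClosed_eq (hst.comp (by fun_prop))
            ((hst.comp continuous_snd).mul (hst.comp continuous_fst))
        | ih x y => rw [← Completion.coe_mul, hcoe, hcoe, hcoe, star_mul, Completion.coe_mul]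
      star_add := fun x y => by
        induction x, y using Completion.induction_on₂ with
        | hp =>
          exact isClosed_eq (hst.comp (by fun_prop))
            ((hst.comp continuous_fst).add (hst.comp continuous_snd))
        | ih x y => rw [← Completion.coe_add, hcoe, hcoe, hcoe, star_add, Completion.coe_add] }
  have hcoe' : ∀ x : R, star (x : Completion R) = (star x : R) := hcoe
  have hst' : Continuous (star : Completion R → Completion R) := hst
  let instAlg : NormedAlgebra ℂ (Completion R) :=
    { (inferInstance : Algebra ℂ (Completion R)) with
      norm_smul_le := norm_smul_le }
  have instMod : StarModule ℂ (Completion R) := by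
    refine ⟨fun c x => ?_⟩
    induction x using Completion.induction_on with
    | hp =>
      exact isClosed_eq (hst'.comp (continuous_const_smul c)) (hst'.const_smul (star c))
    | ih x => rw [← Completion.coe_smul, hcoe', hcoe', star_smul, Completion.coe_smul]
  have instC : CStarRing (Completion R) := by
    refine ⟨fun x => ?_⟩
    induction x using Completion.induction_on with
    | hp => exact isClosed_le (by fun_prop) ((hst'.mul continuous_id).norm)
    | ih x =>
      rw [hcoe', ← Completion.coe_mul, Completion.norm_coe, Completion.norm_coe]
      exact hstar x
  let instE : CStarAlgebra (Completion R) := {}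
  refine ⟨Completion R, instE,
    { toFun := fun x => (x : Completion R)
      map_one' := rfl
      map_mul' := Completion.coe_mul
      map_zero' := rfl
      map_add' := Completion.coe_add
      commutes' := fun r => rfl
      map_star' := fun x => (hcoe' x).symm }, Completion.denseRange_coe, fun x => ?_⟩
  exact Completion.norm_coe x

/-- A C⋆-seminorm on a complex ⋆-algebra. -/
structure IsCStarSeminorm {R : Type u} [Ring R] [StarRing R] [Algebra ℂ R] (p : R → ℝ) : Prop where
  add_le : ∀ x y, p (x + y) ≤ p x + p y
  smul_le : ∀ (c : ℂ) x, p (c • x) ≤ ‖c‖ * p x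
  mul_le : ∀ x y, p (x * y) ≤ p x * p y
  le_star_mul : ∀ x, p x * p x ≤ p (star x * x)

/-- The C⋆-algebra generated by a ⋆-algebra with a C⋆-seminorm. -/
theorem IsCStarSeminorm.exists_completion {R : Type u} [Ring R] [StarRing R] [Algebra ℂ R]
    [StarModule ℂ R] {p : R → ℝ} (hp : IsCStarSeminorm p) :
    ∃ (E : Type u) (_ : CStarAlgebra E) (j : R →⋆ₐ[ℂ] E), DenseRange j ∧ ∀ x, ‖j x‖ = p x := by
  have h0 : p 0 = 0 := by
    have h1 := hp.smul_le 0 0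
    have h2 := hp.add_le 0 0
    rw [smul_zero, norm_zero, zero_mul] at h1
    rw [add_zero] at h2
    linarith
  let q : RingSeminorm R :=
    { toFun := p
      map_zero' := h0
      add_le' := hp.add_le
      neg' := fun x => by
        have h := fun x => hp.smul_le (-1) x
        simp only [neg_smul, one_smul, norm_neg, norm_one, one_mul] at h
        exact le_antisymm (h x) (by simpa using h (-x))
      mul_le' := hp.mul_le }
  let i1 : SeminormedRing R := q.toSeminormedRing
  let i2 : NormedAlgebra ℂ R := { ‹Algebra ℂ R› with norm_smul_le := hp.smul_le }
  exact exists_completion_of_seminormedRing R hp.le_star_mul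

end Completion

/-! ### Homomorphisms with dense range -/

section DenseRange

variable {A B : Type u} [CStarAlgebra A] [CStarAlgebra B]

/-- Self-adjoint elements of the range lift with the same norm: a lift is cut off by continuous
functional calculus. -/
theorem exists_selfAdjoint_lift (f : A →⋆ₐ[ℂ] B) (a : selfAdjoint A) :
    ∃ a' : A, f a' = f a ∧ ‖a'‖ ≤ ‖f a‖ := by
  have hfc : Continuous f := (toCLM f).continuous
  have hfa : IsSelfAdjoint (f (a : A)) := IsSelfAdjoint.map a.2 f
  set c := ‖f (a : A)‖ with hc
  have hcont : Continuous fun x : ℝ => max (-c) (min c x) := by fun_prop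
  refine ⟨cfc (fun x : ℝ => max (-c) (min c x)) (a : A), ?_, ?_⟩
  · have ha : IsSelfAdjoint (a : A) := a.2
    rw [StarAlgHom.map_cfc f (fun x : ℝ => max (-c) (min c x)) (a : A) hcont.continuousOn hfc
      ha hfa]
    conv_rhs => rw [← cfc_id ℝ (f (a : A))]
    refine cfc_congr fun x hx => ?_
    rcases subsingleton_or_nontrivial B with h | h
    · exact absurd hx (by simp [spectrum.of_subsingleton])
    have := spectrum.norm_le_norm_of_mem hx
    rw [Real.norm_eq_abs, abs_le] at this
    simp only [id]
    rw [min_eq_right this.2, max_eq_right this.1]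
  · refine norm_cfc_le (norm_nonneg _) fun x _ => ?_
    rw [Real.norm_eq_abs, abs_le]
    exact ⟨le_max_left _ _, max_le (by linarith [norm_nonneg (f (a : A))]) (min_le_left _ _)⟩

/-- The range of a ⋆-homomorphism is closed: preimages can be chosen with at most twice the norm, by
treating real and imaginary parts separately, and the completeness of `A` gives preimages of limits.
-/
theorem surjective_of_denseRange (f : A →⋆ₐ[ℂ] B) (hf : DenseRange f) :
    Function.Surjective f := by
  let g : NormedAddGroupHom A B :=
    { toFun := f
      map_add' := map_add f
      bound' := ⟨1, fun x => by
        rw [one_mul]; exact NonUnitalStarAlgHom.norm_apply_le f x⟩ }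
  have h : g.SurjectiveOnWith g.range 2 := by
    rintro _ ⟨x, rfl⟩
    obtain ⟨a, ha, hna⟩ := exists_selfAdjoint_lift f (realPart x)
    obtain ⟨b, hb, hnb⟩ := exists_selfAdjoint_lift f (imaginaryPart x)
    have e : ∀ y : A, ‖f (realPart y : A)‖ ≤ ‖f y‖ := fun y => by
      rw [realPart_apply_coe, ← Complex.coe_smul, map_smul, map_add, map_star, norm_smul]
      have := norm_add_le (f y) (star (f y))
      rw [norm_star] at this
      norm_num
      linarith
    have e' : ‖f (imaginaryPart x : A)‖ ≤ ‖f x‖ := by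
      have := e (-(Complex.I • x))
      rwa [map_neg, realPart_I_smul, neg_neg, map_neg, norm_neg, map_smul, norm_smul,
        Complex.norm_I, one_mul] at this
    refine ⟨a + Complex.I • b, ?_, ?_⟩
    · change f _ = f x
      rw [map_add, map_smul, ha, hb, ← map_smul, ← map_add, realPart_add_I_smul_imaginaryPart]
    · refine (norm_add_le _ _).trans ?_
      rw [norm_smul, Complex.norm_I, one_mul]
      change _ ≤ 2 * ‖f x‖
      linarith [e x]
  have h2 := controlled_closure_of_complete (by norm_num : (0 : ℝ) < 2) (zero_lt_one' ℝ) h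
  intro b
  obtain ⟨a, ha, -⟩ := h2 b (by
    have : b ∈ closure (Set.range f) := hf b
    exact this)
  exact ⟨a, ha⟩

end DenseRange

/-! ### Lip-norms from dense families -/

section Family

variable {E : Type u} [CStarAlgebra E] {V : Type u} [AddCommGroup V] [Module ℝ V]
  (j : V →ₗ[ℝ] selfAdjoint E) (M : ExtSeminorm V)

/-- The closed ball of radius `l` of the image of a seminorm. -/
def imageBall (l : ℝ≥0) : Set (selfAdjoint E) := closure (j '' {v | M v ≤ l})

variable {j M}

theorem imageBall_mono {l m : ℝ≥0} (h : l ≤ m) : imageBall j M l ⊆ imageBall j M m :=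
  closure_mono (Set.image_mono fun _ hv => le_trans hv (ENNReal.coe_le_coe.2 h))

theorem add_mem_imageBall {l m : ℝ≥0} {a b : selfAdjoint E} (ha : a ∈ imageBall j M l)
    (hb : b ∈ imageBall j M m) : a + b ∈ imageBall j M (l + m) := by
  refine map_mem_closure₂ continuous_add ha hb ?_
  rintro _ ⟨v, hv, rfl⟩ _ ⟨w, hw, rfl⟩
  refine ⟨v + w, ?_, map_add j v w⟩
  rw [Set.mem_ofPred_eq, ENNReal.coe_add]
  exact (M.map_add_le' v w).trans (add_le_add hv hw)

theorem smul_mem_imageBall {l : ℝ≥0} {a : selfAdjoint E} (r : ℝ) (ha : a ∈ imageBall j M l) :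
    r • a ∈ imageBall j M (‖r‖₊ * l) := by
  refine map_mem_closure (continuous_const_smul r) ha ?_
  rintro _ ⟨v, hv, rfl⟩
  refine ⟨r • v, ?_, map_smul j r v⟩
  rw [Set.mem_ofPred_eq, M.map_smul', ENNReal.coe_mul]
  exact mul_le_mul_right hv _

variable (j M)

/-- The largest lower semicontinuous seminorm which is dominated by `M` on the image of `j`: its
value at `a` is the infimum of the radii of the closed image balls containing `a`. -/
noncomputable def imageLip : ExtSeminorm (selfAdjoint E) :=
  ExtSeminorm.ofLe (fun a => ⨅ (l : ℝ≥0) (_ : a ∈ imageBall j M l), (l : ℝ≥0∞))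
    (le_antisymm (iInf₂_le_of_le 0 (subset_closure ⟨0, by
      rw [Set.mem_ofPred_eq, M.map_zero]; exact zero_le, map_zero j⟩) le_rfl) zero_le)
    (fun r a _ => by
      rw [ENNReal.mul_iInf_of_ne (by simpa using ‹r ≠ 0›) (by simp)]
      refine le_iInf fun l => ?_
      rw [ENNReal.mul_iInf_of_ne (by simpa using ‹r ≠ 0›) (by simp)]
      exact le_iInf fun h => iInf₂_le (‖r‖₊ * l) (smul_mem_imageBall r h))
    (fun a b => by
      simp only [ENNReal.iInf_add, ENNReal.add_iInf]
      exact le_iInf fun l => le_iInf fun hl => le_iInf fun m => le_iInf fun hm =>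
        iInf₂_le (m + l) (add_mem_imageBall hm hl))

variable {j M}

theorem imageLip_le {l : ℝ≥0} {a : selfAdjoint E} (h : a ∈ imageBall j M l) :
    imageLip j M a ≤ l := iInf₂_le l h

theorem mem_imageBall {l : ℝ≥0} {a : selfAdjoint E} (h : imageLip j M a < l) :
    a ∈ imageBall j M l := by
  obtain ⟨m, hm⟩ := iInf_lt_iff.1 h
  obtain ⟨ha, hml⟩ := iInf_lt_iff.1 hm
  exact imageBall_mono (ENNReal.coe_le_coe.1 hml.le) ha

theorem imageLip_apply_le (v : V) : imageLip j M (j v) ≤ M v :=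
  le_of_forall_coe_gt fun _ hl => imageLip_le (subset_closure ⟨v, hl.le, rfl⟩)

theorem isClosed_imageLip_le : IsClosed {a | imageLip j M a ≤ 1} := by
  have : {a | imageLip j M a ≤ 1} = ⋂ (l : ℝ≥0) (_ : 1 < l), imageBall j M l := by
    ext a
    simp only [Set.mem_iInter]
    refine ⟨fun h l hl => mem_imageBall (lt_of_le_of_lt h (ENNReal.one_lt_coe_iff.2 hl)),
      fun h => le_of_forall_coe_gt fun l hl => imageLip_le (h l (ENNReal.one_lt_coe_iff.1 hl))⟩
  rw [this]
  exact isClosed_iInter fun l => isClosed_iInter fun _ => isClosed_closure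

/-- An element of Lip-norm less than `l` and of norm less than `R'` is a limit of elements of the
family of Lip-norm at most `l` and of norm at most `R'`. -/
theorem mem_closure_of_imageLip_lt {l : ℝ≥0} {R R' : ℝ} (hR : R < R') {a : selfAdjoint E}
    (h : imageLip j M a < l) (ha : ‖a‖ ≤ R) :
    a ∈ closure (j '' {v | M v ≤ l ∧ ‖j v‖ ≤ R'}) := by
  have h1 := mem_imageBall h
  have hU : IsOpen {x : selfAdjoint E | ‖x‖ < R'} := isOpen_lt continuous_norm continuous_const
  have h2 : a ∈ closure ({x : selfAdjoint E | ‖x‖ < R'} ∩ j '' {v | M v ≤ l}) :=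
    hU.inter_closure ⟨lt_of_le_of_lt ha hR, h1⟩
  refine closure_mono ?_ h2
  rintro _ ⟨hx, v, hv, rfl⟩
  exact ⟨v, ⟨hv, hx.le⟩, rfl⟩

/-- Rieffel's criterion for the family. The radius `2` leaves room for the closures of the image
balls. -/
theorem isLipNorm_imageLip (hd : Dense (j '' {v | M v < ∞})) (h1 : ∃ v, M v = 0 ∧ j v = 1)
    (C : ℝ) (hC : ∀ v, M v ≤ 2 → ∃ t : ℝ, ‖j v - t • 1‖ ≤ C)
    (htb : ∀ R : ℝ, TotallyBounded (j '' {v | M v ≤ 2 ∧ ‖j v‖ ≤ R})) :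
    IsLipNorm (imageLip j M) := by
  have h12 : (1 : ℝ≥0∞) < ((2 : ℝ≥0) : ℝ≥0∞) := by norm_num
  refine isLipNorm_of_totallyBounded (hd.mono ?_) ?_ (C + 1) (fun a ha => ?_) ?_
  · rintro _ ⟨v, hv, rfl⟩
    exact (imageLip_apply_le v).trans_lt hv
  · obtain ⟨v, hv, hv1⟩ := h1
    rw [← hv1]
    exact le_antisymm ((imageLip_apply_le v).trans hv.le) zero_le
  · have h2 := mem_imageBall (lt_of_le_of_lt ha h12)
    obtain ⟨_, ⟨v, hv, rfl⟩, hav⟩ := Metric.mem_closure_iff.1 h2 1 one_pos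
    obtain ⟨t, ht⟩ := hC v (by simpa using hv)
    refine ⟨t, ?_⟩
    have e : a - t • (1 : selfAdjoint E) = (a - j v) + (j v - t • 1) := by abel
    rw [e]
    rw [dist_eq_norm] at hav
    linarith [norm_add_le (a - j v) (j v - t • 1)]
  · refine (htb (C + 2)).closure.subset ?_
    rintro a ⟨ha, hn⟩
    have := mem_closure_of_imageLip_lt (by linarith : C + 1 < C + 2) (lt_of_le_of_lt ha h12) hn
    simpa using this

variable {A : Type u} [CStarAlgebra A] {π : E →⋆ₐ[ℂ] A}

theorem lip_saMap_le_imageLip {L : ExtSeminorm (selfAdjoint A)}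
    (hc : IsClosed {a : selfAdjoint A | L a ≤ 1}) (h : ∀ v, L (saMap π (j v)) ≤ M v)
    (a : selfAdjoint E) : L (saMap π a) ≤ imageLip j M a := by
  refine le_of_forall_coe_gt fun l hl => ?_
  refine closure_minimal (t := {a | L (saMap π a) ≤ l}) ?_
    ((isClosed_ball_of_isClosed hc l).preimage (continuous_saMap π)) (mem_imageBall hl)
  rintro _ ⟨v, hv, rfl⟩
  exact (h v).trans hv

/-- Norm bounds only have to be checked on the dense family. -/
theorem normBound_imageLip {r : ℝ≥0}
    (h : ∀ v (l : ℝ≥0), M v ≤ l → ‖j v‖ ≤ ‖saMap π (j v)‖ + r * l) :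
    NormBound (imageLip j M) π r := by
  intro d l hl
  refine le_add_mul_of_forall_gt fun l' hl' => ?_
  refine closure_minimal (t := {d | ‖d‖ ≤ ‖saMap π d‖ + r * l'}) ?_
    (isClosed_le continuous_norm ((continuous_saMap π).norm.add continuous_const))
    (mem_imageBall (lt_of_le_of_lt hl (ENNReal.coe_lt_coe.2 hl')))
  rintro _ ⟨v, hv, rfl⟩
  exact h v l' hv

/-- The quotient of `imageLip j M` by `π` is `imageLip (π ∘ j) M`: under a norm bound, an
approximation of an element of the quotient by images of the family lifts to a sequence in a compact
ball. -/
theorem isQuotient_imageLip [Nontrivial E] (hL : IsLipNorm (imageLip j M)) {r : ℝ≥0}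
    (hr : NormBound (imageLip j M) π r) {k : V →ₗ[ℝ] selfAdjoint A}
    (hk : ∀ v, saMap π (j v) = k v) : IsQuotient (imageLip j M) π (imageLip k M) := by
  refine isQuotient_of_lift (lip_saMap_le_imageLip isClosed_imageLip_le fun v => ?_)
    fun a l ha => ?_
  · rw [hk]
    exact imageLip_apply_le v
  · have hcl := mem_closure_of_imageLip_lt (lt_add_one ‖a‖) ha le_rfl
    have hcomp := (hL.isCompact isClosed_imageLip_le l (‖a‖ + 1 + r * l)).image
      (continuous_saMap π)
    obtain ⟨d, hd, rfl⟩ := closure_minimal (by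
      rintro _ ⟨v, ⟨hv, hn⟩, rfl⟩
      have hv' := (imageLip_apply_le (j := j) v).trans hv
      refine ⟨j v, ⟨hv', ?_⟩, hk v⟩
      have := hr _ _ hv'
      rw [hk] at this
      linarith) hcomp.isClosed hcl
    exact ⟨d, rfl, hd.1⟩

end Family

/-! ### Sequences of tunnels -/

/-- A relation between consecutive types which is total to the right and to the left has a path
through every point. -/
theorem exists_path {X : ℕ → Type*} {R : ∀ k, X k → X (k + 1) → Prop}
    (hr : ∀ k x, ∃ y, R k x y) (hl : ∀ k y, ∃ x, R k x y) (N : ℕ) (x : X N) :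
    ∃ s : ∀ k, X k, s N = x ∧ ∀ k, R k (s k) (s (k + 1)) := by
  induction N generalizing X with
  | zero =>
    choose f hf using hr
    exact ⟨fun k => Nat.rec x (fun k y => f k y) k, rfl, fun k => hf k _⟩
  | succ N ih =>
    obtain ⟨s, hs, hR⟩ := ih (X := fun k => X (k + 1)) (R := fun k => R (k + 1))
      (fun k => hr (k + 1)) (fun k => hl (k + 1)) x
    obtain ⟨x₀, hx₀⟩ := hl 0 (s 0)
    refine ⟨fun k => Nat.casesOn k x₀ s, hs, fun k => ?_⟩
    cases k with
    | zero => exact hx₀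
    | succ k => exact hR k

/-- A path can be changed below `N` in order to lie in a prescribed subset, if it lies there from
`N` on. -/
theorem exists_path_of_le {X : ℕ → Type*} {R : ∀ k, X k → X (k + 1) → Prop}
    {P : ∀ k, X k → Prop} (hl : ∀ k y, P (k + 1) y → ∃ x, P k x ∧ R k x y) (N : ℕ)
    (s : ∀ k, X k) (hP : ∀ k, N ≤ k → P k (s k)) (hR : ∀ k, N ≤ k → R k (s k) (s (k + 1))) :
    ∃ t : ∀ k, X k, (∀ k, N ≤ k → t k = s k) ∧ (∀ k, P k (t k)) ∧
      ∀ k, R k (t k) (t (k + 1)) := by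
  induction N generalizing s with
  | zero => exact ⟨s, fun _ _ => rfl, fun k => hP k k.zero_le, fun k => hR k k.zero_le⟩
  | succ N ih =>
    obtain ⟨x, hx, hxR⟩ := hl N (s (N + 1)) (hP _ le_rfl)
    have hne : ∀ k, N + 1 ≤ k → Function.update s N x k = s k := fun k hk =>
      Function.update_of_ne (by omega) _ _
    obtain ⟨t, hts, htP, htR⟩ := ih (Function.update s N x)
      (fun k hk => by
        rcases hk.eq_or_lt with rfl | hk
        · rwa [Function.update_self]
        · rw [hne k hk]; exact hP k hk)
      (fun k hk => by
        rcases hk.eq_or_lt with rfl | hk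
        · rwa [Function.update_self, hne _ le_rfl]
        · rw [hne k hk, hne (k + 1) (by omega)]; exact hR k hk)
    exact ⟨t, fun k hk => (hts k (by omega)).trans (hne k hk), htP, htR⟩

/-- A sequence of consecutive tunnels between `F`-quasi-Leibniz quantum compact metric spaces. The
extents are at most `2 ^ (-(k + 1))`, so that those from `N` on add up to at most `2 ^ (-N)`. -/
structure TunnelSeq (F : ℝ≥0 × ℝ≥0 × ℝ≥0 × ℝ≥0 → ℝ≥0) : Type (u + 1) where
  pt : ℕ → Pair.{u}
  tun : ∀ k, PreTunnel (pt k) (pt (k + 1))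
  mono : Monotone F
  isTunnel : ∀ k, IsTunnel F (tun k)
  extent_le : ∀ k, (tun k).extent ≤ ((1 / 2 : ℝ≥0) ^ (k + 1) : ℝ≥0)

namespace TunnelSeq

variable {F : ℝ≥0 × ℝ≥0 × ℝ≥0 × ℝ≥0 → ℝ≥0} (T : TunnelSeq.{u} F)

/-- The ⋆-algebra of all sequences of elements of the tunnels. -/
def Alg : Type u := ∀ k, (T.tun k).mid

noncomputable instance : Ring T.Alg := inferInstanceAs (Ring (∀ k, (T.tun k).mid))

noncomputable instance : StarRing T.Alg := inferInstanceAs (StarRing (∀ k, (T.tun k).mid))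

noncomputable instance : Algebra ℂ T.Alg := inferInstanceAs (Algebra ℂ (∀ k, (T.tun k).mid))

instance : StarModule ℂ T.Alg := inferInstanceAs (StarModule ℂ (∀ k, (T.tun k).mid))

variable {T}

/-- The coordinates of a self-adjoint sequence. -/
def coord (k : ℕ) (v : selfAdjoint T.Alg) : selfAdjoint (T.tun k).mid :=
  ⟨v.1 k, congrFun v.2 k⟩

/-- The self-adjoint sequence with given coordinates. -/
def ofCoord (d : ∀ k, selfAdjoint (T.tun k).mid) : selfAdjoint T.Alg :=
  ⟨fun k => (d k).1, funext fun k => (d k).2⟩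

theorem coord_ofCoord (d : ∀ k, selfAdjoint (T.tun k).mid) (k : ℕ) : coord k (ofCoord d) = d k :=
  rfl

theorem coord_add (k : ℕ) (v w : selfAdjoint T.Alg) : coord k (v + w) = coord k v + coord k w := rfl

theorem coord_sub (k : ℕ) (v w : selfAdjoint T.Alg) : coord k (v - w) = coord k v - coord k w := rfl

theorem coord_zero (k : ℕ) : coord k (0 : selfAdjoint T.Alg) = 0 := rfl

theorem coord_one (k : ℕ) : coord k (1 : selfAdjoint T.Alg) = 1 := rfl

theorem coord_smul (k : ℕ) (r : ℝ) (v : selfAdjoint T.Alg) : coord k (r • v) = r • coord k v := by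
  refine Subtype.ext ?_
  change (r : ℂ) • v.1 k = r • v.1 k
  exact Complex.coe_smul _ _

theorem coord_realPart (k : ℕ) (x : T.Alg) : coord k (realPart x) = realPart (x k) := by
  refine Subtype.ext ?_
  change (realPart x : T.Alg) k = _
  rw [realPart_apply_coe, realPart_apply_coe, ← Complex.coe_smul, ← Complex.coe_smul]
  rfl

theorem coord_imaginaryPart (k : ℕ) (x : T.Alg) :
    coord k (imaginaryPart x) = imaginaryPart (x k) := by
  refine Subtype.ext ?_
  change (imaginaryPart x : T.Alg) k = _
  rw [imaginaryPart_apply_coe, imaginaryPart_apply_coe, ← Complex.coe_smul, ← Complex.coe_smul]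
  rfl

variable (T) in
/-- The supremum of the Lip-norms of the coordinates. -/
noncomputable def seqLip : ExtSeminorm (selfAdjoint T.Alg) where
  toFun v := ⨆ k, (T.tun k).mid.lip (coord k v)
  map_smul' r v := by
    simp only [coord_smul, ExtSeminorm.map_smul', ENNReal.mul_iSup]
  map_add_le' v w := iSup_le fun k => ((T.tun k).mid.lip.map_add_le' _ _).trans
    (add_le_add (le_iSup (fun k => (T.tun k).mid.lip (coord k v)) k)
      (le_iSup (fun k => (T.tun k).mid.lip (coord k w)) k))

theorem lip_coord_le (k : ℕ) (v : selfAdjoint T.Alg) :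
    (T.tun k).mid.lip (coord k v) ≤ T.seqLip v :=
  le_iSup (fun k => (T.tun k).mid.lip (coord k v)) k

theorem seqLip_le {v : selfAdjoint T.Alg} {c : ℝ≥0∞}
    (h : ∀ k, (T.tun k).mid.lip (coord k v) ≤ c) : T.seqLip v ≤ c := iSup_le h

/-- The coordinates of a coherent sequence match in the common quotients of consecutive tunnels. -/
def IsCoherent (v : selfAdjoint T.Alg) : Prop :=
  ∀ k, saMap (T.tun k).right (coord k v) = saMap (T.tun (k + 1)).left (coord (k + 1) v)

variable (T) in
/-- The coherent sequences of bounded Lip-norm. -/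
noncomputable def coh : Submodule ℝ (selfAdjoint T.Alg) where
  carrier := {v | IsCoherent v ∧ T.seqLip v < ∞}
  add_mem' := by
    rintro v w ⟨hv, hv'⟩ ⟨hw, hw'⟩
    refine ⟨fun k => ?_, (T.seqLip.map_add_le' v w).trans_lt (ENNReal.add_lt_top.2 ⟨hv', hw'⟩)⟩
    rw [coord_add, coord_add, saMap_add, saMap_add, hv k, hw k]
  zero_mem' := by
    refine ⟨fun k => ?_, by rw [T.seqLip.map_zero]; exact ENNReal.zero_lt_top⟩
    rw [coord_zero, coord_zero, saMap_zero, saMap_zero]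
  smul_mem' := by
    rintro r v ⟨hv, hv'⟩
    refine ⟨fun k => ?_, by
      rw [T.seqLip.map_smul']; exact ENNReal.mul_lt_top enorm_lt_top hv'⟩
    rw [coord_smul, coord_smul, saMap_smul, saMap_smul, hv k]

/-- The norms of the coordinates of a coherent sequence vary slowly: both maps of the `k`-th tunnel
decrease norms by at most its extent times the Lip-norm. -/
theorem abs_norm_sub_le {v : selfAdjoint T.Alg} (hv : IsCoherent v) {l : ℝ≥0}
    (hl : ∀ k, (T.tun k).mid.lip (coord k v) ≤ l) {k m : ℕ} (hkm : k ≤ m) :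
    |‖coord m v‖ - ‖coord k v‖| ≤ ((1 / 2) ^ k - (1 / 2) ^ m) * l := by
  induction m, hkm using Nat.le_induction with
  | base => simp
  | succ m hkm ih =>
    have b1 := ((T.isTunnel m).extent_le_iff.1 (T.extent_le m)).2 _ _ (hl m)
    have b2 := ((T.isTunnel (m + 1)).extent_le_iff.1 (T.extent_le (m + 1))).1 _ _ (hl (m + 1))
    have c1 := norm_saMap_le (T.tun m).right (coord m v)
    have c2 := norm_saMap_le (T.tun (m + 1)).left (coord (m + 1) v)
    rw [hv m] at b1 c1
    push_cast at b1 b2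
    have p : (0 : ℝ) ≤ (1 / 2) ^ m * l := by positivity
    rw [abs_le] at ih ⊢
    rw [pow_succ] at b1 b2 ⊢
    rw [pow_succ] at b2
    constructor <;> nlinarith

/-- From `N` on, the norms of the coordinates agree up to `2 ^ (-N)` times the Lip-norm. -/
theorem norm_coord_le {v : selfAdjoint T.Alg} (hv : IsCoherent v) {l : ℝ≥0}
    (hl : T.seqLip v ≤ l) {N k m : ℕ} (hk : N ≤ k) (hm : N ≤ m) :
    ‖coord k v‖ ≤ ‖coord m v‖ + (1 / 2) ^ N * l := by
  have hl' := fun k => (lip_coord_le k v).trans hl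
  have aux : ∀ i j : ℕ, N ≤ i → ((1 / 2 : ℝ) ^ i - (1 / 2) ^ j) * l ≤ (1 / 2) ^ N * l := by
    intro i j hi
    have h1 : (1 / 2 : ℝ) ^ i ≤ (1 / 2) ^ N :=
      pow_le_pow_of_le_one (by norm_num) (by norm_num) hi
    have h2 : (0 : ℝ) ≤ (1 / 2) ^ j := by positivity
    exact mul_le_mul_of_nonneg_right (by linarith) l.2
  rcases le_total k m with h | h
  · linarith [(abs_le.1 (abs_norm_sub_le hv hl' h)).1, aux k m hk]
  · linarith [(abs_le.1 (abs_norm_sub_le hv hl' h)).2, aux m k hm]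

theorem one_mem_coh : (1 : selfAdjoint T.Alg) ∈ T.coh := by
  refine ⟨fun k => ?_, (seqLip_le (c := 0) fun k => ?_).trans_lt ENNReal.zero_lt_top⟩
  · rw [coord_one, coord_one, saMap_one, saMap_one]
  · rw [coord_one]
    exact (T.isTunnel k).mid.isLipNorm.map_one.le

theorem seqLip_one : T.seqLip 1 = 0 := le_antisymm (seqLip_le fun k => by
  rw [coord_one]
  exact (T.isTunnel k).mid.isLipNorm.map_one.le) zero_le

/-- The Jordan product (`i = true`) and the Lie product (`i = false`) of self-adjoint sequences. -/
noncomputable def seqJl (i : Bool) (v w : selfAdjoint T.Alg) : selfAdjoint T.Alg :=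
  if i then realPart ((v : T.Alg) * w) else imaginaryPart ((v : T.Alg) * w)

theorem coord_seqJl (i : Bool) (v w : selfAdjoint T.Alg) (k : ℕ) :
    coord k (seqJl i v w) = jl i (coord k v) (coord k w) := by
  cases i
  · exact (coord_imaginaryPart k _).trans (imaginaryPart_mul (coord k v) (coord k w))
  · exact (coord_realPart k _).trans (realPart_mul (coord k v) (coord k w))

theorem seqJl_mem_coh (i : Bool) {v w : selfAdjoint T.Alg} (hv : v ∈ T.coh) (hw : w ∈ T.coh) :
    seqJl i v w ∈ T.coh := by
  obtain ⟨l, hl⟩ : ∃ l : ℝ≥0, T.seqLip v ≤ l := ⟨_, (ENNReal.coe_toNNReal hv.2.ne).ge⟩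
  obtain ⟨m, hm⟩ : ∃ m : ℝ≥0, T.seqLip w ≤ m := ⟨_, (ENNReal.coe_toNNReal hw.2.ne).ge⟩
  refine ⟨fun k => ?_, (seqLip_le
    (c := F (‖coord 0 v‖₊ + l, ‖coord 0 w‖₊ + m, l, m)) fun k => ?_).trans_lt ENNReal.coe_lt_top⟩
  · rw [coord_seqJl, coord_seqJl, saMap_jl, saMap_jl, hv.1 k, hw.1 k]
  · have h1 := norm_coord_le hv.1 hl k.zero_le le_rfl
    have h2 := norm_coord_le hw.1 hm k.zero_le le_rfl
    rw [pow_zero, one_mul] at h1 h2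
    rw [coord_seqJl]
    exact (T.isTunnel k).mid.jl_le_of_le T.mono i h1 h2 ((lip_coord_le k v).trans hl)
      ((lip_coord_le k w).trans hm)

variable (T) in
/-- The ⋆-algebra of coherent sequences: the complexification of the coherent self-adjoint ones. -/
noncomputable def sub : StarSubalgebra ℂ T.Alg :=
  jlSubalgebra T.coh one_mem_coh fun _ ha _ hb => ⟨seqJl_mem_coh true ha hb,
    seqJl_mem_coh false ha hb⟩

theorem coe_mem_sub {v : selfAdjoint T.Alg} (hv : v ∈ T.coh) : (v : T.Alg) ∈ T.sub :=
  coe_mem_jlSubalgebra.2 hv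

theorem exists_norm_le {x : T.Alg} (hx : x ∈ T.sub) : ∃ C : ℝ, ∀ k, ‖x k‖ ≤ C := by
  have key : ∀ v ∈ T.coh, ∃ C : ℝ, ∀ k, ‖coord k v‖ ≤ C := fun v hv =>
    ⟨_, fun k => norm_coord_le hv.1 (ENNReal.coe_toNNReal hv.2.ne).ge k.zero_le le_rfl⟩
  obtain ⟨C, hC⟩ := key _ hx.1
  obtain ⟨C', hC'⟩ := key _ hx.2
  refine ⟨C + C', fun k => ?_⟩
  have h1 := hC k
  have h2 := hC' k
  rw [coord_realPart] at h1
  rw [coord_imaginaryPart] at h2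
  rw [← realPart_add_I_smul_imaginaryPart (x k)]
  refine (norm_add_le _ _).trans (add_le_add h1 ?_)
  rw [norm_smul, Complex.norm_I, one_mul]
  exact h2

/-! ### The seminorms of the tails of coherent sequences -/

/-- The supremum of the norms of the coordinates from `N` on. -/
noncomputable def tailSup (N : ℕ) (x : T.sub) : ℝ := ⨆ k, ‖x.1 (N + k)‖

theorem norm_le_tailSup {N k : ℕ} (hk : N ≤ k) (x : T.sub) : ‖x.1 k‖ ≤ tailSup N x := by
  obtain ⟨C, hC⟩ := exists_norm_le x.2
  obtain ⟨i, rfl⟩ := Nat.exists_eq_add_of_le hk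
  exact le_ciSup (f := fun i => ‖x.1 (N + i)‖) ⟨C, by rintro _ ⟨i, rfl⟩; exact hC _⟩ i

theorem tailSup_le {N : ℕ} {x : T.sub} {c : ℝ} (h : ∀ k, N ≤ k → ‖x.1 k‖ ≤ c) :
    tailSup N x ≤ c := ciSup_le fun k => h (N + k) (Nat.le_add_right N k)

theorem tailSup_nonneg (N : ℕ) (x : T.sub) : 0 ≤ tailSup N x :=
  (norm_nonneg _).trans (norm_le_tailSup le_rfl x)

theorem isCStarSeminorm_tailSup (N : ℕ) : IsCStarSeminorm (tailSup (T := T) N) where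
  add_le x y := tailSup_le fun k hk => (norm_add_le (x.1 k) (y.1 k)).trans
    (add_le_add (norm_le_tailSup hk x) (norm_le_tailSup hk y))
  smul_le c x := tailSup_le fun k hk => by
    have : ‖(c • x).1 k‖ = ‖c‖ * ‖x.1 k‖ := norm_smul c (x.1 k)
    rw [this]
    exact mul_le_mul_of_nonneg_left (norm_le_tailSup hk x) (norm_nonneg c)
  mul_le x y := tailSup_le fun k hk => (norm_mul_le (x.1 k) (y.1 k)).trans
    (mul_le_mul (norm_le_tailSup hk x) (norm_le_tailSup hk y) (norm_nonneg _) (tailSup_nonneg N x))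
  le_star_mul x := by
    have h : tailSup N x ≤ Real.sqrt (tailSup N (star x * x)) := tailSup_le fun k hk => by
      refine Real.le_sqrt_of_sq_le ?_
      rw [sq, ← CStarRing.norm_star_mul_self]
      exact norm_le_tailSup hk (star x * x)
    have h2 := mul_self_le_mul_self (tailSup_nonneg N x) h
    rwa [Real.mul_self_sqrt (tailSup_nonneg N _)] at h2

theorem tailSup_antitone (x : T.sub) : Antitone fun N => tailSup N x := fun _ _ h =>
  tailSup_le fun _ hk => norm_le_tailSup (h.trans hk) x

/-- The limit superior of the norms of the coordinates. -/
noncomputable def tailLim (x : T.sub) : ℝ := ⨅ N, tailSup N x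

theorem bddBelow_tailSup (x : T.sub) : BddBelow (Set.range fun N => tailSup N x) :=
  ⟨0, by rintro _ ⟨N, rfl⟩; exact tailSup_nonneg N x⟩

theorem tailLim_le (N : ℕ) (x : T.sub) : tailLim x ≤ tailSup N x :=
  ciInf_le (bddBelow_tailSup x) N

theorem tendsto_tailSup (x : T.sub) : Tendsto (fun N => tailSup N x) atTop (𝓝 (tailLim x)) :=
  tendsto_atTop_ciInf (tailSup_antitone x) (bddBelow_tailSup x)

theorem isCStarSeminorm_tailLim : IsCStarSeminorm (tailLim (T := T)) where
  add_le x y := le_of_tendsto_of_tendsto' (tendsto_tailSup (x + y))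
    ((tendsto_tailSup x).add (tendsto_tailSup y)) fun N => (isCStarSeminorm_tailSup N).add_le x y
  smul_le c x := le_of_tendsto_of_tendsto' (tendsto_tailSup (c • x))
    ((tendsto_tailSup x).const_mul ‖c‖) fun N => (isCStarSeminorm_tailSup N).smul_le c x
  mul_le x y := le_of_tendsto_of_tendsto' (tendsto_tailSup (x * y))
    ((tendsto_tailSup x).mul (tendsto_tailSup y)) fun N => (isCStarSeminorm_tailSup N).mul_le x y
  le_star_mul x := le_of_tendsto_of_tendsto' ((tendsto_tailSup x).mul (tendsto_tailSup x))
    (tendsto_tailSup (star x * x)) fun N => (isCStarSeminorm_tailSup N).le_star_mul x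

/-! ### Lifting elements to coherent sequences -/

/-- Every element of finite Lip-norm of a space in the sequence lifts to a coherent sequence. -/
theorem exists_coh_lift (N : ℕ) {b : selfAdjoint (T.pt N)} {c : ℝ≥0} (hb : (T.pt N).lip b < c) :
    ∃ v ∈ T.coh, saMap (T.tun N).left (coord N v) = b ∧ T.seqLip v ≤ c := by
  obtain ⟨d, hd, hdc⟩ := (T.isTunnel N).left_quotient.exists_lift hb
  obtain ⟨s, hs, hR⟩ := exists_path
    (X := fun k => {d : selfAdjoint (T.tun k).mid // (T.tun k).mid.lip d < c})
    (R := fun k d d' => saMap (T.tun k).right d.1 = saMap (T.tun (k + 1)).left d'.1)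
    (fun k d => by
      obtain ⟨d', h, hc⟩ := (T.isTunnel (k + 1)).left_quotient.exists_lift
        (((T.isTunnel k).right_quotient.le d.1).trans_lt d.2)
      exact ⟨⟨d', hc⟩, h.symm⟩)
    (fun k d => by
      obtain ⟨d', h, hc⟩ := (T.isTunnel k).right_quotient.exists_lift
        (((T.isTunnel (k + 1)).left_quotient.le d.1).trans_lt d.2)
      exact ⟨⟨d', hc⟩, h⟩) N ⟨d, hdc⟩
  have hle : T.seqLip (ofCoord fun k => (s k).1) ≤ c := seqLip_le fun k => (s k).2.le
  refine ⟨ofCoord fun k => (s k).1, ⟨hR, hle.trans_lt ENNReal.coe_lt_top⟩, ?_, hle⟩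
  rw [coord_ofCoord, hs, hd]

/-- A coherent sequence whose Lip-norms are small from `N` on can be changed below `N` so that all
Lip-norms are small. -/
theorem exists_coh_eq {v : selfAdjoint T.Alg} (hv : IsCoherent v) (N : ℕ) {c : ℝ≥0}
    (hc : ∀ k, N ≤ k → (T.tun k).mid.lip (coord k v) < c) :
    ∃ w ∈ T.coh, (∀ k, N ≤ k → coord k w = coord k v) ∧ T.seqLip w ≤ c := by
  obtain ⟨t, ht, htc, hR⟩ := exists_path_of_le
    (X := fun k => selfAdjoint (T.tun k).mid)
    (R := fun k d d' => saMap (T.tun k).right d = saMap (T.tun (k + 1)).left d')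
    (P := fun k d => (T.tun k).mid.lip d < c)
    (fun k d hd => by
      obtain ⟨d', h, hc⟩ := (T.isTunnel k).right_quotient.exists_lift
        (((T.isTunnel (k + 1)).left_quotient.le d).trans_lt hd)
      exact ⟨d', hc, h⟩) N (fun k => coord k v) hc fun k _ => hv k
  have hle : T.seqLip (ofCoord t) ≤ c := seqLip_le fun k => (htc k).le
  exact ⟨ofCoord t, ⟨hR, hle.trans_lt ENNReal.coe_lt_top⟩, ht, hle⟩

end TunnelSeq

/-! ### Completeness -/

/-- A ⋆-homomorphism which is dominated by a ⋆-homomorphism `j` with dense range factors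
through `j`. -/
theorem exists_starAlgHom_extension {R : Type*} [Ring R] [StarRing R] [Algebra ℂ R] [StarModule ℂ R]
    {E A : Type u} [CStarAlgebra E] [CStarAlgebra A] (j : R →⋆ₐ[ℂ] E) (hj : DenseRange j)
    (f : R →⋆ₐ[ℂ] A) (hf : ∀ x, ‖f x‖ ≤ ‖j x‖) : ∃ g : E →⋆ₐ[ℂ] A, ∀ x, g (j x) = f x := by
  obtain ⟨g, hg⟩ := exists_starAlgHom_of_graph (j.prod f).range
    (by rintro _ ⟨x, rfl⟩; exact hf x)
    (hj.mono (by rintro _ ⟨x, rfl⟩; exact ⟨_, ⟨x, rfl⟩, rfl⟩))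
  exact ⟨g, fun x => hg _ ⟨x, rfl⟩⟩

theorem norm_realPart_sub_le {A : Type u} [CStarAlgebra A] (x y : A) :
    ‖realPart x - realPart y‖ ≤ ‖x - y‖ := by
  rw [← map_sub]
  exact realPart.norm_le _

/-- A ⋆-homomorphism is surjective as soon as its range contains a dense set of self-adjoint
elements. -/
theorem surjective_of_dense_selfAdjoint {A B : Type u} [CStarAlgebra A] [CStarAlgebra B]
    (f : A →⋆ₐ[ℂ] B) {D : Set (selfAdjoint B)} (hD : Dense D) (h : ∀ b ∈ D, ∃ a, f a = b) :
    Function.Surjective f := by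
  refine surjective_of_denseRange f ?_
  have := dense_of_dense_selfAdjoint (S := f.range) hD h
  exact this.mono fun x hx => hx

namespace TunnelSeq

variable {F : ℝ≥0 × ℝ≥0 × ℝ≥0 × ℝ≥0 → ℝ≥0} {T : TunnelSeq.{u} F} {E : Type u} [CStarAlgebra E]

/-- The map induced by a ⋆-homomorphism on coherent self-adjoint sequences. -/
noncomputable def cohMap (j : T.sub →⋆ₐ[ℂ] E) : T.coh →ₗ[ℝ] selfAdjoint E where
  toFun v := ⟨j ⟨v.1.1, coe_mem_sub v.2⟩, by
    rw [selfAdjoint.mem_iff, ← map_star]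
    exact congrArg j (Subtype.ext v.1.2)⟩
  map_add' v w := Subtype.ext (map_add j ⟨v.1.1, coe_mem_sub v.2⟩ ⟨w.1.1, coe_mem_sub w.2⟩)
  map_smul' r v := Subtype.ext (by
    have h := map_smul j (r : ℂ) ⟨v.1.1, coe_mem_sub v.2⟩
    change _ = r • j ⟨v.1.1, coe_mem_sub v.2⟩
    rw [← Complex.coe_smul, ← h]
    exact congrArg j (Subtype.ext (Complex.coe_smul r v.1.1).symm))

theorem coe_cohMap (j : T.sub →⋆ₐ[ℂ] E) (v : T.coh) :
    (cohMap j v : E) = j ⟨v.1.1, coe_mem_sub v.2⟩ := rfl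

theorem norm_cohMap (j : T.sub →⋆ₐ[ℂ] E) (v : T.coh) :
    ‖cohMap j v‖ = ‖j ⟨v.1.1, coe_mem_sub v.2⟩‖ := rfl

theorem cohMap_one (j : T.sub →⋆ₐ[ℂ] E) : cohMap j ⟨1, one_mem_coh⟩ = 1 :=
  Subtype.ext (map_one j)

variable (T) in
/-- The supremum of the Lip-norms, on coherent sequences. -/
noncomputable def cohLip : ExtSeminorm T.coh where
  toFun v := T.seqLip v.1
  map_smul' r v := T.seqLip.map_smul' r v.1
  map_add_le' v w := T.seqLip.map_add_le' v.1 w.1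

theorem cohMap_realPart (j : T.sub →⋆ₐ[ℂ] E) (x : T.sub) :
    cohMap j ⟨realPart x.1, x.2.1⟩ = realPart (j x) := by
  refine Subtype.ext ?_
  rw [realPart_apply_coe, ← map_star, ← map_add, ← Complex.coe_smul, ← map_smul, coe_cohMap]
  refine congrArg j (Subtype.ext ?_)
  change (realPart x.1 : T.Alg) = (((2 : ℝ)⁻¹ : ℝ) : ℂ) • (x.1 + star x.1)
  rw [realPart_apply_coe, Complex.coe_smul]

theorem cohMap_imaginaryPart (j : T.sub →⋆ₐ[ℂ] E) (x : T.sub) :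
    cohMap j ⟨imaginaryPart x.1, x.2.2⟩ = imaginaryPart (j x) := by
  refine Subtype.ext ?_
  rw [imaginaryPart_apply_coe, ← map_star, ← map_sub, ← Complex.coe_smul, ← map_smul, ← map_smul,
    coe_cohMap]
  refine congrArg j (Subtype.ext ?_)
  change (imaginaryPart x.1 : T.Alg) = -Complex.I • ((((2 : ℝ)⁻¹ : ℝ) : ℂ) • (x.1 - star x.1))
  rw [imaginaryPart_apply_coe, Complex.coe_smul]

theorem cohMap_seqJl (j : T.sub →⋆ₐ[ℂ] E) (i : Bool) (v w : T.coh) :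
    cohMap j ⟨seqJl i v.1 w.1, seqJl_mem_coh i v.2 w.2⟩ = jl i (cohMap j v) (cohMap j w) := by
  have h : (cohMap j v : E) * cohMap j w =
      j (⟨v.1.1, coe_mem_sub v.2⟩ * ⟨w.1.1, coe_mem_sub w.2⟩) := (map_mul j _ _).symm
  cases i
  · change _ = lie (cohMap j v) (cohMap j w)
    rw [← imaginaryPart_mul, h, ← cohMap_imaginaryPart]
    rfl
  · change _ = jordan (cohMap j v) (cohMap j w)
    rw [← realPart_mul, h, ← cohMap_realPart]
    rfl

theorem dense_range_cohMap {j : T.sub →⋆ₐ[ℂ] E} (hj : DenseRange j) :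
    Dense (cohMap j '' {v | T.cohLip v < ∞}) := by
  have hc : Continuous fun x : E => realPart x := by
    refine LipschitzWith.continuous (K := 1) (LipschitzWith.of_dist_le_mul fun x y => ?_)
    rw [dist_eq_norm, dist_eq_norm, NNReal.coe_one, one_mul]
    exact norm_realPart_sub_le x y
  have hs : Function.Surjective fun x : E => realPart x := fun a =>
    ⟨a, selfAdjoint.realPart_coe⟩
  refine (hs.denseRange.comp hj hc).mono ?_
  rintro _ ⟨x, rfl⟩
  exact ⟨⟨realPart x.1, x.2.1⟩, x.2.1.2, cohMap_realPart j x⟩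

/-- The Lip-norms of the limit objects. The coordinates of a coherent sequence of bounded Lip-norm
are controlled, up to an arbitrarily small error, by finitely many of them. -/
theorem isLipNorm_imageLip [Nontrivial E] {j : T.sub →⋆ₐ[ℂ] E} (hj : DenseRange j)
    (hle : ∀ x, ‖j x‖ ≤ tailSup 0 x)
    (hge : ∀ (v : T.coh) (l : ℝ≥0), T.cohLip v ≤ l → ∀ k, ‖coord k v.1‖ ≤ ‖cohMap j v‖ + l) :
    IsLipNorm (imageLip (cohMap j) T.cohLip) := by
  have hle' : ∀ (v : T.coh) (c : ℝ), (∀ k, ‖coord k v.1‖ ≤ c) → ‖cohMap j v‖ ≤ c := fun v c h =>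
    (hle _).trans (tailSup_le fun k _ => h k)
  have hn := (T.isTunnel 0).mid.nontrivial
  obtain ⟨C, hC⟩ := (T.isTunnel 0).mid.isLipNorm.exists_norm_sub_le
  refine DualPropinquity.isLipNorm_imageLip (dense_range_cohMap hj)
    ⟨⟨1, one_mem_coh⟩, seqLip_one, cohMap_one j⟩ (C * 2 + 2) (fun v hv => ?_) fun R => ?_
  · obtain ⟨t, ht⟩ := hC (coord 0 v.1) 2 ((lip_coord_le 0 v.1).trans hv)
    refine ⟨t, ?_⟩
    have e : cohMap j v - t • 1 = cohMap j (v - t • ⟨1, one_mem_coh⟩) := by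
      rw [map_sub, map_smul, cohMap_one]
    rw [e]
    set w : T.coh := v - t • ⟨1, one_mem_coh⟩
    have hw0 : coord 0 w.1 = coord 0 v.1 - t • 1 := by
      change coord 0 (v.1 - t • 1) = _
      rw [coord_sub, coord_smul, coord_one]
    have hw : T.seqLip w.1 ≤ (2 : ℝ≥0) := by
      change T.seqLip (v.1 - t • 1) ≤ _
      rw [T.seqLip.map_sub_eq (by rw [T.seqLip.map_smul', seqLip_one, mul_zero])]
      exact hv
    refine hle' w _ fun k => ?_
    have h2 := norm_coord_le w.2.1 hw k.zero_le le_rfl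
    rw [hw0, pow_zero, one_mul] at h2
    exact h2.trans (add_le_add ht le_rfl)
  · refine totallyBounded_image_of_approx.{u} fun η hη => ?_
    obtain ⟨m, hm⟩ := exists_pow_lt_of_lt_one (show (0 : ℝ) < η / 4 by positivity)
      (show (1 / 2 : ℝ) < 1 by norm_num)
    refine ⟨∀ k : Fin (m + 1), selfAdjoint (T.tun k).mid, inferInstance,
      fun v k => coord k v.1, totallyBounded_pi fun k => ?_, ?_⟩
    · have := (T.isTunnel k).mid.nontrivial
      refine ((T.isTunnel k).mid.isLipNorm.totallyBounded 2 (R + 2)).subset ?_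
      rintro _ ⟨_, ⟨v, hv, rfl⟩, rfl⟩
      exact ⟨(lip_coord_le _ v.1).trans hv.1, (hge v 2 hv.1 k).trans (add_le_add hv.2 le_rfl)⟩
    · intro v hv w hw
      set g : T.coh → ∀ k : Fin (m + 1), selfAdjoint (T.tun k).mid := fun v k => coord k v.1
      change dist (cohMap j v) (cohMap j w) ≤ dist (g v) (g w) + η
      rw [dist_eq_norm, ← map_sub]
      have hfin : ∀ k, k ≤ m → ‖coord k (v - w).1‖ ≤ dist (g v) (g w) := fun k hk => by
        have := dist_le_pi_dist (g v) (g w) ⟨k, Nat.lt_succ_of_le hk⟩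
        rwa [dist_eq_norm] at this
      have hlip : T.seqLip (v - w).1 ≤ (4 : ℝ≥0) := by
        refine (T.seqLip.map_sub_le v.1 w.1).trans ((add_le_add hv.1 hw.1).trans ?_)
        norm_num
      refine hle' _ _ fun k => ?_
      rcases le_total k m with hk | hk
      · exact (hfin k hk).trans (by linarith)
      · have h1 := norm_coord_le (v - w).2.1 hlip hk le_rfl
        have h2 := hfin m le_rfl
        rw [NNReal.coe_ofNat] at h1
        linarith

theorem tailSup_le_coord {v : T.coh} {l : ℝ≥0} (hl : T.cohLip v ≤ l) (N : ℕ) :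
    tailSup N ⟨v.1.1, coe_mem_sub v.2⟩ ≤ ‖coord N v.1‖ + (1 / 2) ^ N * l :=
  tailSup_le fun _ hk => norm_coord_le v.2.1 hl hk le_rfl

theorem coord_le_tailSup {v : T.coh} {l : ℝ≥0} (hl : T.cohLip v ≤ l) (k N : ℕ) :
    ‖coord k v.1‖ ≤ tailSup N ⟨v.1.1, coe_mem_sub v.2⟩ + l := by
  have h := norm_coord_le v.2.1 hl k.zero_le N.zero_le
  rw [pow_zero, one_mul] at h
  exact h.trans (add_le_add (norm_le_tailSup (T := T) le_rfl ⟨v.1.1, coe_mem_sub v.2⟩) le_rfl)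

/-- On elements of bounded Lip-norm, the seminorms of the tails converge uniformly to their limit.
-/
theorem tailSup_le_tailLim {v : T.coh} {l : ℝ≥0} (hl : T.cohLip v ≤ l) (N : ℕ) :
    tailSup N ⟨v.1.1, coe_mem_sub v.2⟩ ≤
      tailLim ⟨v.1.1, coe_mem_sub v.2⟩ + (1 / 2) ^ N * l := by
  refine ge_of_tendsto ((tendsto_tailSup _).add_const _) ?_
  filter_upwards [eventually_ge_atTop N] with m hm
  refine tailSup_le fun k hk => (norm_coord_le v.2.1 hl hk hm).trans ?_
  exact add_le_add (norm_le_tailSup (T := T) le_rfl ⟨v.1.1, coe_mem_sub v.2⟩) le_rfl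

theorem coord_le_tailLim {v : T.coh} {l : ℝ≥0} (hl : T.cohLip v ≤ l) (k : ℕ) :
    ‖coord k v.1‖ ≤ tailLim ⟨v.1.1, coe_mem_sub v.2⟩ + l :=
  ge_of_tendsto' ((tendsto_tailSup _).add_const _) fun N => coord_le_tailSup hl k N

theorem continuous_uncurry_jl (i : Bool) :
    Continuous fun z : selfAdjoint E × selfAdjoint E => jl i z.1 z.2 :=
  continuous_iff_continuousAt.2 fun z => tendsto_jl i (continuous_fst.tendsto z)
    (continuous_snd.tendsto z)

/-- The quasi-Leibniz property of the completion for the norm of the tail from `N` on. A product of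
coherent sequences has the right Lip-norms from `N` on, and can be changed below `N`. -/
theorem imageLip_jl_le {N : ℕ} {j : T.sub →⋆ₐ[ℂ] E} (hn : ∀ x, ‖j x‖ = tailSup N x)
    (i : Bool) {a b : selfAdjoint E} {l m l' m' x y c : ℝ≥0}
    (ha : imageLip (cohMap j) T.cohLip a = l) (hb : imageLip (cohMap j) T.cohLip b = m)
    (hl : l < l') (hm : m < m') (hx : ‖a‖₊ < x) (hy : ‖b‖₊ < y) (hc : F (x, y, l', m') < c) :
    imageLip (cohMap j) T.cohLip (jl i a b) ≤ c := by
  have hA := mem_closure_of_imageLip_lt (R' := (x : ℝ)) hx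
    (ha.trans_lt (ENNReal.coe_lt_coe.2 hl)) le_rfl
  have hB := mem_closure_of_imageLip_lt (R' := (y : ℝ)) hy
    (hb.trans_lt (ENNReal.coe_lt_coe.2 hm)) le_rfl
  refine imageLip_le (map_mem_closure₂ (continuous_uncurry_jl i) hA hB ?_)
  rintro _ ⟨v, ⟨hv, hvn⟩, rfl⟩ _ ⟨w, ⟨hw, hwn⟩, rfl⟩
  rw [norm_cohMap, hn] at hvn hwn
  have hprod := seqJl_mem_coh i v.2 w.2
  obtain ⟨u, hu, huv, huc⟩ := exists_coh_eq hprod.1 N (c := c) fun k hk => by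
    rw [coord_seqJl]
    refine ((T.isTunnel k).mid.jl_le_of_le T.mono i ?_ ?_ ((lip_coord_le k v.1).trans hv)
      ((lip_coord_le k w.1).trans hw)).trans_lt (ENNReal.coe_lt_coe.2 hc)
    · exact (norm_le_tailSup (T := T) hk ⟨v.1.1, coe_mem_sub v.2⟩).trans hvn
    · exact (norm_le_tailSup (T := T) hk ⟨w.1.1, coe_mem_sub w.2⟩).trans hwn
  refine ⟨⟨u, hu⟩, huc, ?_⟩
  rw [← cohMap_seqJl, ← sub_eq_zero, ← map_sub, ← norm_le_zero_iff, norm_cohMap, hn]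
  refine tailSup_le fun k hk => ?_
  change ‖coord k (u - seqJl i v.1 w.1)‖ ≤ 0
  rw [coord_sub, huv k hk, sub_self, norm_zero]

/-- A bound by values of a continuous function at points slightly above a given one. -/
theorem le_of_forall_gt_of_continuous (hF : Continuous F) {x y l m : ℝ≥0} {z : ℝ≥0∞}
    (h : ∀ ρ : ℝ≥0, 0 < ρ → z ≤ (F (x + ρ, y + ρ, l + ρ, m + ρ) + ρ : ℝ≥0)) :
    z ≤ F (x, y, l, m) := by
  have hcont : Continuous fun ρ : ℝ≥0 =>
      ((F (x + ρ, y + ρ, l + ρ, m + ρ) + ρ : ℝ≥0) : ℝ≥0∞) := by fun_prop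
  have h1 := (hcont.tendsto 0).mono_left (nhdsWithin_le_nhds (s := Set.Ioi 0))
  simp only [add_zero] at h1
  exact ge_of_tendsto h1 (eventually_nhdsWithin_of_forall fun ρ hρ => h ρ hρ)

theorem isQQCMS_tailSup (hF : Continuous F) {N : ℕ} {j : T.sub →⋆ₐ[ℂ] E} (hj : DenseRange j)
    (hn : ∀ x, ‖j x‖ = tailSup N x) (hE : Nontrivial E) :
    IsQQCMS F ⟨E, imageLip (cohMap j) T.cohLip⟩ := by
  refine IsQQCMS.of_jl hE (isLipNorm_imageLip hj (fun x => ?_) fun v l hl k => ?_)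
    isClosed_imageLip_le fun i a b l m hl hm => ?_
  · rw [hn]
    exact tailSup_antitone x N.zero_le
  · rw [norm_cohMap, hn]
    exact coord_le_tailSup hl k N
  · refine le_of_forall_gt_of_continuous hF fun ρ hρ => ?_
    exact imageLip_jl_le hn i hl hm (lt_add_of_pos_right _ hρ) (lt_add_of_pos_right _ hρ)
      (lt_add_of_pos_right _ hρ) (lt_add_of_pos_right _ hρ) (lt_add_of_pos_right _ hρ)

/-! ### The limit of a sequence of tunnels -/

/-- The limit of a sequence of tunnels: the completion of the coherent sequences for the limit of
the norms, with the Lip-norm induced by the supremum of the Lip-norms. The completion for the norm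
of the tail from `N` on is a tunnel from the `N`-th space to the limit. -/
theorem exists_limit (hF : Continuous F) (T : TunnelSeq.{u} F) : ∃ 𝔉 : Pair.{u}, IsQQCMS F 𝔉 ∧
    ∀ N, ∃ τ : PreTunnel (T.pt N) 𝔉, IsTunnel F τ ∧
      τ.extent ≤ (2 * (1 / 2) ^ N : ℝ≥0) := by
  obtain ⟨L, instL, jL, hjL, hnL⟩ := (isCStarSeminorm_tailLim (T := T)).exists_completion
  choose E instE jE hjE hnE using fun N => (isCStarSeminorm_tailSup (T := T) N).exists_completion
  have hmid := fun k => (T.isTunnel k).mid.nontrivial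
  have hpt := fun k => (T.isTunnel k).source.nontrivial
  have hone : ∀ N, tailSup N (1 : T.sub) = 1 := fun N => by
    refine le_antisymm (tailSup_le fun k _ => ?_) ?_
    · exact (CStarRing.norm_one (E := (T.tun k).mid)).le
    · exact (CStarRing.norm_one (E := (T.tun N).mid)).ge.trans
        (norm_le_tailSup (T := T) le_rfl (1 : T.sub))
  have hEnt : ∀ N, Nontrivial (E N) := fun N => by
    refine ⟨1, 0, fun h => ?_⟩
    have := hnE N 1
    rw [map_one, h, norm_zero, hone N] at this
    exact zero_ne_one this
  have hLnt : Nontrivial L := by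
    refine ⟨1, 0, fun h => ?_⟩
    have h1 := hnL 1
    have h2 : tailLim (1 : T.sub) = 1 := by simp [tailLim, hone]
    rw [map_one, h, norm_zero, h2] at h1
    exact zero_ne_one h1
  have hEq : ∀ N, IsQQCMS F ⟨E N, imageLip (cohMap (jE N)) T.cohLip⟩ := fun N =>
    isQQCMS_tailSup hF (hjE N) (hnE N) (hEnt N)
  have hLL : IsLipNorm (imageLip (cohMap jL) T.cohLip) :=
    isLipNorm_imageLip hjL (fun x => (hnL x).trans_le (tailLim_le 0 x)) fun v l hl k => by
      rw [norm_cohMap, hnL]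
      exact coord_le_tailLim hl k
  -- the quotient maps to the limit
  choose ρ hρ using fun N => exists_starAlgHom_extension (jE N) (hjE N) jL fun x => by
    rw [hnL, hnE]
    exact tailLim_le N x
  have hρ' : ∀ N v, saMap (ρ N) (cohMap (jE N) v) = cohMap jL v := fun N v =>
    Subtype.ext (hρ N _)
  have hρb : ∀ N, NormBound (imageLip (cohMap (jE N)) T.cohLip) (ρ N) ((1 / 2) ^ N) := fun N =>
    normBound_imageLip fun v l hl => by
      rw [hρ', norm_cohMap, norm_cohMap, hnL, hnE]
      have := tailSup_le_tailLim hl N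
      push_cast
      exact this
  have hρq : ∀ N, IsQuotient (imageLip (cohMap (jE N)) T.cohLip) (ρ N)
      (imageLip (cohMap jL) T.cohLip) := fun N =>
    isQuotient_imageLip (hEq N).isLipNorm (hρb N) (hρ' N)
  have hρs : ∀ N, Function.Surjective (ρ N) := fun N =>
    surjective_of_denseRange (ρ N) (hjL.mono (by rintro _ ⟨x, rfl⟩; exact ⟨jE N x, hρ N x⟩))
  -- the quotient maps to the spaces of the sequence
  let ev : ∀ N, T.sub →⋆ₐ[ℂ] T.pt N := fun N => (T.tun N).left.comp
    { toFun := fun x => x.1 N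
      map_one' := rfl
      map_mul' := fun _ _ => rfl
      map_zero' := rfl
      map_add' := fun _ _ => rfl
      commutes' := fun _ => rfl
      map_star' := fun _ => rfl }
  choose π hπ using fun N => exists_starAlgHom_extension (jE N) (hjE N) (ev N) fun x => by
    rw [hnE]
    exact (NonUnitalStarAlgHom.norm_apply_le (T.tun N).left (x.1 N)).trans
      (norm_le_tailSup (T := T) le_rfl x)
  have hπ' : ∀ N v, saMap (π N) (cohMap (jE N) v) = saMap (T.tun N).left (coord N v.1) :=
    fun N v => Subtype.ext (hπ N _)
  have hπb : ∀ N, NormBound (imageLip (cohMap (jE N)) T.cohLip) (π N) (2 * (1 / 2) ^ N) :=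
    fun N => normBound_imageLip fun v l hl => by
      rw [hπ', norm_cohMap, hnE]
      have h1 := tailSup_le_coord hl N
      have h2 := ((T.isTunnel N).extent_le_iff.1 (T.extent_le N)).1 _ _
        ((lip_coord_le N v.1).trans hl)
      have p : (0 : ℝ) ≤ (1 / 2) ^ N * l := by positivity
      rw [pow_succ] at h2
      push_cast at h2 ⊢
      linarith
  have hπl : ∀ N (b : selfAdjoint (T.pt N)) (l : ℝ≥0), (T.pt N).lip b < l →
      ∃ d, saMap (π N) d = b ∧ imageLip (cohMap (jE N)) T.cohLip d ≤ l := fun N b l hb => by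
    obtain ⟨v, hv, hvb, hvl⟩ := exists_coh_lift N hb
    exact ⟨cohMap (jE N) ⟨v, hv⟩, (hπ' N _).trans hvb, (imageLip_apply_le _).trans hvl⟩
  have hπq : ∀ N, IsQuotient (imageLip (cohMap (jE N)) T.cohLip) (π N) (T.pt N).lip := fun N =>
    isQuotient_of_lift (lip_saMap_le_imageLip (T.isTunnel N).source.isClosed fun v => by
      rw [hπ']
      exact ((T.isTunnel N).left_quotient.le _).trans (lip_coord_le N v.1)) (hπl N)
  have hπs : ∀ N, Function.Surjective (π N) := fun N =>
    surjective_of_dense_selfAdjoint (π N) (T.isTunnel N).source.isLipNorm.dense_dom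
      fun b hb => by
        obtain ⟨l, hbl, -⟩ := ENNReal.lt_iff_exists_nnreal_btwn.1 (show (T.pt N).lip b < ∞ from hb)
        obtain ⟨d, hd, -⟩ := hπl N b l hbl
        exact ⟨d, congrArg Subtype.val hd⟩
  -- the quasi-Leibniz property of the limit comes from the tunnels, whose quotient maps are almost
  -- isometric on elements of bounded Lip-norm
  have hLq : IsQQCMS F ⟨L, imageLip (cohMap jL) T.cohLip⟩ := by
    refine IsQQCMS.of_jl hLnt hLL isClosed_imageLip_le fun i a b l m hl hm => ?_
    refine TunnelSeq.le_of_forall_gt_of_continuous hF fun r hr => ?_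
    obtain ⟨N, hN⟩ := exists_pow_lt_of_lt_one (show (0 : ℝ) < r / (l + m + r + 1) by positivity)
      (show (1 / 2 : ℝ) < 1 by norm_num)
    rw [lt_div_iff₀ (by positivity)] at hN
    have lift : ∀ (a : selfAdjoint L) (l : ℝ≥0), imageLip (cohMap jL) T.cohLip a = l →
        (1 / 2 : ℝ) ^ N * (l + r) ≤ r → ∃ d, saMap (ρ N) d = a ∧
          imageLip (cohMap (jE N)) T.cohLip d ≤ (l + r : ℝ≥0) ∧ ‖d‖₊ ≤ ‖a‖₊ + r := by
      intro a l hl hle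
      obtain ⟨d, hd, hdl⟩ := (hρq N).exists_lift (a := a) (l := (l + r : ℝ≥0))
        (hl.trans_lt (ENNReal.coe_lt_coe.2 (lt_add_of_pos_right l hr)))
      refine ⟨d, hd, hdl.le, ?_⟩
      have := hρb N d _ hdl.le
      rw [hd] at this
      rw [← NNReal.coe_le_coe]
      push_cast at this ⊢
      exact this.trans (add_le_add le_rfl hle)
    have hp : (0 : ℝ) ≤ (1 / 2) ^ N := by positivity
    obtain ⟨d, hd, hdl, hdn⟩ := lift a l hl (by nlinarith [l.2, m.2, r.2])
    obtain ⟨e, he, hel, hen⟩ := lift b m hm (by nlinarith [l.2, m.2, r.2])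
    have h1 := (hEq N).jl_le_of_le T.mono i hdn hen hdl hel
    have h2 := (hρq N).le (jl i d e)
    rw [saMap_jl, hd, he] at h2
    exact (h2.trans h1).trans (ENNReal.coe_le_coe.2 le_self_add)
  refine ⟨⟨L, imageLip (cohMap jL) T.cohLip⟩, hLq, fun N => ?_⟩
  let τ : PreTunnel (T.pt N) ⟨L, imageLip (cohMap jL) T.cohLip⟩ :=
    ⟨⟨E N, imageLip (cohMap (jE N)) T.cohLip⟩, π N, ρ N⟩
  have hτ : IsTunnel F τ := ⟨(T.isTunnel N).source, hLq, hEq N, hπs N, hρs N, hπq N, hρq N⟩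
  refine ⟨τ, hτ, hτ.extent_le_iff.2 ⟨hπb N, fun d l hd => (hρb N d l hd).trans ?_⟩⟩
  have p : (0 : ℝ) ≤ (1 / 2) ^ N * l := by positivity
  push_cast
  linarith

end TunnelSeq

/-- A Cauchy sequence has a subsequence joined by tunnels of rapidly decreasing extents, and
converges to the limit of these tunnels. -/
theorem isCompleteOn_propinquity {F : ℝ≥0 × ℝ≥0 × ℝ≥0 × ℝ≥0 → ℝ≥0} (hF : Permissible F)
    (hc : Continuous F) :
    IsCompleteOn {𝔄 : Pair.{u} | IsQQCMS F 𝔄} (propinquity (allTunnels F)) := by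
  intro 𝔄 hA hcauchy
  have hpos : ∀ k : ℕ, (0 : ℝ≥0∞) < (((1 / 2 : ℝ≥0) ^ (k + 1) : ℝ≥0) : ℝ≥0∞) := fun k =>
    ENNReal.coe_pos.2 (by positivity)
  choose N hN using fun k => hcauchy _ (hpos k)
  -- a subsequence with consecutive distances below `2⁻¹`, `2⁻²`, …
  let φ : ℕ → ℕ := fun k => ∑ i ∈ Finset.range (k + 1), N i
  have hφ : ∀ k, N k ≤ φ k := fun k =>
    Finset.single_le_sum (f := N) (fun _ _ => Nat.zero_le _) (Finset.self_mem_range_succ k)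
  have hφ' : ∀ k, N k ≤ φ (k + 1) := fun k =>
    Finset.single_le_sum (f := N) (fun _ _ => Nat.zero_le _) (Finset.mem_range.2 (by omega))
  choose τ hτ hext using fun k => exists_tunnel_extent_lt (hN k _ (hφ k) _ (hφ' k))
  let T : TunnelSeq F := ⟨fun k => 𝔄 (φ k), τ, hF.1, hτ, fun k => (hext k).le⟩
  obtain ⟨𝔉, h𝔉, hlim⟩ := T.exists_limit hc
  refine ⟨𝔉, h𝔉, ?_⟩
  have happ := isAppropriate_allTunnels.{u} hF
  have hbound : ∀ k n, N k ≤ n → propinquity (allTunnels F) (𝔄 n) 𝔉 ≤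
      ((1 / 2 : ℝ≥0) ^ (k + 1) + 2 * (1 / 2) ^ k : ℝ≥0) := fun k n hn => by
    obtain ⟨σ, hσ, hσe⟩ := hlim k
    refine (happ.propinquity_triangle _ (𝔄 (φ k)) _).trans ?_
    rw [ENNReal.coe_add]
    exact add_le_add (hN k _ hn _ (hφ k)).le ((iInf₂_le σ hσ).trans hσe)
  have h0 : Tendsto (fun k => (((1 / 2 : ℝ≥0) ^ (k + 1) + 2 * (1 / 2) ^ k : ℝ≥0) : ℝ≥0∞)) atTop
      (𝓝 0) := by
    have h1 : Tendsto (fun k : ℕ => (1 / 2 : ℝ≥0) ^ k) atTop (𝓝 0) :=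
      tendsto_pow_atTop_nhds_zero_of_lt_one (by norm_num) (by
        rw [one_div]; exact inv_lt_one_of_one_lt₀ (by norm_num))
    have h2 := ((tendsto_add_atTop_iff_nat 1).2 h1).add (h1.const_mul 2)
    rw [mul_zero, add_zero] at h2
    exact ENNReal.tendsto_coe.2 h2
  rw [ENNReal.tendsto_nhds_zero] at h0 ⊢
  intro ε hε
  obtain ⟨k, hk⟩ := (h0 ε hε).exists
  filter_upwards [eventually_ge_atTop (N k)] with n hn
  exact (hbound k n hn).trans hk

end DualPropinquity

theorem mainTheorem6 (F : ℝ≥0 × ℝ≥0 × ℝ≥0 × ℝ≥0 → ℝ≥0) (hF : Permissible F) :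
    (∀ (𝒞 : Set Pair.{u}) (𝒯 : TunnelClass.{u}), 𝒞.Nonempty → (∀ 𝔄 ∈ 𝒞, IsQQCMS F 𝔄) →
      IsAppropriate F 𝒞 𝒯 →
        IsMetricOn 𝒞 (propinquity 𝒯) ∧
        ∀ 𝔄 ∈ 𝒞, ∀ 𝔅 ∈ 𝒞, distq 𝔄 𝔅 ≤ propinquity 𝒯 𝔄 𝔅) ∧
    (∀ 𝔄 𝔅 : Pair.{u}, IsQQCMS F 𝔄 → IsQQCMS F 𝔅 →
      propinquity (allTunnels F) 𝔄 𝔅 ≤ max (mkDiam 𝔄.lip) (mkDiam 𝔅.lip)) ∧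
    (∀ (X Y : Type u) [MetricSpace X] [CompactSpace X] [Nonempty X]
        [MetricSpace Y] [CompactSpace Y] [Nonempty Y],
      propinquity (allTunnels F) (classical X) (classical Y) ≤
        ENNReal.ofReal (GromovHausdorff.ghDist X Y)) ∧
    (Continuous F →
      IsMetricOn {𝔄 : Pair.{u} | IsQQCMS F 𝔄} (propinquity (allTunnels F)) ∧
      IsCompleteOn {𝔄 : Pair.{u} | IsQQCMS F 𝔄} (propinquity (allTunnels F))) := by
  exact ⟨fun 𝒞 𝒯 _ _ h => ⟨h.isMetricOn hF, fun 𝔄 _ 𝔅 _ => h.distq_le_propinquity 𝔄 𝔅⟩,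
    fun 𝔄 𝔅 hA hB => propinquity_le_max_mkDiam hF hA hB,
    fun X Y _ _ _ _ _ _ => propinquity_classical_le hF X Y,
    fun hc => ⟨(isAppropriate_allTunnels hF).isMetricOn hF, isCompleteOn_propinquity hF hc⟩⟩
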